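/- Let $k,M>0$ and let $r=r(r^\star)$, $r^\star=v-u<0$, be the solution of $\frac{dr}{dr^\star}=1-\frac{2M}{r}+k^2r^2$ with $r\to\infty$ as $r^\star\to 0^-$. Let $\mathcal M=\{(u,v):0\le v\le u\}\times S^2$ with boundary component $\mathcal I=\{u=v\}$, and let $$g=-4\Omega^2\,du\,dv+\slashed g_{AB}(d\theta^A-b^A du)(d\theta^B-b^B du)$$ be a smooth metric in double null gauge on $\mathcal M\setminus\mathcal I$, where $\Omega>0$, $b$ is a vector field tangent to the spheres $S^2_{u,v}$, and $\slashed g$ is a Riemannian metric on each $S^2_{u,v}$. Assume that $\mathrm{Ric}(g)=-3k^2g$ on $\mathcal M\setminus\mathcal I$ and that $(u-v)^2g$ extends to a smooth (nondegenerate, hence Lorentzian) metric on $\mathcal M$. Put $e_3=\Omega^{-1}(\partial_u+b^A\partial_A)$, $e_4=\Omega^{-1}\partial_v$, $e_A=\partial_{\theta^A}$. Let $\nabla$ be the Levi-Civita connection of $g$, $W$ its Weyl tensor (with the curvature convention for which round spheres satisfy $\mathrm{Rm}(X,Y,X,Y)>0$ for linearly independent $X,Y$), and ${}^\star W$ the Hodge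 dual of $W$. Define $$\chi_{AB}=g(\nabla_A e_4,e_B),\quad \underline\chi_{AB}=g(\nabla_A e_3,e_B),\quad \eta_A=-\tfrac12 g(\nabla_{e_3}e_A,e_4),\quad \underline\eta_A=-\tfrac12 g(\nabla_{e_4}e_A,e_3),$$ $$\omega=\tfrac12\Omega\, g(\nabla_{e_4}e_3,e_4),\qquad \underline\omega=\tfrac12\Omega\, g(\nabla_{e_3}e_4,e_3),$$ $$\alpha_{AB}=W(e_A,e_4,e_B,e_4),\quad \underline\alpha_{AB}=W(e_A,e_3,e_B,e_3),\quad \beta_A=\tfrac12W(e_A,e_4,e_3,e_4),\quad \underline\beta_A=\tfrac12W(e_A,e_3,e_3,e_4),$$ $$\rho=\tfrac14W(e_4,e_3,e_4,e_3),\qquad \sigma=\tfrac14{}^\star W(e_4,e_3,e_4,e_3),$$ and let $\mathrm{tr}$ and a hat denote the trace and the tracefree part with respect to $\slashed g$. Then the following quantities extend smoothly to $\mathcal I$, that is, to $\mathcal M$. For the tensorial ones this means that, locally on $S^2$, their components with respect to every $g$-orthonormal frame $(E_1,E_2)$ of the spheres $S^2_{u,v}$ for which $(u-v)^{-1}E_1$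 and $(u-v)^{-1}E_2$ extend smoothly to $\mathcal I$ themselves extend smoothly to $\mathcal I$: $$r^2\big(k^2(u-v)^2\Omega^2-1\big),\qquad r^{-1}b,$$ $$\Omega\,\mathrm{tr}\chi-\tfrac{2}{u-v},\quad \Omega\,\mathrm{tr}\underline\chi+\tfrac{2}{u-v},\quad r\hat\chi,\quad r\hat{\underline\chi},\quad r^2\eta,\quad r^2\underline\eta,\quad r\big(\omega-\tfrac1{u-v}\big),\quad r\big(\underline\omega+\tfrac1{u-v}\big),$$ $$r\big(\Omega\,\mathrm{tr}\chi-\Omega\,\mathrm{tr}\underline\chi-\tfrac4{u-v}\big),\quad r^2(\hat\chi-\hat{\underline\chi}),\quad r^3(\eta+\underline\eta),\quad r^2(\omega+\underline\omega),$$ $$r^3\alpha,\quad r^3\underline\alpha,\quad r^3\beta,\quad r^3\underline\beta,\quad r^3\rho,\quad r^3\sigma.$$ -/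

import Mathlib

open scoped Manifold ContDiff

noncomputable section

namespace AAdS

/-! ## Tensor calculus in a coordinate patch of a 4-manifold

Coordinates are `x = (x 0, x 1, x 2, x 3)`, later `(u, v, θ¹, θ²)`. All derivatives are taken
within a domain `D`, so that they are one-sided at those boundary points that belong to `D`. -/

/-- Points of a four-dimensional coordinate patch. -/
abbrev Coord : Type := Fin 4 → ℝ

/-- Partial derivative `∂_i f` within `D`. -/
def pd (D : Set Coord) (i : Fin 4) (f : Coord → ℝ) (x : Coord) : ℝ :=
  fderivWithin ℝ f D x (Pi.single i 1)

/-- A field of bilinear forms, by its coordinate components `g_{ij}`. -/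
abbrev MetricField : Type := Coord → Matrix (Fin 4) (Fin 4) ℝ

/-- A vector field, by its coordinate components. -/
abbrev VField : Type := Coord → Fin 4 → ℝ

/-- Christoffel symbols `Γ^i_{jl} = ½ g^{im} (∂_j g_{ml} + ∂_l g_{mj} - ∂_m g_{jl})`. -/
def christoffel (D : Set Coord) (g : MetricField) (i j l : Fin 4) (x : Coord) : ℝ :=
  (1 / 2) * ∑ m, (g x)⁻¹ i m *
    (pd D j (fun y => g y m l) x + pd D l (fun y => g y m j) x - pd D m (fun y => g y j l) x)

/-- `R^i_{jlm} = ∂_l Γ^i_{mj} - ∂_m Γ^i_{lj} + Γ^i_{ln} Γ^n_{mj} - Γ^i_{mn} Γ^n_{lj}`. -/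
def riemannUp (D : Set Coord) (g : MetricField) (i j l m : Fin 4) (x : Coord) : ℝ :=
  pd D l (christoffel D g i m j) x - pd D m (christoffel D g i l j) x
    + ∑ n, (christoffel D g i l n x * christoffel D g n m j x
          - christoffel D g i m n x * christoffel D g n l j x)

/-- `R_{ijlm} = g_{in} R^n_{jlm}`. -/
def riemann (D : Set Coord) (g : MetricField) (i j l m : Fin 4) (x : Coord) : ℝ :=
  ∑ n, g x i n * riemannUp D g n j l m x

/-- `Ric_{jm} = R^i_{jim}`. -/
def ricci (D : Set Coord) (g : MetricField) (j m : Fin 4) (x : Coord) : ℝ :=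
  ∑ i, riemannUp D g i j i m x

/-- Scalar curvature. -/
def scalarCurv (D : Set Coord) (g : MetricField) (x : Coord) : ℝ :=
  ∑ i, ∑ j, (g x)⁻¹ i j * ricci D g i j x

/-- The Weyl tensor `W_{ijlm}` in dimension four. -/
def weyl (D : Set Coord) (g : MetricField) (i j l m : Fin 4) (x : Coord) : ℝ :=
  riemann D g i j l m x
    - (1 / 2) * (g x i l * ricci D g j m x - g x i m * ricci D g j l x
        - g x j l * ricci D g i m x + g x j m * ricci D g i l x)
    + (1 / 6) * scalarCurv D g x * (g x i l * g x j m - g x i m * g x j l)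

/-- The volume form `ε_{ijlm} = |det g|^{1/2} [ijlm]` of the coordinate orientation; the determinant
on the right-hand side is the Levi-Civita symbol `[ijlm]`. -/
def volForm (g : MetricField) (i j l m : Fin 4) (x : Coord) : ℝ :=
  Real.sqrt |(g x).det| * ((1 : Matrix (Fin 4) (Fin 4) ℝ).submatrix ![i, j, l, m] id).det

/-- The Hodge dual `⋆W_{ijlm} = ½ ε_{ijpq} g^{pa} g^{qb} W_{ablm}` of the Weyl tensor. -/
def weylDual (D : Set Coord) (g : MetricField) (i j l m : Fin 4) (x : Coord) : ℝ :=
  (1 / 2) * ∑ p, ∑ q, ∑ a, ∑ c,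
    volForm g i j p q x * (g x)⁻¹ p a * (g x)⁻¹ q c * weyl D g a c l m x

/-- `T(X, Y, Z, V)` for a covariant 4-tensor with components `T`. -/
def apply4 (T : Fin 4 → Fin 4 → Fin 4 → Fin 4 → Coord → ℝ) (X Y Z V : VField) (x : Coord) : ℝ :=
  ∑ i, ∑ j, ∑ l, ∑ m, T i j l m x * X x i * Y x j * Z x l * V x m

/-- `g(X, Y)`. -/
def ip (g : MetricField) (X Y : VField) (x : Coord) : ℝ :=
  ∑ i, ∑ j, g x i j * X x i * Y x j

/-- Levi-Civita covariant derivative `(∇_X Y)^i = X^j (∂_j Y^i + Γ^i_{jl} Y^l)`. -/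
def covD (D : Set Coord) (g : MetricField) (X Y : VField) : VField := fun x i =>
  ∑ j, X x j * (pd D j (fun y => Y y i) x + ∑ l, christoffel D g i j l x * Y x l)

/-! ## A metric in double null gauge in a coordinate patch `(u, v, θ¹, θ²)` -/

/-- The index of the angular coordinate `θ^A` among the four coordinates. -/
def ang (A : Fin 2) : Fin 4 := ![2, 3] A

/-- The functions `Ω`, `b^A`, `\slashed g_{AB}` in a coordinate patch with domain `D`. -/
structure PatchData where
  D : Set Coord
  Ω : Coord → ℝ
  b : Coord → Fin 2 → ℝ
  gs : Coord → Matrix (Fin 2) (Fin 2) ℝ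

namespace PatchData

/-- Components of the one-forms `dθ^A - b^A du`. -/
def coframe (P : PatchData) (A : Fin 2) (x : Coord) (i : Fin 4) : ℝ :=
  (if i = ang A then 1 else 0) - P.b x A * (if i = 0 then 1 else 0)

/-- The spacetime metric
`g = -4 Ω² du dv + \slashed g_{AB} (dθ^A - b^A du) (dθ^B - b^B du)`,
where `du dv` is the symmetric product, so that `g(∂_u, ∂_v) = -2 Ω²`. -/
def metric (P : PatchData) : MetricField := fun x => Matrix.of fun i j =>
  -2 * P.Ω x ^ 2 * ((if i = 0 then 1 else 0) * (if j = 1 then 1 else 0)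
      + (if i = 1 then 1 else 0) * (if j = 0 then 1 else 0))
    + ∑ A, ∑ B, P.gs x A B * P.coframe A x i * P.coframe B x j

/-- `e₃ = Ω⁻¹ (∂_u + b^A ∂_A)`. -/
def e3 (P : PatchData) : VField := fun x i =>
  (P.Ω x)⁻¹ * ((if i = 0 then 1 else 0) + ∑ A, P.b x A * (if i = ang A then 1 else 0))

/-- `e₄ = Ω⁻¹ ∂_v`. -/
def e4 (P : PatchData) : VField := fun x i => (P.Ω x)⁻¹ * (if i = 1 then 1 else 0)

/-- `e_A = ∂_A`. -/
def eS (A : Fin 2) : VField := fun _ i => if i = ang A then 1 else 0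

/-- Ricci coefficient `χ_{AB} = g(∇_A e₄, e_B)`. -/
def chi (P : PatchData) (x : Coord) (A B : Fin 2) : ℝ :=
  ip P.metric (covD P.D P.metric (eS A) P.e4) (eS B) x

/-- Ricci coefficient `\underline χ_{AB} = g(∇_A e₃, e_B)`. -/
def chib (P : PatchData) (x : Coord) (A B : Fin 2) : ℝ :=
  ip P.metric (covD P.D P.metric (eS A) P.e3) (eS B) x

/-- Ricci coefficient `η_A = -½ g(∇_{e₃} e_A, e₄)`. -/
def eta (P : PatchData) (x : Coord) (A : Fin 2) : ℝ :=
  -(1 / 2) * ip P.metric (covD P.D P.metric P.e3 (eS A)) P.e4 x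

/-- Ricci coefficient `\underline η_A = -½ g(∇_{e₄} e_A, e₃)`. -/
def etab (P : PatchData) (x : Coord) (A : Fin 2) : ℝ :=
  -(1 / 2) * ip P.metric (covD P.D P.metric P.e4 (eS A)) P.e3 x

/-- Ricci coefficient `ω = ½ Ω g(∇_{e₄} e₃, e₄)`. -/
def omega (P : PatchData) (x : Coord) : ℝ :=
  (1 / 2) * P.Ω x * ip P.metric (covD P.D P.metric P.e4 P.e3) P.e4 x

/-- Ricci coefficient `\underline ω = ½ Ω g(∇_{e₃} e₄, e₃)`. -/
def omegab (P : PatchData) (x : Coord) : ℝ :=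
  (1 / 2) * P.Ω x * ip P.metric (covD P.D P.metric P.e3 P.e4) P.e3 x

/-- The trace `\slashed g^{AB} θ_{AB}`. -/
def trS (P : PatchData) (θ : Coord → Fin 2 → Fin 2 → ℝ) (x : Coord) : ℝ :=
  ∑ A, ∑ B, (P.gs x)⁻¹ A B * θ x A B

/-- The tracefree part `θ_{AB} - ½ (tr θ) \slashed g_{AB}`. -/
def hatS (P : PatchData) (θ : Coord → Fin 2 → Fin 2 → ℝ) (x : Coord) (A B : Fin 2) : ℝ :=
  θ x A B - (1 / 2) * P.trS θ x * P.gs x A B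

/-- `α_{AB} = W(e_A, e₄, e_B, e₄)`. -/
def alpha (P : PatchData) (x : Coord) (A B : Fin 2) : ℝ :=
  apply4 (weyl P.D P.metric) (eS A) P.e4 (eS B) P.e4 x

/-- `\underline α_{AB} = W(e_A, e₃, e_B, e₃)`. -/
def alphab (P : PatchData) (x : Coord) (A B : Fin 2) : ℝ :=
  apply4 (weyl P.D P.metric) (eS A) P.e3 (eS B) P.e3 x

/-- `β_A = ½ W(e_A, e₄, e₃, e₄)`. -/
def beta (P : PatchData) (x : Coord) (A : Fin 2) : ℝ :=
  (1 / 2) * apply4 (weyl P.D P.metric) (eS A) P.e4 P.e3 P.e4 x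

/-- `\underline β_A = ½ W(e_A, e₃, e₃, e₄)`. -/
def betab (P : PatchData) (x : Coord) (A : Fin 2) : ℝ :=
  (1 / 2) * apply4 (weyl P.D P.metric) (eS A) P.e3 P.e3 P.e4 x

/-- `ρ = ¼ W(e₄, e₃, e₄, e₃)`. -/
def rho (P : PatchData) (x : Coord) : ℝ :=
  (1 / 4) * apply4 (weyl P.D P.metric) P.e4 P.e3 P.e4 P.e3 x

/-- `σ = ¼ ⋆W(e₄, e₃, e₄, e₃)`. -/
def sigma (P : PatchData) (x : Coord) : ℝ :=
  (1 / 4) * apply4 (weylDual P.D P.metric) P.e4 P.e3 P.e4 P.e3 x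

end PatchData

/-! ## Metrics in double null gauge on `{0 ≤ v < u} × S²` -/

/-- The sphere `S²`. -/
abbrev S2 : Type := Metric.sphere (0 : EuclideanSpace ℝ (Fin 3)) 1

/-- A coordinate chart candidate for `S²`. -/
abbrev SChart : Type := OpenPartialHomeomorph S2 (EuclideanSpace ℝ (Fin 2))

/-- The smooth coordinate charts of `S²`. -/
def charts : Set SChart := IsManifold.maximalAtlas (𝓡 2) ∞ S2

/-- Angular coordinates `(θ¹, θ²)` of a point `x = (u, v, θ¹, θ²)`. -/
def angPart (x : Coord) : EuclideanSpace ℝ (Fin 2) := !₂[x 2, x 3]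

/-- The part of the manifold with conformal boundary `{0 ≤ v ≤ u} × S²` over a chart of `S²`. The
conformal boundary is `{u = v}`. -/
def closedDom (e : SChart) : Set Coord := {x | 0 ≤ x 1 ∧ x 1 ≤ x 0 ∧ angPart x ∈ e.target}

/-- The part of `{0 ≤ v < u} × S²` (conformal boundary removed) over a chart of `S²`. -/
def intDom (e : SChart) : Set Coord := {x | 0 ≤ x 1 ∧ x 1 < x 0 ∧ angPart x ∈ e.target}

/-- The lapse `Ω`, the shift `b` (a vector field tangent to the spheres) and the metrics
`\slashed g` on the spheres `S²_{u,v}`. Only the values for `0 ≤ v < u` matter. -/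
structure DoubleNull where
  Ω : ℝ → ℝ → S2 → ℝ
  b : ℝ → ℝ → (p : S2) → TangentSpace (𝓡 2) p
  gs : ℝ → ℝ → (p : S2) → TangentSpace (𝓡 2) p →ₗ[ℝ] TangentSpace (𝓡 2) p →ₗ[ℝ] ℝ
  Ω_pos : ∀ u v p, 0 ≤ v → v < u → 0 < Ω u v p
  gs_symm : ∀ u v p, 0 ≤ v → v < u → ∀ X Y, gs u v p X Y = gs u v p Y X
  gs_pos : ∀ u v p, 0 ≤ v → v < u → ∀ X, X ≠ 0 → 0 < gs u v p X X

namespace DoubleNull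

/-- The coordinate vector `∂_A` at the point of `S²` with coordinates `θ` in the chart `e`. -/
def coordVec (e : SChart) (θ : EuclideanSpace ℝ (Fin 2)) (A : Fin 2) :
    TangentSpace (𝓡 2) (e.symm θ) :=
  mfderiv (𝓡 2) (𝓡 2) e.symm θ (EuclideanSpace.single A (1 : ℝ))

/-- The components of `Ω`, `b`, `\slashed g` in the coordinates `(u, v, θ¹, θ²)` given by a
chart. -/
def inChart (g : DoubleNull) (e : SChart) : PatchData where
  D := intDom e
  Ω := fun x => g.Ω (x 0) (x 1) (e.symm (angPart x))
  b := fun x A =>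
    (show EuclideanSpace ℝ (Fin 2) from
      mfderiv (𝓡 2) (𝓡 2) e (e.symm (angPart x)) (g.b (x 0) (x 1) (e.symm (angPart x)))) A
  gs := fun x => Matrix.of fun A B =>
    g.gs (x 0) (x 1) (e.symm (angPart x)) (coordVec e (angPart x) A) (coordVec e (angPart x) B)

/-- The metric is smooth on `{0 ≤ v < u} × S²`. -/
def IsSmooth (g : DoubleNull) : Prop :=
  ∀ e ∈ charts, ContDiffOn ℝ ∞ (g.inChart e).Ω (intDom e) ∧
    (∀ A, ContDiffOn ℝ ∞ (fun x => (g.inChart e).b x A) (intDom e)) ∧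
    (∀ A B, ContDiffOn ℝ ∞ (fun x => (g.inChart e).gs x A B) (intDom e))

/-- The Einstein equations `Ric(g) = -3 k² g` on `{0 ≤ v < u} × S²`. -/
def IsEinstein (g : DoubleNull) (k : ℝ) : Prop :=
  ∀ e ∈ charts, ∀ x ∈ intDom e, ∀ i j,
    ricci (intDom e) (g.inChart e).metric i j x = -3 * k ^ 2 * (g.inChart e).metric x i j

/-- The metric is asymptotically Anti-de Sitter: the rescaled metric `(u - v)² g` extends to a
smooth nondegenerate metric on `{0 ≤ v ≤ u} × S²`. -/
def IsAsymptoticallyAdS (g : DoubleNull) : Prop :=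
  ∀ e ∈ charts, ∃ h : MetricField,
    (∀ i j, ContDiffOn ℝ ∞ (fun x => h x i j) (closedDom e)) ∧
    (∀ x ∈ closedDom e, (h x).det ≠ 0) ∧
    (∀ x ∈ intDom e, ∀ i j, h x i j = (x 0 - x 1) ^ 2 * (g.inChart e).metric x i j)

end DoubleNull

/-! ## The area radius of the background and smooth extension to the conformal boundary -/

/-- `r`, as a function of `r⋆ = v - u < 0`, solves
`dr/dr⋆ = 1 - 2M/r + k² r²` with `r(0) = ∞`. -/
def IsAreaRadius (M k : ℝ) (r : ℝ → ℝ) : Prop :=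
  (∀ s < 0, HasDerivAt r (1 - 2 * M / r s + k ^ 2 * r s ^ 2) s) ∧
    Filter.Tendsto r (nhdsWithin 0 (Set.Iio 0)) Filter.atTop

/-- A function on the interior extends smoothly to the conformal boundary `{u = v}`. -/
def ExtendsSmoothly (e : SChart) (f : Coord → ℝ) : Prop :=
  ∃ F : Coord → ℝ, ContDiffOn ℝ ∞ F (closedDom e) ∧ ∀ x ∈ intDom e, F x = f x

/-- `E a = E_a^A ∂_A` (`a = 1, 2`) is a `g`-orthonormal frame of the spheres `S²_{u,v}` which is
regular at the conformal boundary: the frame `(u - v)⁻¹ E_a`, which is orthonormal for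
`(u - v)² g`, extends smoothly. -/
def IsOrthonormalFrame (e : SChart) (P : PatchData) (E : Fin 2 → Coord → Fin 2 → ℝ) : Prop :=
  (∀ x ∈ intDom e, ∀ a c,
    ∑ A, ∑ B, P.gs x A B * E a x A * E c x B = if a = c then 1 else 0) ∧
  (∀ a A, ExtendsSmoothly e (fun x => (x 0 - x 1)⁻¹ * E a x A))

/-- The components `ξ(E_a)` of a one-form on the spheres extend smoothly. -/
def FormExtends (e : SChart) (E : Fin 2 → Coord → Fin 2 → ℝ) (ξ : Coord → Fin 2 → ℝ) : Prop :=
  ∀ a, ExtendsSmoothly e (fun x => ∑ A, ξ x A * E a x A)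

/-- The components `θ(E_a, E_c)` of a 2-tensor on the spheres extend smoothly. -/
def TensorExtends (e : SChart) (E : Fin 2 → Coord → Fin 2 → ℝ)
    (θ : Coord → Fin 2 → Fin 2 → ℝ) : Prop :=
  ∀ a c, ExtendsSmoothly e (fun x => ∑ A, ∑ B, θ x A B * E a x A * E c x B)

/-- The components `\slashed g(X, E_a)` of a vector field on the spheres in the orthonormal frame
`E` extend smoothly. -/
def VectorExtends (e : SChart) (P : PatchData) (E : Fin 2 → Coord → Fin 2 → ℝ)
    (X : Coord → Fin 2 → ℝ) : Prop :=
  ∀ a, ExtendsSmoothly e (fun x => ∑ A, ∑ B, P.gs x A B * X x A * E a x B)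

end AAdS

end

/-! Write s = u − v and h = s²g, and let Ω̂ = sΩ be the lapse of h. The conformal transformation law
turns Ric(g) = −3k²g into 3(|ds|² − k²)h = s(2 Hess s + (Δs)h) + s² Ric(h), where everything is
taken with respect to h and is smooth up to s = 0 (`einstein_conformal`). A smooth function that
vanishes at s = 0 is s times a smooth function, also on this domain with corners
(`exists_smooth_quotient`). So the identity can be divided by s and evaluated at the boundary again.

At s = 0 it gives |ds|² = k², hence |ds|² = k² + sa. After one division, 3ah = 2 Hess s + (Δs)h at
the boundary. Now the gauge enters: h(∂_v, ∂_v) = 0 forces Hess s(∂_v, ∂_v) = 0, which says ∂_v Ω̂ =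
0 there. Since |ds|² = Ω̂⁻², this gives a = 0. Then Hess s is a multiple of h at the boundary, and
its trace shows that it vanishes. Thus |ds|² = k² + s²N and Hess s = sK with N and K smooth
(`exists_expansion`).

The improved Ricci coefficients are read off from these two expansions. Ω̂⁻² = k² + s²N governs Ω,
ω, ω̲ and η + η̲, because these are Ω or derivatives of log Ω or log Ω̂. Hess s = sK governs η̲ and
the difference of the two null second fundamental forms. The shift, the shears and the traces need
only the smoothness of h.

For the Weyl tensor, the expansions give W(g) = s⁻²C with C smooth, trace-free and with the
symmetries of a curvature tensor (`weyl_eq`). At s = 0 the Ricci identity for ds, with Hess s = sK,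
shows that C is annihilated by the nonnull vector ∇s (`sum_gradS_confWeyl`). In dimension four this
forces C = 0, because such a C is a trace-free curvature tensor of a three-dimensional space
(`IsCurvatureTensor.eq_zero`). So W(g) = s⁻¹V with V smooth, and the same holds for the dual.

It remains to count weights. The function 1/r solves an autonomous polynomial equation with nonzero
slope at r⋆ = 0, so r = ρ/s with ρ smooth and nowhere zero (`IsAreaRadius.exists_smooth_mul`). Each
of e₃, e₄ and E_a is s times a smooth field. -/

noncomputable section

namespace AAdS

/-! ## Weighted averages along segments and Hadamard's lemma on domains with boundary -/

section Average

set_option linter.unusedSectionVars false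

variable {V : Type} [NormedAddCommGroup V] [NormedSpace ℝ V]

/-- The average `∫₀¹ t^m f((A + t B) x) dt`. -/
def segAvg (A B : V →L[ℝ] V) {F : Type} [NormedAddCommGroup F] [NormedSpace ℝ F]
    (m : ℕ) (f : V → F) (x : V) : F :=
  ∫ t in (0 : ℝ)..1, t ^ m • f (A x + t • B x)

variable {A B : V →L[ℝ] V} {D : Set V} {F : Type} [NormedAddCommGroup F] [NormedSpace ℝ F]

theorem continuousOn_segment (hmap : ∀ t ∈ Set.Icc (0 : ℝ) 1, ∀ x ∈ D, A x + t • B x ∈ D)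
    {f : V → F} (hf : ContinuousOn f D) {x : V} (hx : x ∈ D) (m : ℕ) :
    ContinuousOn (fun t : ℝ => t ^ m • f (A x + t • B x)) (Set.Icc 0 1) := by
  refine ContinuousOn.smul (by fun_prop) ?_
  exact hf.comp (by fun_prop) fun t ht => hmap t ht x hx

theorem intervalIntegrable_segment
    (hmap : ∀ t ∈ Set.Icc (0 : ℝ) 1, ∀ x ∈ D, A x + t • B x ∈ D)
    {f : V → F} (hf : ContinuousOn f D) {x : V} (hx : x ∈ D) (m : ℕ) :
    IntervalIntegrable (fun t : ℝ => t ^ m • f (A x + t • B x)) MeasureTheory.volume 0 1 := by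
  apply ContinuousOn.intervalIntegrable
  rw [Set.uIcc_of_le zero_le_one]
  exact continuousOn_segment hmap hf hx m

/-- Compactness of [0, 1] makes the continuity in the base point uniform in t. This is what allows
limits to pass under the integral. -/
theorem uniform_segment (hmap : ∀ t ∈ Set.Icc (0 : ℝ) 1, ∀ x ∈ D, A x + t • B x ∈ D)
    {f : V → F} (hf : ContinuousOn f D) {x : V} (hx : x ∈ D) {ε : ℝ} (hε : 0 < ε) :
    ∃ δ > 0, ∀ y ∈ D ∩ Metric.ball x δ, ∀ t ∈ Set.Icc (0 : ℝ) 1,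
      ‖f (A y + t • B y) - f (A x + t • B x)‖ < ε := by
  have hc : ContinuousOn (Function.uncurry fun (y : V) (t : ℝ) => f (A y + t • B y))
      (D ×ˢ Set.Icc (0 : ℝ) 1) :=
    hf.comp (f := fun p : V × ℝ => A p.1 + p.2 • B p.1) (by fun_prop)
      fun p hp => hmap p.2 hp.2 p.1 hp.1
  obtain ⟨v, hv, h⟩ := isCompact_Icc.mem_uniformity_of_prod hc hx (Metric.dist_mem_uniformity hε)
  obtain ⟨δ, hδ, hball⟩ := Metric.mem_nhdsWithin_iff.1 hv
  refine ⟨δ, hδ, fun y hy t ht => ?_⟩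
  have := h y (hball ⟨hy.2, hy.1⟩) t ht
  rwa [Set.mem_ofPred_eq, dist_eq_norm] at this

theorem continuousOn_segAvg (hmap : ∀ t ∈ Set.Icc (0 : ℝ) 1, ∀ x ∈ D, A x + t • B x ∈ D)
    {f : V → F} (hf : ContinuousOn f D) (m : ℕ) : ContinuousOn (segAvg A B m f) D := by
  intro x hx
  rw [Metric.continuousWithinAt_iff]
  intro ε hε
  obtain ⟨δ, hδ, h⟩ := uniform_segment hmap hf hx (half_pos hε)
  refine ⟨δ, hδ, fun {y} hy hyx => ?_⟩
  rw [dist_eq_norm, segAvg, segAvg, ← intervalIntegral.integral_sub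
    (intervalIntegrable_segment hmap hf hy m) (intervalIntegrable_segment hmap hf hx m)]
  have : ‖∫ t in (0 : ℝ)..1, (t ^ m • f (A y + t • B y) - t ^ m • f (A x + t • B x))‖
      ≤ ε / 2 * |1 - 0| := by
    refine intervalIntegral.norm_integral_le_of_norm_le_const fun t ht => ?_
    rw [Set.uIoc_of_le zero_le_one] at ht
    rw [← smul_sub, norm_smul, norm_pow, Real.norm_of_nonneg ht.1.le]
    have h1 := (h y ⟨hy, hyx⟩ t ⟨ht.1.le, ht.2⟩).le
    have h2 : t ^ m ≤ 1 := pow_le_one₀ ht.1.le ht.2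
    have h3 : 0 ≤ t ^ m := pow_nonneg ht.1.le m
    nlinarith [norm_nonneg (f (A y + t • B y) - f (A x + t • B x))]
  norm_num at this
  linarith

/-- Differentiation under the integral sign for derivatives within a set that need not be open. The
chain rule produces A + tB, and the extra t raises the weight from m to m + 1 in the B term; this is
why the weights t^m are carried along. -/
theorem hasFDerivWithinAt_segAvg [CompleteSpace F]
    (hmap : ∀ t ∈ Set.Icc (0 : ℝ) 1, ∀ x ∈ D, A x + t • B x ∈ D)
    (hconv : ∀ x ∈ D, ∃ δ > 0, ∀ δ' ≤ δ, Convex ℝ (D ∩ Metric.ball x δ'))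
    {f : V → F} {f' : V → V →L[ℝ] F} (hf : ∀ x ∈ D, HasFDerivWithinAt f (f' x) D x)
    (hf' : ContinuousOn f' D) (m : ℕ) {x : V} (hx : x ∈ D) :
    HasFDerivWithinAt (segAvg A B m f)
      ((segAvg A B m f' x) ∘L A + (segAvg A B (m + 1) f' x) ∘L B) D x := by
  have hfc : ContinuousOn f D := fun x hx => (hf x hx).continuousWithinAt
  apply HasFDerivWithinAt.of_isLittleO
  rw [Asymptotics.isLittleO_iff]
  intro ε hε
  -- C bounds ‖A + tB‖ on [0, 1]; the summand 1 only makes it positive.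
  set C : ℝ := ‖A‖ + ‖B‖ + 1 with hC
  have hCpos : 0 < C := by positivity
  obtain ⟨δ₁, hδ₁, h₁⟩ := uniform_segment hmap hf' hx (div_pos hε hCpos)
  obtain ⟨δ₂, hδ₂, h₂⟩ := hconv x hx
  have hδ : 0 < min δ₁ δ₂ := lt_min hδ₁ hδ₂
  refine Metric.mem_nhdsWithin_iff.2 ⟨min δ₁ δ₂, hδ, fun y hy => ?_⟩
  have hyD : y ∈ D := hy.2
  have hS := h₂ (min δ₁ δ₂) (min_le_right _ _)
  set φ : ℝ → V →L[ℝ] V := fun t => A + t • B with hφ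
  have hnorm : ∀ t ∈ Set.Icc (0 : ℝ) 1, ‖φ t‖ ≤ C := fun t ht => by
    have h1 : ‖φ t‖ ≤ ‖A‖ + ‖t • B‖ := norm_add_le _ _
    rw [norm_smul, Real.norm_of_nonneg ht.1] at h1
    nlinarith [norm_nonneg B, ht.1, ht.2]
  -- Mean value inequality on the convex piece of `D` near x, with a constant independent of t.
  have key : ∀ t ∈ Set.Icc (0 : ℝ) 1,
      ‖f (A y + t • B y) - f (A x + t • B x) - f' (A x + t • B x) (φ t (y - x))‖
        ≤ ε * ‖y - x‖ := by
    intro t ht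
    have := Convex.norm_image_sub_le_of_norm_hasFDerivWithin_le' (𝕜 := ℝ)
      (f := fun y => f (A y + t • B y)) (f' := fun y => f' (A y + t • B y) ∘L φ t)
      (φ := f' (A x + t • B x) ∘L φ t) (C := ε) (s := D ∩ Metric.ball x (min δ₁ δ₂))
      (x := x) (y := y) ?_ ?_ hS ⟨hx, Metric.mem_ball_self hδ⟩ ⟨hyD, hy.1⟩
    · simpa using this
    · intro z hz
      have h1 : HasFDerivWithinAt (fun y => A y + t • B y) (φ t)
          (D ∩ Metric.ball x (min δ₁ δ₂)) z := (φ t).hasFDerivWithinAt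
      exact (hf _ (hmap t ht z hz.1)).comp z h1 fun w hw => hmap t ht w hw.1
    · intro z hz
      have hz' : z ∈ D ∩ Metric.ball x δ₁ :=
        ⟨hz.1, Metric.ball_subset_ball (min_le_left _ _) hz.2⟩
      rw [← ContinuousLinearMap.sub_comp]
      calc _ ≤ ‖f' (A z + t • B z) - f' (A x + t • B x)‖ * ‖φ t‖ :=
            ContinuousLinearMap.opNorm_comp_le _ _
        _ ≤ ε / C * C := by
            gcongr
            · exact (h₁ z hz' t ht).le
            · exact hnorm t ht
        _ = ε := by field_simp
  have hint : segAvg A B m f y - segAvg A B m f x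
      - ((segAvg A B m f' x) ∘L A + (segAvg A B (m + 1) f' x) ∘L B) (y - x)
      = ∫ t in (0 : ℝ)..1, t ^ m • (f (A y + t • B y) - f (A x + t • B x)
          - f' (A x + t • B x) (φ t (y - x))) := by
    have i1 := intervalIntegrable_segment hmap hfc hyD m
    have i2 := intervalIntegrable_segment hmap hfc hx m
    have i3 := intervalIntegrable_segment hmap hf' hx m
    have i4 := intervalIntegrable_segment hmap hf' hx (m + 1)
    have e3 : (segAvg A B m f' x) (A (y - x))
        = ∫ t in (0 : ℝ)..1, (t ^ m • f' (A x + t • B x)) (A (y - x)) :=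
      ContinuousLinearMap.intervalIntegral_apply i3 _
    have e4 : (segAvg A B (m + 1) f' x) (B (y - x))
        = ∫ t in (0 : ℝ)..1, (t ^ (m + 1) • f' (A x + t • B x)) (B (y - x)) :=
      ContinuousLinearMap.intervalIntegral_apply i4 _
    have j3 : IntervalIntegrable (fun t : ℝ => (t ^ m • f' (A x + t • B x)) (A (y - x)))
        MeasureTheory.volume 0 1 :=
      ⟨i3.1.apply_continuousLinearMap _, i3.2.apply_continuousLinearMap _⟩
    have j4 : IntervalIntegrable (fun t : ℝ => (t ^ (m + 1) • f' (A x + t • B x)) (B (y - x)))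
        MeasureTheory.volume 0 1 :=
      ⟨i4.1.apply_continuousLinearMap _, i4.2.apply_continuousLinearMap _⟩
    rw [add_apply, ContinuousLinearMap.comp_apply,
      ContinuousLinearMap.comp_apply, e3, e4, segAvg, segAvg,
      ← intervalIntegral.integral_sub i1 i2, ← intervalIntegral.integral_add j3 j4,
      ← intervalIntegral.integral_sub (i1.sub i2) (j3.add j4)]
    refine intervalIntegral.integral_congr fun t _ => ?_
    simp only [hφ, add_apply, smul_apply, map_add, map_smul,
      smul_sub, smul_add, smul_smul, pow_succ]
  change ‖segAvg A B m f y - segAvg A B m f x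
      - ((segAvg A B m f' x) ∘L A + (segAvg A B (m + 1) f' x) ∘L B) (y - x)‖ ≤ _
  rw [hint]
  have : ‖∫ t in (0 : ℝ)..1, t ^ m • (f (A y + t • B y) - f (A x + t • B x)
          - f' (A x + t • B x) (φ t (y - x)))‖ ≤ ε * ‖y - x‖ * |1 - 0| := by
    refine intervalIntegral.norm_integral_le_of_norm_le_const fun t ht => ?_
    rw [Set.uIoc_of_le zero_le_one] at ht
    rw [norm_smul, norm_pow, Real.norm_of_nonneg ht.1.le]
    have h1 := key t ⟨ht.1.le, ht.2⟩
    have h2 : t ^ m ≤ 1 := pow_le_one₀ ht.1.le ht.2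
    have h3 : 0 ≤ t ^ m := pow_nonneg ht.1.le m
    calc _ ≤ 1 * (ε * ‖y - x‖) := by gcongr
      _ = _ := one_mul _
  simpa using this

/-- The derivative of an average is a combination of averages of f', so smoothness follows by
induction on n. The weight and the target space must vary in the induction, since f' takes values in
a space of linear maps. -/
theorem contDiffOn_segAvg (hD : UniqueDiffOn ℝ D)
    (hmap : ∀ t ∈ Set.Icc (0 : ℝ) 1, ∀ x ∈ D, A x + t • B x ∈ D)
    (hconv : ∀ x ∈ D, ∃ δ > 0, ∀ δ' ≤ δ, Convex ℝ (D ∩ Metric.ball x δ')) (n : ℕ) :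
    ∀ {F : Type} [NormedAddCommGroup F] [NormedSpace ℝ F] [CompleteSpace F] (m : ℕ) {f : V → F},
      ContDiffOn ℝ n f D → ContDiffOn ℝ n (segAvg A B m f) D := by
  induction n with
  | zero =>
    intro F _ _ _ m f hf
    exact contDiffOn_zero.2 (continuousOn_segAvg hmap hf.continuousOn m)
  | succ n ih =>
    intro F _ _ _ m f hf
    have hf' : ContDiffOn ℝ n (fderivWithin ℝ f D) D :=
      hf.fderivWithin hD (by norm_cast)
    have hd : ∀ x ∈ D, HasFDerivWithinAt f (fderivWithin ℝ f D x) D x := fun x hx =>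
      (hf.differentiableOn (by norm_cast) x hx).hasFDerivWithinAt
    have key := fun x (hx : x ∈ D) =>
      hasFDerivWithinAt_segAvg hmap hconv hd hf'.continuousOn m hx
    push_cast
    rw [contDiffOn_succ_iff_fderivWithin hD]
    refine ⟨fun x hx => (key x hx).differentiableWithinAt, fun h => ?_, ?_⟩
    · exact absurd h (by exact_mod_cast WithTop.coe_ne_top)
    · refine ContDiffOn.congr (f := fun x => (segAvg A B m (fderivWithin ℝ f D) x) ∘L A
        + (segAvg A B (m + 1) (fderivWithin ℝ f D) x) ∘L B) ?_
        fun x hx => (key x hx).fderivWithin (hD x hx)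
      exact ((ih m hf').clm_comp contDiffOn_const).add
        ((ih (m + 1) hf').clm_comp contDiffOn_const)

end Average

end AAdS

end

noncomputable section

namespace AAdS

/-! ## The coordinate domains -/

variable {e : SChart}

theorem continuous_angPart : Continuous angPart := by
  unfold angPart
  fun_prop

theorem isOpen_angTarget (e : SChart) : IsOpen {x : Coord | angPart x ∈ e.target} :=
  e.open_target.preimage continuous_angPart

/-- The wedge `{0 ≤ v ≤ u}`. -/
def wedge : Set Coord := {x | 0 ≤ x 1 ∧ x 1 ≤ x 0}

theorem convex_wedge : Convex ℝ wedge := by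
  rintro x ⟨hx1, hx2⟩ y ⟨hy1, hy2⟩ a c ha hc -
  refine ⟨?_, ?_⟩ <;> simp only [Pi.add_apply, Pi.smul_apply, smul_eq_mul]
  · positivity
  · gcongr

theorem closedDom_eq (e : SChart) : closedDom e = wedge ∩ {x | angPart x ∈ e.target} := by
  ext x
  simp [closedDom, wedge, and_assoc]

theorem intDom_subset_closedDom (e : SChart) : intDom e ⊆ closedDom e :=
  fun _ hx => ⟨hx.1, hx.2.1.le, hx.2.2⟩

theorem intDom_eq (e : SChart) : intDom e = closedDom e ∩ {x | x 1 < x 0} := by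
  ext x
  simp only [intDom, closedDom, Set.mem_inter_iff, Set.mem_ofPred_eq]
  exact ⟨fun h => ⟨⟨h.1, h.2.1.le, h.2.2⟩, h.2.1⟩, fun h => ⟨h.1.1, h.2, h.1.2.2⟩⟩

theorem isOpen_bulk : IsOpen {x : Coord | x 1 < x 0} :=
  isOpen_lt (continuous_apply 1) (continuous_apply 0)

theorem isOpen_openWedge : IsOpen {x : Coord | 0 < x 1 ∧ x 1 < x 0} :=
  (isOpen_lt continuous_const (continuous_apply 1)).inter isOpen_bulk

theorem uniqueDiffOn_closedDom (e : SChart) : UniqueDiffOn ℝ (closedDom e) := by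
  rw [closedDom_eq]
  refine UniqueDiffOn.inter (uniqueDiffOn_convex convex_wedge ?_) (isOpen_angTarget e)
  -- The point u = 2, v = 1 lies strictly inside the wedge.
  refine ⟨![2, 1, 0, 0], mem_interior.2 ⟨_, ?_, isOpen_openWedge, ?_⟩⟩
  · exact fun x hx => ⟨hx.1.le, hx.2.le⟩
  · simp

/-- The angular condition is open, so near a point the domain is a ball cut by the convex wedge.
This supplies the convexity needed for the mean value inequality. -/
theorem locally_convex_closedDom (e : SChart) :
    ∀ x ∈ closedDom e, ∃ δ > 0, ∀ δ' ≤ δ, Convex ℝ (closedDom e ∩ Metric.ball x δ') := by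
  intro x hx
  obtain ⟨δ, hδ, h⟩ := Metric.isOpen_iff.1 (isOpen_angTarget e) x hx.2.2
  refine ⟨δ, hδ, fun δ' hδ' => ?_⟩
  have : closedDom e ∩ Metric.ball x δ' = wedge ∩ Metric.ball x δ' := by
    rw [closedDom_eq]
    ext y
    exact ⟨fun hy => ⟨hy.1.1, hy.2⟩,
      fun hy => ⟨⟨hy.1, h (Metric.ball_subset_ball hδ' hy.2)⟩, hy.2⟩⟩
  rw [this]
  exact convex_wedge.inter (convex_ball x δ')

/-- Moving along (2, 1, 0, 0) increases both v and u − v and keeps the angles, so it leads from any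
corner or face into the open part. -/
theorem closedDom_subset_closure_open (e : SChart) :
    closedDom e ⊆ closure ({x : Coord | 0 < x 1 ∧ x 1 < x 0} ∩ {x | angPart x ∈ e.target}) := by
  intro x hx
  have ht : Filter.Tendsto (fun t : ℝ => x + t • (![2, 1, 0, 0] : Coord))
      (nhdsWithin 0 (Set.Ioi 0)) (nhds x) := by
    have : Filter.Tendsto (fun t : ℝ => x + t • (![2, 1, 0, 0] : Coord)) (nhds 0)
        (nhds (x + (0 : ℝ) • (![2, 1, 0, 0] : Coord))) :=
      Continuous.tendsto (by fun_prop) 0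
    rw [zero_smul, add_zero] at this
    exact this.mono_left nhdsWithin_le_nhds
  refine mem_closure_of_tendsto ht ?_
  filter_upwards [self_mem_nhdsWithin, ht ((isOpen_angTarget e).mem_nhds hx.2.2)] with t ht0 htU
  refine ⟨?_, htU⟩
  have h0 : (0 : ℝ) < t := ht0
  have h1 := hx.1
  have h2 := hx.2.1
  constructor <;> simp <;> linarith

theorem closedDom_subset_closure (e : SChart) : closedDom e ⊆ closure (intDom e) :=
  (closedDom_subset_closure_open e).trans (closure_mono fun _ hx => ⟨hx.1.1.le, hx.1.2, hx.2⟩)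

theorem closedDom_subset_closure_interior (e : SChart) :
    closedDom e ⊆ closure (interior (closedDom e)) := by
  refine (closedDom_subset_closure_open e).trans (closure_mono ?_)
  refine interior_maximal (fun x hx => ⟨hx.1.1.le, hx.1.2.le, hx.2⟩) ?_
  exact isOpen_openWedge.inter (isOpen_angTarget e)

/-- Smooth functions up to the conformal boundary. -/
abbrev Smooth (e : SChart) (f : Coord → ℝ) : Prop := ContDiffOn ℝ ∞ f (closedDom e)

/-- An identity between functions which are smooth up to the boundary holds on the boundary if it
holds in the interior. -/
theorem eq_of_eq_on_intDom {f g : Coord → ℝ} (hf : Smooth e f) (hg : Smooth e g)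
    (h : ∀ x ∈ intDom e, f x = g x) : ∀ x ∈ closedDom e, f x = g x :=
  Set.EqOn.of_subset_closure (s := intDom e) h hf.continuousOn hg.continuousOn
    (intDom_subset_closedDom e) (closedDom_subset_closure e)

/-! ## Rules for partial derivatives -/

theorem Smooth.diff {f : Coord → ℝ} (hf : Smooth e f) {x : Coord} (hx : x ∈ closedDom e) :
    DifferentiableWithinAt ℝ f (closedDom e) x :=
  hf.differentiableOn (by simp) x hx

theorem Smooth.pd {f : Coord → ℝ} (hf : Smooth e f) (i : Fin 4) :
    Smooth e (pd (closedDom e) i f) :=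
  (hf.fderivWithin (m := ∞) (uniqueDiffOn_closedDom e) (by simp)).clm_apply contDiffOn_const

theorem pd_congr {D : Set Coord} {f g : Coord → ℝ} (h : ∀ x ∈ D, f x = g x) {x : Coord}
    (hx : x ∈ D) (i : Fin 4) : pd D i f x = pd D i g x := by
  unfold pd
  rw [fderivWithin_congr h (h x hx)]

/-- The interior is relatively open in the closed domain, so both notions of one-sided derivative
agree. Hence all the calculus can be done in `closedDom`. -/
theorem pd_intDom (f : Coord → ℝ) {x : Coord} (hx : x ∈ intDom e) (i : Fin 4) :
    pd (intDom e) i f x = pd (closedDom e) i f x := by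
  unfold pd
  rw [intDom_eq, fderivWithin_inter (isOpen_bulk.mem_nhds hx.2.1)]

theorem pd_congr_intDom {f g : Coord → ℝ} (h : ∀ x ∈ intDom e, f x = g x) {x : Coord}
    (hx : x ∈ intDom e) (i : Fin 4) : pd (closedDom e) i f x = pd (closedDom e) i g x := by
  rw [← pd_intDom f hx, ← pd_intDom g hx, pd_congr h hx]

section Rules

variable {f g : Coord → ℝ} {x : Coord} (i : Fin 4)

theorem pd_const (c : ℝ) : pd (closedDom e) i (fun _ => c) x = 0 := by
  simp [pd]

theorem pd_coord (hx : x ∈ closedDom e) (j : Fin 4) :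
    pd (closedDom e) i (fun y => y j) x = if i = j then 1 else 0 := by
  have h : HasFDerivWithinAt (fun y : Coord => y j)
      (ContinuousLinearMap.proj (R := ℝ) (φ := fun _ : Fin 4 => ℝ) j) (closedDom e) x :=
    (ContinuousLinearMap.proj (R := ℝ) (φ := fun _ : Fin 4 => ℝ) j).hasFDerivWithinAt
  rw [pd, h.fderivWithin (uniqueDiffOn_closedDom e x hx)]
  simp [Pi.single_apply, eq_comm]

theorem pd_add (hx : x ∈ closedDom e) (hf : DifferentiableWithinAt ℝ f (closedDom e) x)
    (hg : DifferentiableWithinAt ℝ g (closedDom e) x) :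
    pd (closedDom e) i (fun y => f y + g y) x
      = pd (closedDom e) i f x + pd (closedDom e) i g x := by
  unfold pd
  rw [fderivWithin_fun_add (uniqueDiffOn_closedDom e x hx) hf hg]
  rfl

theorem pd_sub (hx : x ∈ closedDom e) (hf : DifferentiableWithinAt ℝ f (closedDom e) x)
    (hg : DifferentiableWithinAt ℝ g (closedDom e) x) :
    pd (closedDom e) i (fun y => f y - g y) x
      = pd (closedDom e) i f x - pd (closedDom e) i g x := by
  unfold pd
  rw [fderivWithin_fun_sub (uniqueDiffOn_closedDom e x hx) hf hg]
  rfl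

theorem pd_neg (hx : x ∈ closedDom e) :
    pd (closedDom e) i (fun y => -f y) x = -pd (closedDom e) i f x := by
  unfold pd
  rw [fderivWithin_fun_neg (uniqueDiffOn_closedDom e x hx)]
  rfl

theorem pd_mul (hx : x ∈ closedDom e) (hf : DifferentiableWithinAt ℝ f (closedDom e) x)
    (hg : DifferentiableWithinAt ℝ g (closedDom e) x) :
    pd (closedDom e) i (fun y => f y * g y) x
      = pd (closedDom e) i f x * g x + f x * pd (closedDom e) i g x := by
  unfold pd
  rw [fderivWithin_fun_mul (uniqueDiffOn_closedDom e x hx) hf hg]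
  simp only [add_apply, smul_apply, smul_eq_mul]
  ring

theorem pd_sum {ι : Type} (u : Finset ι) {f : ι → Coord → ℝ} (hx : x ∈ closedDom e)
    (hf : ∀ a ∈ u, DifferentiableWithinAt ℝ (f a) (closedDom e) x) :
    pd (closedDom e) i (fun y => ∑ a ∈ u, f a y) x = ∑ a ∈ u, pd (closedDom e) i (f a) x := by
  unfold pd
  rw [fderivWithin_fun_sum (uniqueDiffOn_closedDom e x hx) hf]
  simp

theorem pd_inv (hx : x ∈ closedDom e) (hf : DifferentiableWithinAt ℝ f (closedDom e) x)
    (h0 : f x ≠ 0) :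
    pd (closedDom e) i (fun y => (f y)⁻¹) x = -pd (closedDom e) i f x / f x ^ 2 := by
  have h := (hasDerivAt_inv h0).comp_hasFDerivWithinAt x hf.hasFDerivWithinAt
  have h' : fderivWithin ℝ (fun y => (f y)⁻¹) (closedDom e) x
      = (-(f x ^ 2)⁻¹) • fderivWithin ℝ f (closedDom e) x :=
    h.fderivWithin (uniqueDiffOn_closedDom e x hx)
  rw [pd, h', pd, smul_apply, smul_eq_mul]
  ring

end Rules

/-- Second derivatives within the domain are symmetric even at the corners, because every point is a
limit of interior points. -/
theorem pd_comm {f : Coord → ℝ} (hf : Smooth e f) {x : Coord} (hx : x ∈ closedDom e)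
    (i j : Fin 4) :
    pd (closedDom e) i (pd (closedDom e) j f) x = pd (closedDom e) j (pd (closedDom e) i f) x := by
  have hs : IsSymmSndFDerivWithinAt ℝ f (closedDom e) x :=
    (hf x hx).isSymmSndFDerivWithinAt (by simp; exact ENat.LEInfty.out) (uniqueDiffOn_closedDom e)
      (closedDom_subset_closure_interior e hx) hx
  have hd : DifferentiableWithinAt ℝ (fderivWithin ℝ f (closedDom e)) (closedDom e) x :=
    (hf.fderivWithin (m := ∞) (uniqueDiffOn_closedDom e) (by simp)).differentiableOn (by simp) x hx
  have key : ∀ a c : Fin 4, pd (closedDom e) a (pd (closedDom e) c f) x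
      = fderivWithin ℝ (fderivWithin ℝ f (closedDom e)) (closedDom e) x (Pi.single a 1)
        (Pi.single c 1) := by
    intro a c
    change fderivWithin ℝ (fun y => fderivWithin ℝ f (closedDom e) y (Pi.single c 1))
      (closedDom e) x (Pi.single a 1) = _
    rw [fderivWithin_clm_apply (uniqueDiffOn_closedDom e x hx) hd
      (differentiableWithinAt_const _)]
    simp
  rw [key, key, hs.eq]

/-! ## Hadamard's lemma at the conformal boundary -/

theorem smooth_coord (e : SChart) (j : Fin 4) : Smooth e (fun x => x j) := by
  unfold Smooth
  fun_prop

theorem smooth_defining (e : SChart) : Smooth e (fun x => x 0 - x 1) :=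
  (smooth_coord e 0).sub (smooth_coord e 1)

/-- A smooth function which vanishes on the conformal boundary is divisible by `u - v`. -/
theorem exists_smooth_quotient {f : Coord → ℝ} (hf : Smooth e f)
    (h0 : ∀ x ∈ closedDom e, x 0 = x 1 → f x = 0) :
    ∃ q, Smooth e q ∧ ∀ x ∈ closedDom e, f x = (x 0 - x 1) * q x := by
  set p : Fin 4 → Coord →L[ℝ] ℝ :=
    fun j => ContinuousLinearMap.proj (R := ℝ) (φ := fun _ : Fin 4 => ℝ) j with hp
  set w : Coord := Pi.single 0 1 with hw
  -- Ax + tBx is the point (v + t(u − v), v, θ): it runs from the conformal boundary at t = 0 to x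
  -- at t = 1 while v and θ stay fixed, so it remains in the domain.
  set B : Coord →L[ℝ] Coord := (p 0 - p 1).smulRight w with hB
  set A : Coord →L[ℝ] Coord := ContinuousLinearMap.id ℝ Coord - B with hA
  have hval : ∀ (t : ℝ) (x : Coord) (j : Fin 4), (A x + t • B x) j
      = if j = 0 then x 1 + t * (x 0 - x 1) else x j := by
    intro t x j
    by_cases hj : j = 0
    · subst hj
      simp [hA, hB, hp, hw]
    · simp [hA, hB, hp, hw, hj]
  have hmap : ∀ t ∈ Set.Icc (0 : ℝ) 1, ∀ x ∈ closedDom e, A x + t • B x ∈ closedDom e := by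
    rintro t ⟨ht0, ht1⟩ x ⟨hx1, hx2, hx3⟩
    have hang : angPart (A x + t • B x) = angPart x := by
      unfold angPart
      rw [hval, hval]
      simp
    refine ⟨?_, ?_, ?_⟩
    · rw [hval]
      simpa using hx1
    · rw [hval, hval]
      simp
      nlinarith
    · rwa [hang]
  -- The quotient is ∫₀¹ ∂_u f(v + t(u − v), v, θ) dt. The fundamental theorem of calculus along the
  -- segment gives the factor u − v.
  refine ⟨segAvg A B 0 (pd (closedDom e) 0 f), ?_, ?_⟩
  · rw [Smooth, contDiffOn_infty]
    exact fun n => contDiffOn_segAvg (uniqueDiffOn_closedDom e) hmap (locally_convex_closedDom e) n 0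
      (contDiffOn_infty.1 (hf.pd 0) n)
  · intro x hx
    have hB' : B x = (x 0 - x 1) • w := rfl
    have hc := continuousOn_segment hmap hf.continuousOn hx 0
    simp only [pow_zero, one_smul] at hc
    have hc' := intervalIntegrable_segment hmap (hf.pd 0).continuousOn hx 0
    simp only [pow_zero, one_smul] at hc'
    have hder : ∀ t ∈ Set.Ioo (min (0 : ℝ) 1) (max 0 1),
        HasDerivWithinAt (fun t : ℝ => f (A x + t • B x))
          ((x 0 - x 1) * pd (closedDom e) 0 f (A x + t • B x)) (Set.Ioi t) t := by
      intro t ht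
      rw [min_eq_left zero_le_one, max_eq_right zero_le_one] at ht
      have h1 := (hf.diff (hmap t ⟨ht.1.le, ht.2.le⟩ x hx)).hasFDerivWithinAt
      have h2 : HasDerivWithinAt (fun t : ℝ => A x + t • B x) (B x) (Set.Icc 0 1) t := by
        simpa using (((hasDerivAt_id t).smul_const (B x)).const_add (A x)).hasDerivWithinAt
      have h3 := h1.comp_hasDerivWithinAt t h2 fun s hs => hmap s hs x hx
      have h4 : fderivWithin ℝ f (closedDom e) (A x + t • B x) (B x)
          = (x 0 - x 1) * pd (closedDom e) 0 f (A x + t • B x) := by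
        rw [hB', map_smul, smul_eq_mul, pd]
      rw [← h4]
      exact (h3.hasDerivAt (Icc_mem_nhds ht.1 ht.2)).hasDerivWithinAt
    have := intervalIntegral.integral_eq_sub_of_hasDeriv_right
      (by rwa [Set.uIcc_of_le zero_le_one]) hder (hc'.const_mul _)
    rw [intervalIntegral.integral_const_mul] at this
    have hend : f (A x + (0 : ℝ) • B x) = 0 :=
      h0 _ (hmap 0 (by simp) x hx) (by rw [hval, hval]; simp)
    have hstart : A x + (1 : ℝ) • B x = x := by
      ext j
      rw [hval]
      split_ifs with h
      · subst h
        ring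
      · rfl
    rw [hend, hstart, sub_zero] at this
    rw [← this, segAvg]
    simp

/-- Divisibility by `u - v` is preserved and detected in the interior. -/
theorem Smooth.eq_zero_of_mul {f : Coord → ℝ} (hf : Smooth e f)
    (h : ∀ x ∈ intDom e, (x 0 - x 1) * f x = 0) : ∀ x ∈ closedDom e, f x = 0 := by
  refine eq_of_eq_on_intDom hf contDiffOn_const fun x hx => ?_
  have : x 0 - x 1 ≠ 0 := sub_ne_zero.2 hx.2.1.ne'
  exact (mul_eq_zero.1 (h x hx)).resolve_left this

end AAdS

end

noncomputable section

namespace AAdS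

/-! ## The area radius near the conformal boundary -/

section AreaRadius

variable {M k : ℝ} {r : ℝ → ℝ}

/-- For small positive r the term −2M/r dominates and makes r decrease. So r cannot leave the value
0 upwards, while it must become positive before r⋆ = 0. -/
theorem IsAreaRadius.pos (hM : 0 < M) (hr : IsAreaRadius M k r) {s : ℝ} (hs : s < 0) :
    0 < r s := by
  obtain ⟨hode, hlim⟩ := hr
  by_contra hneg
  rw [not_lt] at hneg
  have hcont : ∀ t < 0, ContinuousAt r t := fun t ht => (hode t ht).continuousAt
  obtain ⟨t₁, ht₁, ht₁'⟩ : ∃ t₁, t₁ ∈ Set.Ioo s 0 ∧ ∀ t ∈ Set.Ico t₁ 0, 0 < r t := by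
    have h := hlim.eventually_gt_atTop 0
    obtain ⟨a, ha, ha'⟩ := (mem_nhdsLT_iff_exists_Ioo_subset' (sub_one_lt (0 : ℝ))).1 h
    have ha0 : a < 0 := ha
    have hm : max a s < 0 := max_lt ha0 hs
    refine ⟨max a s / 2, ⟨?_, by linarith⟩, fun t ht => ha' ⟨?_, ht.2⟩⟩
    · linarith [le_max_right a s]
    · linarith [le_max_left a s, ht.1]
  -- Its supremum z is the last time at which r ≤ 0. At r = 0 the convention 2M/0 = 0 makes the
  -- equation meaningless; at z only the continuity of r is used, and the sign of r' is taken to the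
  -- right of z.
  set Z : Set ℝ := {t | t ∈ Set.Icc s t₁ ∧ r t ≤ 0} with hZ
  have hZne : Z.Nonempty := ⟨s, ⟨le_rfl, ht₁.1.le⟩, hneg⟩
  have hZb : BddAbove Z := ⟨t₁, fun t ht => ht.1.2⟩
  have hZc : IsClosed Z := by
    have hc : ContinuousOn r (Set.Icc s t₁) := fun t ht =>
      (hcont t (ht.2.trans_lt ht₁.2)).continuousWithinAt
    exact hc.preimage_isClosed_of_isClosed isClosed_Icc isClosed_Iic
  set z := sSup Z with hz
  have hzZ : z ∈ Z := hZc.csSup_mem hZne hZb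
  have hzlt : z < t₁ := lt_of_le_of_ne hzZ.1.2 fun h => by
    have := ht₁' t₁ ⟨le_rfl, ht₁.2⟩
    rw [h] at hzZ
    linarith [hzZ.2]
  have hpos : ∀ t ∈ Set.Ioc z t₁, 0 < r t := fun t ht => by
    by_contra hc
    rw [not_lt] at hc
    have : t ≤ z := le_csSup hZb ⟨⟨hzZ.1.1.trans ht.1.le, ht.2⟩, hc⟩
    linarith [ht.1]
  have hz0 : z < 0 := hzlt.trans ht₁.2
  have hrz : r z = 0 := by
    have hlim' : Filter.Tendsto r (nhdsWithin z (Set.Ioi z)) (nhds (r z)) :=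
      (hcont z hz0).tendsto.mono_left nhdsWithin_le_nhds
    refine le_antisymm hzZ.2 (ge_of_tendsto hlim' ?_)
    filter_upwards [Ioc_mem_nhdsGT hzlt] with t ht using (hpos t ht).le
  -- just to the right of `z` the function is small and positive, hence decreasing
  have hlimF : Filter.Tendsto (fun t => r t - 2 * M + k ^ 2 * r t ^ 3) (nhds z)
      (nhds (0 - 2 * M + k ^ 2 * 0 ^ 3)) := by
    have := (hcont z hz0).tendsto
    rw [hrz] at this
    exact (this.sub_const _).add ((this.pow 3).const_mul _)
  have hev : ∀ᶠ t in nhds z, r t - 2 * M + k ^ 2 * r t ^ 3 < 0 :=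
    hlimF.eventually_lt_const (by nlinarith)
  obtain ⟨δ, hδ, hball⟩ := Metric.eventually_nhds_iff.1 hev
  set c := min (z + δ / 2) t₁ with hc
  have hzc : z < c := lt_min (by linarith) hzlt
  have hct : c ≤ t₁ := min_le_right _ _
  have hanti : AntitoneOn r (Set.Icc z c) := by
    refine antitoneOn_of_deriv_nonpos (convex_Icc z c) ?_ ?_ ?_
    · exact fun t ht => (hcont t (by linarith [ht.2, ht₁.2])).continuousWithinAt
    · rw [interior_Icc]
      exact fun t ht =>
        (hode t (by linarith [ht.2, ht₁.2])).differentiableAt.differentiableWithinAt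
    · rw [interior_Icc]
      intro t ht
      rw [(hode t (by linarith [ht.2, ht₁.2])).deriv]
      have hp := hpos t ⟨ht.1, by linarith [ht.2]⟩
      have hn : r t - 2 * M + k ^ 2 * r t ^ 3 < 0 := by
        refine hball ?_
        rw [Real.dist_eq, abs_of_pos (by linarith [ht.1])]
        linarith [ht.2, min_le_left (z + δ / 2) t₁]
      have : 1 - 2 * M / r t + k ^ 2 * r t ^ 2 = (r t - 2 * M + k ^ 2 * r t ^ 3) / r t := by
        field_simp
      rw [this]
      exact (div_neg_of_neg_of_pos hn hp).le
  have h1 := hanti ⟨le_rfl, hzc.le⟩ ⟨hzc.le, le_rfl⟩ hzc.le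
  have h2 := hpos c ⟨hzc, hct⟩
  linarith

/-- The reciprocal `1 / r` of the area radius, extended by zero. -/
def recipRadius (r : ℝ → ℝ) (s : ℝ) : ℝ := if s < 0 then (r s)⁻¹ else 0

theorem continuousWithinAt_recipRadius_zero (hr : IsAreaRadius M k r) :
    ContinuousWithinAt (recipRadius r) (Set.Iio 0) 0 := by
  have h : Filter.Tendsto (fun s => (r s)⁻¹) (nhdsWithin 0 (Set.Iio 0)) (nhds 0) :=
    hr.2.inv_tendsto_atTop
  have h0 : recipRadius r 0 = 0 := by simp [recipRadius]
  rw [ContinuousWithinAt, h0]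
  refine h.congr' ?_
  filter_upwards [self_mem_nhdsWithin] with s hs
  rw [recipRadius, if_pos (Set.mem_Iio.1 hs)]

/-- In terms of y = 1/r the equation becomes y' = −(k² + y² − 2My³), which is regular at y = 0, that
is, at the conformal boundary. -/
theorem hasDerivAt_recipRadius (hM : 0 < M) (hr : IsAreaRadius M k r) {s : ℝ} (hs : s < 0) :
    HasDerivAt (recipRadius r)
      (-(k ^ 2 + recipRadius r s ^ 2 - 2 * M * recipRadius r s ^ 3)) s := by
  have hpos := hr.pos hM hs
  have h := (hr.1 s hs).inv hpos.ne'
  have heq : recipRadius r =ᶠ[nhds s] fun t => (r t)⁻¹ := by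
    filter_upwards [Iio_mem_nhds hs] with t ht
    rw [recipRadius, if_pos (Set.mem_Iio.1 ht)]
  refine (h.congr_of_eventuallyEq heq).congr_deriv ?_
  rw [recipRadius, if_pos hs]
  field_simp
  ring

/-- At the endpoint the one-sided derivative exists because y is continuous there and y' has a
limit. -/
theorem hasDerivWithinAt_recipRadius (hM : 0 < M) (hr : IsAreaRadius M k r) {s : ℝ}
    (hs : s ∈ Set.Iic (0 : ℝ)) :
    HasDerivWithinAt (recipRadius r)
      (-(k ^ 2 + recipRadius r s ^ 2 - 2 * M * recipRadius r s ^ 3)) (Set.Iic 0) s := by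
  rcases lt_or_eq_of_le (Set.mem_Iic.1 hs) with h | rfl
  · exact (hasDerivAt_recipRadius hM hr h).hasDerivWithinAt
  · have hc := continuousWithinAt_recipRadius_zero hr
    refine hasDerivWithinAt_Iic_of_tendsto_deriv (s := Set.Iio 0)
      (fun t ht => (hasDerivAt_recipRadius hM hr ht).differentiableAt.differentiableWithinAt) hc
      self_mem_nhdsWithin ?_
    have ht : Filter.Tendsto (recipRadius r) (nhdsWithin 0 (Set.Iio 0))
      (nhds (recipRadius r 0)) := hc
    refine Filter.Tendsto.congr' ?_
      (((ht.pow 2).const_add (k ^ 2)).sub ((ht.pow 3).const_mul (2 * M))).neg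
    filter_upwards [self_mem_nhdsWithin] with t ht'
    rw [(hasDerivAt_recipRadius hM hr ht').deriv]

/-- Bootstrap: the right-hand side of the equation is a polynomial in y, hence as regular as y. -/
theorem contDiffOn_recipRadius (hM : 0 < M) (hr : IsAreaRadius M k r) :
    ContDiffOn ℝ ∞ (recipRadius r) (Set.Iic 0) := by
  have hd := fun s (hs : s ∈ Set.Iic (0 : ℝ)) => hasDerivWithinAt_recipRadius hM hr hs
  rw [contDiffOn_infty]
  intro n
  induction n with
  | zero => exact contDiffOn_zero.2 fun s hs => (hd s hs).continuousWithinAt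
  | succ n ih =>
    push_cast
    rw [contDiffOn_succ_iff_derivWithin (uniqueDiffOn_Iic 0)]
    refine ⟨fun s hs => (hd s hs).differentiableWithinAt, fun h => ?_, ?_⟩
    · exact absurd h (by exact_mod_cast WithTop.coe_ne_top)
    · refine ContDiffOn.congr (f := fun s =>
        -(k ^ 2 + recipRadius r s ^ 2 - 2 * M * recipRadius r s ^ 3)) ?_
        fun s hs => (hd s hs).derivWithin (uniqueDiffOn_Iic 0 s hs)
      exact ((contDiffOn_const.add (ih.pow 2)).sub (contDiffOn_const.mul (ih.pow 3))).neg

/-- The function `r (u - v)` extends smoothly to the conformal boundary. -/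
theorem IsAreaRadius.exists_smooth_mul (hM : 0 < M) (hk : 0 < k) (hr : IsAreaRadius M k r)
    (e : SChart) :
    ∃ q, Smooth e q ∧ (∀ x ∈ closedDom e, q x ≠ 0) ∧
      ∀ x ∈ intDom e, r (x 1 - x 0) = q x / (x 0 - x 1) := by
  have hmaps : Set.MapsTo (fun x : Coord => x 1 - x 0) (closedDom e) (Set.Iic 0) := fun x hx =>
    sub_nonpos.2 hx.2.1
  have hφ : Smooth e (fun x : Coord => x 1 - x 0) := (smooth_coord e 1).sub (smooth_coord e 0)
  have hf : Smooth e (fun x => recipRadius r (x 1 - x 0)) :=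
    (contDiffOn_recipRadius hM hr).comp hφ hmaps
  obtain ⟨q, hq, hfq⟩ := exists_smooth_quotient hf fun x _ hx => by simp [recipRadius, hx]
  have hq0 : ∀ x ∈ closedDom e, q x ≠ 0 := by
    intro x hx h0
    rcases lt_or_eq_of_le hx.2.1 with h | h
    · have h1 := hfq x hx
      rw [h0, mul_zero, recipRadius, if_pos (by linarith)] at h1
      exact (inv_pos.2 (hr.pos hM (sub_neg.2 h))).ne' h1
    · have h1 := pd_congr hfq hx 0
      rw [pd_mul 0 hx ((smooth_defining e).diff hx) (hq.diff hx), h0, h, sub_self,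
        zero_mul, mul_zero, add_zero] at h1
      have h2 := (hasDerivWithinAt_recipRadius hM hr (hmaps hx)).comp_hasFDerivWithinAt x
        (hφ.diff hx).hasFDerivWithinAt hmaps
      have h3 : fderivWithin ℝ (fun x => recipRadius r (x 1 - x 0)) (closedDom e) x = _ :=
        h2.fderivWithin (uniqueDiffOn_closedDom e x hx)
      have h4 : pd (closedDom e) 0 (fun x => x 1 - x 0) x = -1 := by
        rw [pd_sub 0 hx ((smooth_coord e 1).diff hx) ((smooth_coord e 0).diff hx),
          pd_coord 0 hx, pd_coord 0 hx]
        simp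
      rw [pd, h3, smul_apply, smul_eq_mul] at h1
      change _ * pd (closedDom e) 0 (fun x => x 1 - x 0) x = 0 at h1
      rw [h4] at h1
      simp [recipRadius, h] at h1
      exact hk.ne' h1
  refine ⟨fun x => (q x)⁻¹, hq.inv hq0, fun x hx => inv_ne_zero (hq0 x hx), fun x hx => ?_⟩
  have h1 := hfq x (intDom_subset_closedDom e hx)
  have hlt : x 1 - x 0 < 0 := sub_neg.2 hx.2.1
  rw [recipRadius, if_pos hlt] at h1
  rw [← inv_inv (r (x 1 - x 0)), h1, mul_inv, div_eq_mul_inv, mul_comm]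

end AreaRadius

end AAdS

end

noncomputable section

namespace AAdS

/-! ## Metrics which are smooth up to the boundary -/

/-- A nondegenerate symmetric bilinear form which is smooth up to the boundary. -/
structure IsRegularMetric (e : SChart) (h : MetricField) : Prop where
  smooth : ∀ i j, Smooth e (fun x => h x i j)
  symm : ∀ x ∈ closedDom e, ∀ i j, h x i j = h x j i
  det_ne : ∀ x ∈ closedDom e, (h x).det ≠ 0

/-! ### Smoothness of determinants and inverse matrices -/

section MatrixEntries

variable {e : SChart} {n : ℕ}

theorem smooth_det {a : Coord → Matrix (Fin n) (Fin n) ℝ}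
    (ha : ∀ i j, Smooth e (fun x => a x i j)) : Smooth e (fun x => (a x).det) := by
  simp only [Matrix.det_apply]
  refine ContDiffOn.sum fun σ _ => ?_
  simp only [Units.smul_def, zsmul_eq_mul]
  exact contDiffOn_const.mul (contDiffOn_prod fun i _ => ha _ _)

theorem smooth_inv {a : Coord → Matrix (Fin n) (Fin n) ℝ}
    (ha : ∀ i j, Smooth e (fun x => a x i j)) (h0 : ∀ x ∈ closedDom e, (a x).det ≠ 0)
    (i j : Fin n) : Smooth e (fun x => (a x)⁻¹ i j) := by
  simp only [Matrix.inv_def, Ring.inverse_eq_inv', Matrix.smul_apply, smul_eq_mul,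
    Matrix.adjugate_apply]
  refine ((smooth_det ha).inv h0).mul (smooth_det fun p q => ?_)
  by_cases hp : p = j
  · subst hp
    simp only [Matrix.updateRow_self]
    exact contDiffOn_const
  · simp only [Matrix.updateRow_ne hp]
    exact ha p q

end MatrixEntries

section Calculus

variable {e : SChart} {h : MetricField}

/-- Christoffel symbols of the first kind. -/
def christoffelLow (D : Set Coord) (g : MetricField) (n j l : Fin 4) (x : Coord) : ℝ :=
  (1 / 2) * (pd D j (fun y => g y n l) x + pd D l (fun y => g y n j) x
    - pd D n (fun y => g y j l) x)

theorem christoffel_eq (D : Set Coord) (g : MetricField) (i j l : Fin 4) (x : Coord) :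
    christoffel D g i j l x = ∑ m, (g x)⁻¹ i m * christoffelLow D g m j l x := by
  simp only [christoffel, christoffelLow, Finset.mul_sum]
  exact Finset.sum_congr rfl fun _ _ => by ring

theorem sum_mul_inv_mul {g : Matrix (Fin 4) (Fin 4) ℝ} (hg : g.det ≠ 0) (i : Fin 4)
    (f : Fin 4 → ℝ) : ∑ m, g i m * ∑ n, g⁻¹ m n * f n = f i := by
  have h1 : g * g⁻¹ = 1 := Matrix.mul_nonsing_inv g (isUnit_iff_ne_zero.2 hg)
  have h2 : g.mulVec (g⁻¹.mulVec f) = f := by rw [Matrix.mulVec_mulVec, h1, Matrix.one_mulVec]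
  exact congrFun h2 i

/-- Raising an index that was just lowered gives back the original; it returns `riemann` to
`riemannUp` when traces are taken. -/
theorem sum_inv_mul_mul {g : Matrix (Fin 4) (Fin 4) ℝ} (hg : g.det ≠ 0) (i : Fin 4)
    (f : Fin 4 → ℝ) : ∑ m, g⁻¹ i m * ∑ n, g m n * f n = f i := by
  have h1 : g⁻¹ * g = 1 := Matrix.nonsing_inv_mul g (isUnit_iff_ne_zero.2 hg)
  have h2 : g⁻¹.mulVec (g.mulVec f) = f := by rw [Matrix.mulVec_mulVec, h1, Matrix.one_mulVec]
  exact congrFun h2 i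

theorem sum_inv_mul {g : Matrix (Fin 4) (Fin 4) ℝ} (hg : g.det ≠ 0) (i j : Fin 4) :
    ∑ m, g⁻¹ i m * g m j = if i = j then 1 else 0 := by
  have h1 : g⁻¹ * g = 1 := Matrix.nonsing_inv_mul g (isUnit_iff_ne_zero.2 hg)
  have := congrFun (congrFun h1 i) j
  rwa [Matrix.mul_apply, Matrix.one_apply] at this

theorem sum_christoffel {D : Set Coord} {g : MetricField} {x : Coord} (hg : (g x).det ≠ 0)
    (i j l : Fin 4) :
    ∑ n, g x i n * christoffel D g n j l x = christoffelLow D g i j l x := by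
  simp only [christoffel_eq]
  exact sum_mul_inv_mul hg i _

namespace IsRegularMetric

variable (hh : IsRegularMetric e h)
include hh

theorem inv_symm {x : Coord} (hx : x ∈ closedDom e) (i j : Fin 4) :
    (h x)⁻¹ i j = (h x)⁻¹ j i := by
  have h1 : (h x).transpose = h x := Matrix.ext fun a c => hh.symm x hx c a
  have h2 : ((h x)⁻¹).transpose = (h x)⁻¹ := by rw [Matrix.transpose_nonsing_inv, h1]
  exact congrFun (congrFun h2 j) i

theorem smooth_inv (i j : Fin 4) : Smooth e (fun x => (h x)⁻¹ i j) :=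
  AAdS.smooth_inv hh.smooth hh.det_ne i j

theorem smooth_christoffel (i j l : Fin 4) : Smooth e (christoffel (closedDom e) h i j l) := by
  refine contDiffOn_const.mul (ContDiffOn.sum fun m _ => (hh.smooth_inv i m).mul ?_)
  exact (((hh.smooth m l).pd j).add ((hh.smooth m j).pd l)).sub ((hh.smooth j l).pd m)

theorem smooth_riemannUp (i j l m : Fin 4) : Smooth e (riemannUp (closedDom e) h i j l m) := by
  refine (((hh.smooth_christoffel i m j).pd l).sub ((hh.smooth_christoffel i l j).pd m)).add ?_
  exact ContDiffOn.sum fun n _ =>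
    ((hh.smooth_christoffel i l n).mul (hh.smooth_christoffel n m j)).sub
      ((hh.smooth_christoffel i m n).mul (hh.smooth_christoffel n l j))

theorem smooth_riemann (i j l m : Fin 4) : Smooth e (riemann (closedDom e) h i j l m) :=
  ContDiffOn.sum fun n _ => (hh.smooth i n).mul (hh.smooth_riemannUp n j l m)

theorem smooth_ricci (j m : Fin 4) : Smooth e (ricci (closedDom e) h j m) :=
  ContDiffOn.sum fun i _ => hh.smooth_riemannUp i j i m

theorem pd_symm {x : Coord} (hx : x ∈ closedDom e) (i j l : Fin 4) :
    pd (closedDom e) l (fun y => h y i j) x = pd (closedDom e) l (fun y => h y j i) x :=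
  pd_congr (fun y hy => hh.symm y hy i j) hx l

theorem christoffelLow_symm {x : Coord} (hx : x ∈ closedDom e) (n j l : Fin 4) :
    christoffelLow (closedDom e) h n j l x = christoffelLow (closedDom e) h n l j x := by
  rw [christoffelLow, christoffelLow, hh.pd_symm hx j l]
  ring

theorem christoffel_symm {x : Coord} (hx : x ∈ closedDom e) (n j l : Fin 4) :
    christoffel (closedDom e) h n j l x = christoffel (closedDom e) h n l j x := by
  simp only [christoffel_eq, hh.christoffelLow_symm hx _ j l]

/-- Metric compatibility. -/
theorem pd_metric {x : Coord} (hx : x ∈ closedDom e) (m j l : Fin 4) :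
    pd (closedDom e) m (fun y => h y j l) x
      = christoffelLow (closedDom e) h j m l x + christoffelLow (closedDom e) h l m j x := by
  rw [christoffelLow, christoffelLow, hh.pd_symm hx l j, hh.pd_symm hx l m, hh.pd_symm hx m j]
  ring

/-- The inverse metric is parallel: differentiate h⁻¹h = 1 and insert metric compatibility. -/
theorem pd_inv {x : Coord} (hx : x ∈ closedDom e) (m i j : Fin 4) :
    pd (closedDom e) m (fun y => (h y)⁻¹ i j) x
      = -∑ n, (christoffel (closedDom e) h i m n x * (h x)⁻¹ n j
          + christoffel (closedDom e) h j m n x * (h x)⁻¹ i n) := by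
  set a : Matrix (Fin 4) (Fin 4) ℝ :=
    Matrix.of fun i j => pd (closedDom e) m (fun y => (h y)⁻¹ i j) x with ha
  set c : Matrix (Fin 4) (Fin 4) ℝ :=
    Matrix.of fun i j => christoffel (closedDom e) h i m j x with hc
  have hu : IsUnit (h x).det := isUnit_iff_ne_zero.2 (hh.det_ne x hx)
  have ht : (h x).transpose = h x := Matrix.ext fun a c => hh.symm x hx c a
  have hti : ((h x)⁻¹).transpose = (h x)⁻¹ := by rw [Matrix.transpose_nonsing_inv, ht]
  -- In matrix form: (∂_m h⁻¹)h + h⁻¹(∂_m h) = 0 with ∂_m h = hc + cᵀh.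
  have key : a * h x + (h x)⁻¹ * (h x * c + c.transpose * h x) = 0 := by
    ext p q
    have h1 : pd (closedDom e) m (fun y => ∑ n, (h y)⁻¹ p n * h y n q) x = 0 := by
      rw [pd_congr (fun y hy => sum_inv_mul (hh.det_ne y hy) p q) hx]
      exact pd_const m _
    rw [pd_sum m _ (f := fun n y => (h y)⁻¹ p n * h y n q) hx fun n _ =>
      Smooth.diff ((hh.smooth_inv p n).mul (hh.smooth n q)) hx] at h1
    simp only [pd_mul m hx ((hh.smooth_inv p _).diff hx) ((hh.smooth _ q).diff hx),
      Finset.sum_add_distrib] at h1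
    have h2 : ∀ n, (h x * c + c.transpose * h x) n q
        = pd (closedDom e) m (fun y => h y n q) x := by
      intro n
      rw [hh.pd_metric hx, ← sum_christoffel (hh.det_ne x hx), ← sum_christoffel (hh.det_ne x hx),
        Matrix.add_apply, Matrix.mul_apply, Matrix.mul_apply]
      congr 1
      refine Finset.sum_congr rfl fun l _ => ?_
      rw [hh.symm x hx q l, mul_comm, Matrix.transpose_apply]
      rfl
    simp only [Matrix.add_apply (a * h x), Matrix.mul_apply (N := h x * c + c.transpose * h x), h2,
      Matrix.mul_apply (M := a), Matrix.zero_apply]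
    exact h1
  have h3 : a = -(c * (h x)⁻¹ + (h x)⁻¹ * c.transpose) := by
    have h4 : a = a * h x * (h x)⁻¹ := by
      rw [Matrix.mul_assoc, Matrix.mul_nonsing_inv _ hu, Matrix.mul_one]
    rw [h4, eq_neg_of_add_eq_zero_left key, Matrix.mul_add, ← Matrix.mul_assoc,
      Matrix.nonsing_inv_mul _ hu, Matrix.one_mul, Matrix.neg_mul, Matrix.add_mul,
      Matrix.mul_assoc (h x)⁻¹, Matrix.mul_assoc c.transpose, Matrix.mul_nonsing_inv _ hu,
      Matrix.mul_one]
  have h5 := congrFun (congrFun h3 i) j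
  rw [Matrix.neg_apply, Matrix.add_apply, Matrix.mul_apply, Matrix.mul_apply,
    ← Finset.sum_add_distrib] at h5
  refine h5.trans (congrArg _ (Finset.sum_congr rfl fun n _ => ?_))
  rw [Matrix.transpose_apply, mul_comm ((h x)⁻¹ i n)]
  rfl

end IsRegularMetric

end Calculus

/-! ## The boundary defining function -/

/-- The components of `d(u - v)`. -/
def dS : Fin 4 → ℝ := ![1, -1, 0, 0]

/-- The gradient of `u - v`. -/
def gradS (h : MetricField) (i : Fin 4) (x : Coord) : ℝ := ∑ m, (h x)⁻¹ i m * dS m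

/-- The squared length of `d(u - v)`. -/
def normS (h : MetricField) (x : Coord) : ℝ := ∑ i, dS i * gradS h i x

/-- The Hessian of `u - v`. -/
def hessS (D : Set Coord) (h : MetricField) (i j : Fin 4) (x : Coord) : ℝ :=
  -∑ n, dS n * christoffel D h n i j x

/-- The Hessian of `u - v` with its first index raised. -/
def hessUp (D : Set Coord) (h : MetricField) (i j : Fin 4) (x : Coord) : ℝ :=
  ∑ n, (h x)⁻¹ i n * hessS D h n j x

theorem pd_defining {e : SChart} {x : Coord} (hx : x ∈ closedDom e) (i : Fin 4) :
    pd (closedDom e) i (fun y => y 0 - y 1) x = dS i := by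
  rw [pd_sub i hx ((smooth_coord e 0).diff hx) ((smooth_coord e 1).diff hx), pd_coord i hx,
    pd_coord i hx]
  fin_cases i <;> simp [dS]

namespace IsRegularMetric

variable {e : SChart} {h : MetricField} (hh : IsRegularMetric e h)
include hh

theorem smooth_gradS (i : Fin 4) : Smooth e (gradS h i) :=
  ContDiffOn.sum fun m _ => (hh.smooth_inv i m).mul contDiffOn_const

theorem smooth_normS : Smooth e (normS h) :=
  ContDiffOn.sum fun i _ => contDiffOn_const.mul (hh.smooth_gradS i)

theorem smooth_hessS (i j : Fin 4) : Smooth e (hessS (closedDom e) h i j) :=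
  (ContDiffOn.sum fun n _ => contDiffOn_const.mul (hh.smooth_christoffel n i j)).neg

theorem smooth_hessUp (i j : Fin 4) : Smooth e (hessUp (closedDom e) h i j) :=
  ContDiffOn.sum fun n _ => (hh.smooth_inv i n).mul (hh.smooth_hessS n j)

theorem hessS_symm {x : Coord} (hx : x ∈ closedDom e) (i j : Fin 4) :
    hessS (closedDom e) h i j x = hessS (closedDom e) h j i x := by
  simp only [hessS, hh.christoffel_symm hx _ i j]

theorem sum_metric_gradS {x : Coord} (hx : x ∈ closedDom e) (i : Fin 4) :
    ∑ n, h x i n * gradS h n x = dS i :=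
  sum_mul_inv_mul (hh.det_ne x hx) i _

/-- This is ∇_m∇^i s = (Hess s)^i_m written with partial derivatives. It follows from the
parallelism of h⁻¹, since ds has constant components. -/
theorem pd_gradS {x : Coord} (hx : x ∈ closedDom e) (m i : Fin 4) :
    pd (closedDom e) m (gradS h i) x
      = hessUp (closedDom e) h i m x
        - ∑ n, christoffel (closedDom e) h i m n x * gradS h n x := by
  unfold gradS
  rw [pd_sum m _ (f := fun n y => (h y)⁻¹ i n * dS n) hx fun n _ =>
      Smooth.diff ((hh.smooth_inv i n).mul contDiffOn_const) hx]
  simp only [pd_mul m hx ((hh.smooth_inv i _).diff hx) (differentiableWithinAt_const _),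
    pd_const, mul_zero, add_zero, hh.pd_inv hx, hessUp, hessS, hh.christoffel_symm hx _ _ m]
  simp only [Fin.sum_univ_four]
  ring

/-- d|ds|² = 2 Hess s(∇s, ·). One copy of the Hessian comes from its raised form, the other from the
Christoffel terms, because dS·Γ = −Hess s. -/
theorem pd_normS {x : Coord} (hx : x ∈ closedDom e) (m : Fin 4) :
    pd (closedDom e) m (normS h) x = 2 * ∑ i, gradS h i x * hessS (closedDom e) h i m x := by
  unfold normS
  rw [pd_sum m _ (f := fun n y => dS n * gradS h n y) hx fun n _ =>
      Smooth.diff (contDiffOn_const.mul (hh.smooth_gradS n)) hx]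
  have h1 : ∀ i, pd (closedDom e) m (fun y => dS i * gradS h i y) x
      = dS i * (hessUp (closedDom e) h i m x
        - ∑ n, christoffel (closedDom e) h i m n x * gradS h n x) := fun i => by
    rw [pd_mul m hx (differentiableWithinAt_const _) ((hh.smooth_gradS i).diff hx), pd_const,
      hh.pd_gradS hx]
    ring
  have h2 : ∑ i, dS i * hessUp (closedDom e) h i m x
      = ∑ i, gradS h i x * hessS (closedDom e) h i m x := by
    simp only [hessUp, gradS, Finset.mul_sum, Finset.sum_mul]
    rw [Finset.sum_comm]
    refine Finset.sum_congr rfl fun i _ => Finset.sum_congr rfl fun j _ => ?_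
    rw [hh.inv_symm hx j i]
    ring
  have h3 : ∑ i, dS i * ∑ n, christoffel (closedDom e) h i m n x * gradS h n x
      = -∑ i, gradS h i x * hessS (closedDom e) h i m x := by
    simp only [hessS, Finset.mul_sum, mul_neg, Finset.sum_neg_distrib, neg_neg]
    rw [Finset.sum_comm]
    refine Finset.sum_congr rfl fun i _ => Finset.sum_congr rfl fun j _ => ?_
    rw [hh.christoffel_symm hx j i m]
    ring
  simp only [h1, mul_sub, Finset.sum_sub_distrib, h2, h3]
  ring

end IsRegularMetric

end AAdS

end

noncomputable section

namespace AAdS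

/-! ## Conformal change of the metric -/

/-- The difference tensor of the connections of `h` and `(u - v)⁻² h`, up to the factor
`(u - v)⁻¹`. -/
def confDiff (h : MetricField) (i j l : Fin 4) (x : Coord) : ℝ :=
  (if i = j then dS l else 0) + (if i = l then dS j else 0) - h x j l * gradS h i x

section Conformal

variable {e : SChart} {h g : MetricField}

theorem sub_ne_zero_of_mem {x : Coord} (hx : x ∈ intDom e) : x 0 - x 1 ≠ 0 :=
  sub_ne_zero.2 hx.2.1.ne'

theorem pd_invDefining {x : Coord} (hx : x ∈ intDom e) (i : Fin 4) :
    pd (closedDom e) i (fun y => (y 0 - y 1)⁻¹) x = -dS i * (x 0 - x 1)⁻¹ ^ 2 := by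
  have hx' := intDom_subset_closedDom e hx
  rw [pd_inv i hx' ((smooth_defining e).diff hx') (sub_ne_zero_of_mem hx), pd_defining hx']
  rw [div_eq_mul_inv, inv_pow]

theorem diff_invDefining {x : Coord} (hx : x ∈ intDom e) :
    DifferentiableWithinAt ℝ (fun y : Coord => (y 0 - y 1)⁻¹) (closedDom e) x :=
  ((smooth_defining e).diff (intDom_subset_closedDom e hx)).inv (sub_ne_zero_of_mem hx)

theorem pd_invDefining_sq {x : Coord} (hx : x ∈ intDom e) (i : Fin 4) :
    pd (closedDom e) i (fun y => (y 0 - y 1)⁻¹ ^ 2) x = -2 * dS i * (x 0 - x 1)⁻¹ ^ 3 := by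
  have hx' := intDom_subset_closedDom e hx
  simp only [pow_two]
  rw [pd_mul i hx' (diff_invDefining hx) (diff_invDefining hx), pd_invDefining hx]
  ring

variable (hh : IsRegularMetric e h)
  (hg : ∀ x ∈ intDom e, ∀ i j, h x i j = (x 0 - x 1) ^ 2 * g x i j)

include hg in
theorem metric_eq {x : Coord} (hx : x ∈ intDom e) (i j : Fin 4) :
    g x i j = (x 0 - x 1)⁻¹ ^ 2 * h x i j := by
  have := sub_ne_zero_of_mem hx
  rw [hg x hx]
  field_simp

include hh hg

theorem metric_inv_eq {x : Coord} (hx : x ∈ intDom e) (i j : Fin 4) :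
    (g x)⁻¹ i j = (x 0 - x 1) ^ 2 * (h x)⁻¹ i j := by
  have hs := sub_ne_zero_of_mem hx
  have hu : IsUnit (h x).det :=
    isUnit_iff_ne_zero.2 (hh.det_ne x (intDom_subset_closedDom e hx))
  have h1 : g x = (x 0 - x 1)⁻¹ ^ 2 • h x := Matrix.ext fun i j => metric_eq hg hx i j
  have h2 : ((x 0 - x 1) ^ 2 • (h x)⁻¹) * g x = 1 := by
    rw [h1, Matrix.smul_mul, Matrix.mul_smul, Matrix.nonsing_inv_mul _ hu, smul_smul]
    rw [← mul_pow, mul_inv_cancel₀ hs, one_pow, one_smul]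
  rw [Matrix.inv_eq_left_inv h2]
  rfl

theorem pd_conformal {x : Coord} (hx : x ∈ intDom e) (m i j : Fin 4) :
    pd (intDom e) m (fun y => g y i j) x
      = (x 0 - x 1)⁻¹ ^ 2 * pd (closedDom e) m (fun y => h y i j) x
        - 2 * (x 0 - x 1)⁻¹ ^ 3 * dS m * h x i j := by
  have hx' := intDom_subset_closedDom e hx
  rw [pd_intDom _ hx, pd_congr_intDom (fun y hy => metric_eq hg hy i j) hx,
    pd_mul m hx' ((diff_invDefining hx).fun_pow 2) ((hh.smooth i j).diff hx'), pd_invDefining_sq hx]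
  ring

/-- Differentiating the factor s⁻² of the metric produces exactly the three terms of `confDiff`. -/
theorem christoffel_conformal {x : Coord} (hx : x ∈ intDom e) (i j l : Fin 4) :
    christoffel (intDom e) g i j l x = christoffel (closedDom e) h i j l x
      - (x 0 - x 1)⁻¹ * confDiff h i j l x := by
  have hx' := intDom_subset_closedDom e hx
  have hs := sub_ne_zero_of_mem hx
  have h1 : ∀ m, christoffelLow (intDom e) g m j l x
      = (x 0 - x 1)⁻¹ ^ 2 * christoffelLow (closedDom e) h m j l x
        - (x 0 - x 1)⁻¹ ^ 3 * (dS j * h x m l + dS l * h x m j - dS m * h x j l) := by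
    intro m
    simp only [christoffelLow, pd_conformal hh hg hx]
    ring
  have h2 := sum_inv_mul (hh.det_ne x hx') i j
  have h3 := sum_inv_mul (hh.det_ne x hx') i l
  simp only [christoffel_eq, h1, metric_inv_eq hh hg hx, confDiff, gradS]
  have h4 : (if i = j then dS l else 0) = dS l * ∑ m, (h x)⁻¹ i m * h x m j := by
    rw [h2]
    simp
  have h5 : (if i = l then dS j else 0) = dS j * ∑ m, (h x)⁻¹ i m * h x m l := by
    rw [h3]
    simp
  rw [h4, h5]
  simp only [Fin.sum_univ_four]
  field_simp
  ring

omit hg in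
theorem diff_confDiff {x : Coord} (hx : x ∈ closedDom e) (i j l : Fin 4) :
    DifferentiableWithinAt ℝ (confDiff h i j l) (closedDom e) x :=
  Smooth.diff (contDiffOn_const.sub ((hh.smooth j l).mul (hh.smooth_gradS i))) hx

omit hg in
theorem pd_confDiff {x : Coord} (hx : x ∈ closedDom e) (m i j l : Fin 4) :
    pd (closedDom e) m (confDiff h i j l) x
      = -((christoffelLow (closedDom e) h j m l x + christoffelLow (closedDom e) h l m j x)
            * gradS h i x
        + h x j l * (hessUp (closedDom e) h i m x
            - ∑ n, christoffel (closedDom e) h i m n x * gradS h n x)) := by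
  unfold confDiff
  rw [pd_sub m hx (differentiableWithinAt_const _)
      (((hh.smooth j l).diff hx).fun_mul ((hh.smooth_gradS i).diff hx)),
    pd_mul m hx ((hh.smooth j l).diff hx) ((hh.smooth_gradS i).diff hx), pd_const,
    hh.pd_metric hx, hh.pd_gradS hx]
  ring

omit hh hg in
-- This contraction and the two after it evaluate the quadratic terms of the curvature after Γ is
-- replaced by Γ − s⁻¹ `confDiff`.
theorem sum_christoffel_confDiff (i j l m : Fin 4) (x : Coord) :
    ∑ n, christoffel (closedDom e) h i l n x * confDiff h n m j x
      = christoffel (closedDom e) h i l m x * dS j + christoffel (closedDom e) h i l j x * dS m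
        - h x m j * ∑ n, christoffel (closedDom e) h i l n x * gradS h n x := by
  simp only [confDiff, mul_add, mul_sub, Finset.sum_add_distrib, Finset.sum_sub_distrib,
    Finset.mul_sum, mul_ite, mul_zero, Finset.sum_ite_eq', Finset.mem_univ, if_true]
  congr 1
  exact Finset.sum_congr rfl fun _ _ => by ring

omit hg in
theorem sum_confDiff_christoffel {x : Coord} (hx : x ∈ closedDom e) (i j l m : Fin 4) :
    ∑ n, confDiff h i l n x * christoffel (closedDom e) h n m j x
      = (if i = l then -hessS (closedDom e) h m j x else 0)
        + dS l * christoffel (closedDom e) h i m j x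
        - gradS h i x * christoffelLow (closedDom e) h l m j x := by
  have h1 : ∑ n, (if i = l then dS n else 0) * christoffel (closedDom e) h n m j x
      = if i = l then -hessS (closedDom e) h m j x else 0 := by
    split_ifs <;> simp [hessS]
  rw [← sum_christoffel (hh.det_ne x hx) l, ← h1]
  simp only [confDiff, add_mul, sub_mul, Finset.sum_add_distrib, Finset.sum_sub_distrib,
    ite_mul, zero_mul, Finset.sum_ite_eq, Finset.mem_univ, if_true, Finset.mul_sum]
  congr 1
  exact Finset.sum_congr rfl fun _ _ => by ring

omit hg in
theorem sum_confDiff_confDiff {x : Coord} (hx : x ∈ closedDom e) (i j l m : Fin 4) :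
    ∑ n, confDiff h i l n x * confDiff h n m j x
      = (if i = l then 2 * dS m * dS j - h x m j * normS h x else 0)
        + dS l * confDiff h i m j x
        - gradS h i x * (h x l m * dS j + h x l j * dS m - h x m j * dS l) := by
  have h1 : ∑ n, dS n * confDiff h n m j x = 2 * dS m * dS j - h x m j * normS h x := by
    simp only [confDiff, normS, mul_add, mul_sub, Finset.sum_add_distrib, Finset.sum_sub_distrib,
      mul_ite, mul_zero, Finset.sum_ite_eq', Finset.mem_univ, if_true, Finset.mul_sum]
    congr 1
    · ring
    · exact Finset.sum_congr rfl fun _ _ => by ring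
  have h2 : ∑ n, h x l n * confDiff h n m j x
      = h x l m * dS j + h x l j * dS m - h x m j * dS l := by
    rw [← hh.sum_metric_gradS hx l]
    simp only [confDiff, mul_add, mul_sub, Finset.sum_add_distrib, Finset.sum_sub_distrib,
      mul_ite, mul_zero, Finset.sum_ite_eq', Finset.mem_univ, if_true, Finset.mul_sum]
    congr 1
    exact Finset.sum_congr rfl fun _ _ => by ring
  have h3 : ∑ n, (if i = l then dS n else 0) * confDiff h n m j x
      = if i = l then 2 * dS m * dS j - h x m j * normS h x else 0 := by
    split_ifs
    · exact h1
    · simp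
  have h4 : ∀ n, confDiff h i l n x * confDiff h n m j x
      = (if i = l then dS n else 0) * confDiff h n m j x
        + (if i = n then dS l else 0) * confDiff h n m j x
        - gradS h i x * (h x l n * confDiff h n m j x) := fun n => by
    simp only [confDiff]
    ring
  rw [Finset.sum_congr rfl fun n _ => h4 n, Finset.sum_sub_distrib, Finset.sum_add_distrib, h3,
    ← Finset.mul_sum, h2]
  simp

/-- The curvature of `(u - v)⁻² h`. -/
theorem riemannUp_conformal {x : Coord} (hx : x ∈ intDom e) (i j l m : Fin 4) :
    riemannUp (intDom e) g i j l m x = riemannUp (closedDom e) h i j l m x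
      + (x 0 - x 1)⁻¹ * ((if i = l then hessS (closedDom e) h j m x else 0)
          - (if i = m then hessS (closedDom e) h j l x else 0)
          + h x j m * hessUp (closedDom e) h i l x - h x j l * hessUp (closedDom e) h i m x)
      - (x 0 - x 1)⁻¹ ^ 2 * normS h x
          * ((if i = l then h x j m else 0) - (if i = m then h x j l else 0)) := by
  have hx' := intDom_subset_closedDom e hx
  set σ := (x 0 - x 1)⁻¹ with hσ
  have hpd : ∀ l m, pd (intDom e) l (christoffel (intDom e) g i m j) x
      = pd (closedDom e) l (christoffel (closedDom e) h i m j) x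
        - (-dS l * σ ^ 2 * confDiff h i m j x
          + σ * pd (closedDom e) l (confDiff h i m j) x) := by
    intro l m
    rw [pd_intDom _ hx, pd_congr_intDom (fun y hy => christoffel_conformal hh hg hy i m j) hx,
      pd_sub l hx' ((hh.smooth_christoffel i m j).diff hx')
        ((diff_invDefining hx).fun_mul (diff_confDiff hh hx' i m j)),
      pd_mul l hx' (diff_invDefining hx) (diff_confDiff hh hx' i m j), pd_invDefining hx]
  have hprod : ∀ l m, ∑ n, christoffel (intDom e) g i l n x * christoffel (intDom e) g n m j x
      = ∑ n, christoffel (closedDom e) h i l n x * christoffel (closedDom e) h n m j x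
        - σ * ∑ n, christoffel (closedDom e) h i l n x * confDiff h n m j x
        - σ * ∑ n, confDiff h i l n x * christoffel (closedDom e) h n m j x
        + σ ^ 2 * ∑ n, confDiff h i l n x * confDiff h n m j x := by
    intro l m
    simp only [christoffel_conformal hh hg hx, Finset.mul_sum]
    rw [← Finset.sum_sub_distrib, ← Finset.sum_sub_distrib, ← Finset.sum_add_distrib]
    exact Finset.sum_congr rfl fun _ _ => by ring
  simp only [riemannUp, Finset.sum_sub_distrib, hpd, hprod, pd_confDiff hh hx',
    sum_christoffel_confDiff, sum_confDiff_christoffel hh hx', sum_confDiff_confDiff hh hx']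
  -- Symmetries bring the terms of the two index orders l, m to a common form. All Christoffel
  -- symbols outside the curvature of h then cancel, and only the tensors Hess s and |ds|² remain.
  rw [hh.christoffel_symm hx' i m l, hh.hessS_symm hx' m j, hh.hessS_symm hx' l j,
    hh.christoffelLow_symm hx' m l j, hh.christoffelLow_symm hx' j l m,
    hh.christoffelLow_symm hx' l m j,
    hh.symm x hx' m j, hh.symm x hx' l j, hh.symm x hx' m l]
  simp only [confDiff]
  rw [hh.symm x hx' m j, hh.symm x hx' l j]
  split_ifs <;> ring

/-- The Ricci curvature of `(u - v)⁻² h`. -/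
theorem ricci_conformal {x : Coord} (hx : x ∈ intDom e) (j m : Fin 4) :
    ricci (intDom e) g j m x = ricci (closedDom e) h j m x
      + (x 0 - x 1)⁻¹ * (2 * hessS (closedDom e) h j m x
          + h x j m * ∑ i, hessUp (closedDom e) h i i x)
      - 3 * (x 0 - x 1)⁻¹ ^ 2 * normS h x * h x j m := by
  have hx' := intDom_subset_closedDom e hx
  have h1 : ∑ i, h x j i * hessUp (closedDom e) h i m x = hessS (closedDom e) h j m x :=
    sum_mul_inv_mul (hh.det_ne x hx') j _
  simp only [ricci, riemannUp_conformal hh hg hx, Finset.sum_sub_distrib, Finset.sum_add_distrib,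
    ← Finset.mul_sum, h1, Finset.sum_ite_eq', Finset.mem_univ, if_true, Finset.sum_const,
    Finset.card_univ, Fintype.card_fin, nsmul_eq_mul]
  push_cast
  ring

end Conformal

end AAdS

end

noncomputable section

namespace AAdS

/-! ## Algebraic curvature tensors -/

section Algebra

variable {C : Fin 4 → Fin 4 → Fin 4 → Fin 4 → ℝ}

/-- The symmetries of the Riemann tensor. -/
structure IsCurvatureTensor (C : Fin 4 → Fin 4 → Fin 4 → Fin 4 → ℝ) : Prop where
  antisymm_left : ∀ i j l m, C i j l m = -C j i l m
  antisymm_right : ∀ i j l m, C i j l m = -C i j m l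
  bianchi : ∀ i j l m, C i j l m + C i l m j + C i m j l = 0

/-- The usual combination of four Bianchi identities, one for each cyclic rotation of the indices,
with the antisymmetries. -/
theorem IsCurvatureTensor.pair_symm (hC : IsCurvatureTensor C) (i j l m : Fin 4) :
    C i j l m = C l m i j := by
  have b1 := hC.bianchi i j l m
  have b2 := hC.bianchi j l m i
  have b3 := hC.bianchi l m i j
  have b4 := hC.bianchi m i j l
  have r := hC.antisymm_right
  have l' := hC.antisymm_left
  linarith [l' i j l m, l' j l m i, l' l m i j, l' m i j l, r i l m j, l' i l m j,
    r i m j l, l' i m j l, r j m i l, l' j m i l, r j i l m, l' j i l m, r l i j m, l' l i j m,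
    r l j m i, l' l j m i, r m j l i, l' m j l i, r m l i j, l' m l i j, l' l i m j]

/-- A two-form annihilated by a vector with nonzero 0-component is determined by its components in
the indices 1, 2, 3. -/
theorem antisymm_eq_zero {F : Fin 4 → Fin 4 → ℝ} (hF : ∀ i j, F i j = -F j i) {c d : ℝ}
    (h0 : ∀ j, F 0 j = F 1 j - c * F 2 j - d * F 3 j) (h12 : F 1 2 = 0) (h13 : F 1 3 = 0)
    (h23 : F 2 3 = 0) (i j : Fin 4) : F i j = 0 := by
  have hd : ∀ i, F i i = 0 := fun i => by linarith [hF i i]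
  have h21 : F 2 1 = 0 := by rw [hF, h12, neg_zero]
  have h31 : F 3 1 = 0 := by rw [hF, h13, neg_zero]
  have h32 : F 3 2 = 0 := by rw [hF, h23, neg_zero]
  have h01 : F 0 1 = 0 := by rw [h0, hd, h21, h31]; ring
  have h02 : F 0 2 = 0 := by rw [h0, hd, h12, h32]; ring
  have h03 : F 0 3 = 0 := by rw [h0, hd, h13, h23]; ring
  have h10 : F 1 0 = 0 := by rw [hF, h01, neg_zero]
  have h20 : F 2 0 = 0 := by rw [hF, h02, neg_zero]
  have h30 : F 3 0 = 0 := by rw [hF, h03, neg_zero]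
  fin_cases i <;> fin_cases j <;> first | exact hd _ | assumption

/-- A trace-free algebraic curvature tensor in dimension four which is annihilated by a nonnull
vector vanishes. Here the inverse metric is in double null form
`-c (∂_v ⊗ (∂_u + b) + (∂_u + b) ⊗ ∂_v) + q`. -/
theorem IsCurvatureTensor.eq_zero (hC : IsCurvatureTensor C) {c b₁ b₂ q₁₁ q₁₂ q₂₂ : ℝ}
    (hc : c ≠ 0) (hq : q₁₁ * q₂₂ - q₁₂ ^ 2 ≠ 0)
    (hN : ∀ j l m, C 0 j l m = C 1 j l m - b₁ * C 2 j l m - b₂ * C 3 j l m)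
    (htr : ∀ j m, -c * (C 0 j 1 m + C 1 j 0 m + b₁ * (C 1 j 2 m + C 2 j 1 m)
        + b₂ * (C 1 j 3 m + C 3 j 1 m))
      + (q₁₁ * C 2 j 2 m + q₁₂ * (C 2 j 3 m + C 3 j 2 m) + q₂₂ * C 3 j 3 m) = 0)
    (i j l m : Fin 4) : C i j l m = 0 := by
  have ps := hC.pair_symm
  have al := hC.antisymm_left
  have ar := hC.antisymm_right
  have hN3 : ∀ i j m, C i j 0 m = C i j 1 m - b₁ * C i j 2 m - b₂ * C i j 3 m := fun i j m => by
    rw [ps i j 0 m, hN, ps 1 m, ps 2 m, ps 3 m]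
  have dl : ∀ i l m, C i i l m = 0 := fun i l m => by linarith [al i i l m]
  have dr : ∀ i j l, C i j l l = 0 := fun i j l => by linarith [ar i j l l]
  -- Eliminating the index 0 leaves a curvature tensor in the three indices 1, 2, 3, and its trace
  -- is now with respect to −2c ∂_v² + q. The shift drops out. This is a three-dimensional Ricci
  -- tensor, and in dimension three the Ricci tensor determines the curvature.
  have tr : ∀ j m, -2 * c * C 1 j 1 m
      + (q₁₁ * C 2 j 2 m + q₁₂ * (C 2 j 3 m + C 3 j 2 m) + q₂₂ * C 3 j 3 m) = 0 := fun j m => by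
    rw [← htr j m, hN, hN3]
    ring
  set x₁ := C 1 2 1 2 with h₁
  set x₂ := C 1 2 1 3 with h₂
  set x₃ := C 1 3 1 3 with h₃
  set x₄ := C 1 2 2 3 with h₄
  set x₅ := C 1 3 2 3 with h₅
  set x₆ := C 2 3 2 3 with h₆
  have t11 := tr 1 1
  have t12 := tr 1 2
  have t13 := tr 1 3
  have t22 := tr 2 2
  have t23 := tr 2 3
  have t33 := tr 3 3
  have e1 : C 2 1 2 1 = x₁ := by rw [al, ar]; simp [h₁]
  have e2 : C 2 1 3 1 = x₂ := by rw [al, ar]; simp [h₂]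
  have e2' : C 3 1 2 1 = x₂ := by rw [ps, e2]
  have e3 : C 3 1 3 1 = x₃ := by rw [al, ar]; simp [h₃]
  have e4 : C 2 1 3 2 = x₄ := by rw [al, ar]; simp [h₄]
  have e5 : C 3 1 3 2 = x₅ := by rw [al, ar]; simp [h₅]
  have e4' : C 2 1 2 3 = -x₄ := by rw [al]
  have e5' : C 3 1 2 3 = -x₅ := by rw [al]
  have e6 : C 3 2 3 2 = x₆ := by rw [al, ar]; simp [h₆]
  have e6' : C 3 2 2 3 = -x₆ := by rw [al]
  simp only [dl, dr, e1, e2, e2', e3, e4, e5, e4', e5', e6, e6', mul_zero, add_zero, zero_add]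
    at t11 t12 t13 t22 t23 t33
  -- The six components decouple: this combination of traces isolates the sphere curvature x₆, the
  -- mixed traces isolate x₄ and x₅, and then x₁, x₂, x₃ follow.
  have z6 : x₆ = 0 := by
    have : (q₁₁ * q₂₂ - q₁₂ ^ 2) * x₆ = 0 := by
      linear_combination c * t11 + q₁₁ / 2 * t22 + q₁₂ * t23 + q₂₂ / 2 * t33
    exact (mul_eq_zero.1 this).resolve_left hq
  have z4 : x₄ = 0 := by
    have : (q₁₁ * q₂₂ - q₁₂ ^ 2) * x₄ = 0 := by
      linear_combination -q₁₂ * t12 - q₂₂ * t13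
    exact (mul_eq_zero.1 this).resolve_left hq
  have z5 : x₅ = 0 := by
    have : (q₁₁ * q₂₂ - q₁₂ ^ 2) * x₅ = 0 := by
      linear_combination q₁₁ * t12 + q₁₂ * t13
    exact (mul_eq_zero.1 this).resolve_left hq
  have hc2 : -2 * c ≠ 0 := mul_ne_zero (by norm_num) hc
  have z1 : x₁ = 0 := (mul_eq_zero.1 (by linear_combination t22 - q₂₂ * z6)).resolve_left hc2
  have z2 : x₂ = 0 := (mul_eq_zero.1 (by linear_combination t23 + q₁₂ * z6)).resolve_left hc2
  have z3 : x₃ = 0 := (mul_eq_zero.1 (by linear_combination t33 - q₁₁ * z6)).resolve_left hc2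
  have s12 : ∀ i j, C i j 1 2 = 0 := antisymm_eq_zero (fun i j => al i j 1 2) (fun j => hN j 1 2)
    z1 (by rw [ps]; exact z2) (by rw [ps]; exact z4)
  have s13 : ∀ i j, C i j 1 3 = 0 := antisymm_eq_zero (fun i j => al i j 1 3) (fun j => hN j 1 3)
    z2 z3 (by rw [ps]; exact z5)
  have s23 : ∀ i j, C i j 2 3 = 0 := antisymm_eq_zero (fun i j => al i j 2 3) (fun j => hN j 2 3)
    z4 z5 z6
  exact antisymm_eq_zero (F := C i j) (fun l m => ar i j l m) (fun m => hN3 i j m) (s12 i j)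
    (s13 i j) (s23 i j) l m

end Algebra

/-! ## Symmetries of the Riemann tensor -/

namespace IsRegularMetric

variable {e : SChart} {h : MetricField} (hh : IsRegularMetric e h)
include hh

theorem smooth_christoffelLow (i j l : Fin 4) :
    Smooth e (christoffelLow (closedDom e) h i j l) :=
  contDiffOn_const.mul ((((hh.smooth i l).pd j).add ((hh.smooth i j).pd l)).sub
    ((hh.smooth j l).pd i))

omit hh in
theorem riemann_antisymm_right (D : Set Coord) (i j l m : Fin 4) (x : Coord) :
    riemann D h i j l m x = -riemann D h i j m l x := by
  simp only [riemann, ← Finset.sum_neg_distrib]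
  refine Finset.sum_congr rfl fun n _ => ?_
  simp only [riemannUp, Finset.sum_sub_distrib]
  ring

/-- A consequence of the symmetry of the Christoffel symbols alone: in the cyclic sum all terms
cancel in pairs. -/
theorem riemann_bianchi {x : Coord} (hx : x ∈ closedDom e) (i j l m : Fin 4) :
    riemann (closedDom e) h i j l m x + riemann (closedDom e) h i l m j x
      + riemann (closedDom e) h i m j l x = 0 := by
  have hs : ∀ n j l, ∀ y ∈ closedDom e,
      christoffel (closedDom e) h n j l y = christoffel (closedDom e) h n l j y :=
    fun n j l y hy => hh.christoffel_symm hy n j l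
  simp only [riemann, ← Finset.sum_add_distrib, ← mul_add]
  refine Finset.sum_eq_zero fun n _ => mul_eq_zero_of_right _ ?_
  simp only [riemannUp, Finset.sum_sub_distrib]
  rw [pd_congr (hs n m j) hx l, pd_congr (hs n l j) hx m, pd_congr (hs n l m) hx j]
  simp only [hs _ m j x hx, hs _ l j x hx, hs _ l m x hx]
  ring

/-- The Riemann tensor in terms of the Christoffel symbols of the first kind. -/
theorem riemann_eq {x : Coord} (hx : x ∈ closedDom e) (i j l m : Fin 4) :
    riemann (closedDom e) h i j l m x
      = pd (closedDom e) l (christoffelLow (closedDom e) h i m j) x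
        - pd (closedDom e) m (christoffelLow (closedDom e) h i l j) x
        - ∑ n, christoffelLow (closedDom e) h n l i x * christoffel (closedDom e) h n m j x
        + ∑ n, christoffelLow (closedDom e) h n m i x * christoffel (closedDom e) h n l j x := by
  -- Pulling h through the derivative costs, by metric compatibility, two terms. One of them cancels
  -- the product term computed in `hprod`.
  have hpd : ∀ l m, ∑ n, h x i n * pd (closedDom e) l (christoffel (closedDom e) h n m j) x
      = pd (closedDom e) l (christoffelLow (closedDom e) h i m j) x
        - ∑ n, (christoffelLow (closedDom e) h i l n x + christoffelLow (closedDom e) h n l i x)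
          * christoffel (closedDom e) h n m j x := by
    intro l m
    rw [← pd_congr (fun y hy => sum_christoffel (hh.det_ne y hy) i m j) hx l,
      pd_sum l _ (f := fun n y => h y i n * christoffel (closedDom e) h n m j y) hx fun n _ =>
      Smooth.diff ((hh.smooth i n).mul (hh.smooth_christoffel n m j)) hx]
    simp only [pd_mul l hx ((hh.smooth i _).diff hx) ((hh.smooth_christoffel _ m j).diff hx),
      hh.pd_metric hx]
    rw [← Finset.sum_sub_distrib]
    exact Finset.sum_congr rfl fun _ _ => by ring
  have hprod : ∀ l m, ∑ n, h x i n * ∑ p, christoffel (closedDom e) h n l p x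
        * christoffel (closedDom e) h p m j x
      = ∑ n, christoffelLow (closedDom e) h i l n x * christoffel (closedDom e) h n m j x := by
    intro l m
    simp only [← sum_christoffel (hh.det_ne x hx) i l, Finset.mul_sum, Finset.sum_mul]
    rw [Finset.sum_comm]
    exact Finset.sum_congr rfl fun _ _ => Finset.sum_congr rfl fun _ _ => by ring
  simp only [riemann, riemannUp, mul_add, mul_sub, Finset.sum_add_distrib, Finset.sum_sub_distrib,
    hpd, hprod, add_mul]
  ring

/-- Symmetrised in i, j, the derivative terms become the commutator of ∂_l and ∂_m on h_ij. The
quadratic terms cancel because h⁻¹ is symmetric. -/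
theorem riemann_antisymm_left {x : Coord} (hx : x ∈ closedDom e) (i j l m : Fin 4) :
    riemann (closedDom e) h i j l m x = -riemann (closedDom e) h j i l m x := by
  have hq : ∀ i j l m,
      ∑ n, christoffelLow (closedDom e) h n l i x * christoffel (closedDom e) h n m j x
      = ∑ n, christoffelLow (closedDom e) h n m j x * christoffel (closedDom e) h n l i x := by
    intro i j l m
    simp only [christoffel_eq, Finset.mul_sum]
    rw [Finset.sum_comm]
    refine Finset.sum_congr rfl fun p _ => Finset.sum_congr rfl fun n _ => ?_
    rw [hh.inv_symm hx n p]
    ring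
  have hs : ∀ l m, pd (closedDom e) l (christoffelLow (closedDom e) h i m j) x
      + pd (closedDom e) l (christoffelLow (closedDom e) h j m i) x
      = pd (closedDom e) l (pd (closedDom e) m fun y => h y i j) x := by
    intro l m
    rw [← pd_add l hx ((hh.smooth_christoffelLow i m j).diff hx)
      ((hh.smooth_christoffelLow j m i).diff hx)]
    exact pd_congr (fun y hy => (hh.pd_metric hy m i j).symm) hx l
  rw [hh.riemann_eq hx, hh.riemann_eq hx, hq j i l m, hq j i m l]
  have h1 := hs l m
  have h2 := hs m l
  rw [pd_comm (hh.smooth i j) hx l m] at h1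
  linarith

theorem isCurvatureTensor_riemann {x : Coord} (hx : x ∈ closedDom e) :
    IsCurvatureTensor fun i j l m => riemann (closedDom e) h i j l m x where
  antisymm_left := hh.riemann_antisymm_left hx
  antisymm_right i j l m := riemann_antisymm_right _ i j l m x
  bianchi := hh.riemann_bianchi hx

/-- The Ricci identity for `d(u - v)`. -/
theorem sum_gradS_riemann {x : Coord} (hx : x ∈ closedDom e) (j l m : Fin 4) :
    ∑ i, gradS h i x * riemann (closedDom e) h i j l m x
      = pd (closedDom e) m (hessS (closedDom e) h l j) x
        - pd (closedDom e) l (hessS (closedDom e) h m j) x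
        - ∑ n, (hessS (closedDom e) h l n x * christoffel (closedDom e) h n m j x
          - hessS (closedDom e) h m n x * christoffel (closedDom e) h n l j x) := by
  have h1 : ∑ i, gradS h i x * riemann (closedDom e) h i j l m x
      = ∑ n, dS n * riemannUp (closedDom e) h n j l m x := by
    simp only [← hh.sum_metric_gradS hx, riemann, Finset.mul_sum, Finset.sum_mul]
    rw [Finset.sum_comm]
    refine Finset.sum_congr rfl fun p _ => Finset.sum_congr rfl fun n _ => ?_
    rw [hh.symm x hx n p]
    ring
  have h2 : ∀ l m, pd (closedDom e) l (hessS (closedDom e) h m j) x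
      = -∑ n, dS n * pd (closedDom e) l (christoffel (closedDom e) h n m j) x := by
    intro l m
    unfold hessS
    rw [pd_neg l hx, pd_sum l _ (f := fun n y => dS n * christoffel (closedDom e) h n m j y) hx
      fun n _ => Smooth.diff (contDiffOn_const.mul (hh.smooth_christoffel n m j)) hx]
    simp only [pd_mul l hx (differentiableWithinAt_const _)
      ((hh.smooth_christoffel _ m j).diff hx), pd_const, zero_mul, zero_add]
  rw [h1, h2, h2]
  simp only [riemannUp, hessS, Fin.sum_univ_four]
  ring

end IsRegularMetric

end AAdS

end

noncomputable section

namespace AAdS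

/-! ## Compactified double null data -/

namespace PatchData

variable (P : PatchData) (x : Coord)

theorem metric_zero_zero : P.metric x 0 0 = P.gs x 0 0 * P.b x 0 * P.b x 0
    + P.gs x 0 1 * P.b x 0 * P.b x 1 + P.gs x 1 0 * P.b x 1 * P.b x 0
    + P.gs x 1 1 * P.b x 1 * P.b x 1 := by
  simp [metric, coframe, ang, Fin.sum_univ_two]
  ring

theorem metric_zero_one : P.metric x 0 1 = -2 * P.Ω x ^ 2 := by
  simp [metric, coframe, ang, Fin.sum_univ_two]

theorem metric_one_zero : P.metric x 1 0 = -2 * P.Ω x ^ 2 := by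
  simp [metric, coframe, ang, Fin.sum_univ_two]

theorem metric_one_one : P.metric x 1 1 = 0 := by
  simp [metric, coframe, ang, Fin.sum_univ_two]

theorem metric_one_ang (A : Fin 2) : P.metric x 1 (ang A) = 0 := by
  fin_cases A <;> simp [metric, coframe, ang, Fin.sum_univ_two]

theorem metric_ang_one (A : Fin 2) : P.metric x (ang A) 1 = 0 := by
  fin_cases A <;> simp [metric, coframe, ang, Fin.sum_univ_two]

theorem metric_zero_ang (A : Fin 2) :
    P.metric x 0 (ang A) = -(P.b x 0 * P.gs x 0 A + P.b x 1 * P.gs x 1 A) := by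
  fin_cases A <;> simp [metric, coframe, ang, Fin.sum_univ_two] <;> ring

theorem metric_ang_zero (A : Fin 2) :
    P.metric x (ang A) 0 = -(P.b x 0 * P.gs x A 0 + P.b x 1 * P.gs x A 1) := by
  fin_cases A <;> simp [metric, coframe, ang, Fin.sum_univ_two] <;> ring

theorem metric_ang_ang (A B : Fin 2) : P.metric x (ang A) (ang B) = P.gs x A B := by
  fin_cases A <;> fin_cases B <;> simp [metric, coframe, ang, Fin.sum_univ_two]

/-- The inverse of a metric in double null gauge. -/
def invMetric : Matrix (Fin 4) (Fin 4) ℝ :=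
  !![0, -(2 * P.Ω x ^ 2)⁻¹, 0, 0;
    -(2 * P.Ω x ^ 2)⁻¹, 0, -(2 * P.Ω x ^ 2)⁻¹ * P.b x 0, -(2 * P.Ω x ^ 2)⁻¹ * P.b x 1;
    0, -(2 * P.Ω x ^ 2)⁻¹ * P.b x 0, (P.gs x)⁻¹ 0 0, (P.gs x)⁻¹ 0 1;
    0, -(2 * P.Ω x ^ 2)⁻¹ * P.b x 1, (P.gs x)⁻¹ 1 0, (P.gs x)⁻¹ 1 1]

theorem metric_eq_of : P.metric x =
    !![P.gs x 0 0 * P.b x 0 * P.b x 0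
        + P.gs x 0 1 * P.b x 0 * P.b x 1 + P.gs x 1 0 * P.b x 1 * P.b x 0
        + P.gs x 1 1 * P.b x 1 * P.b x 1, -2 * P.Ω x ^ 2,
        -(P.b x 0 * P.gs x 0 0 + P.b x 1 * P.gs x 1 0),
        -(P.b x 0 * P.gs x 0 1 + P.b x 1 * P.gs x 1 1);
      -2 * P.Ω x ^ 2, 0, 0, 0;
      -(P.b x 0 * P.gs x 0 0 + P.b x 1 * P.gs x 0 1), 0, P.gs x 0 0, P.gs x 0 1;
      -(P.b x 0 * P.gs x 1 0 + P.b x 1 * P.gs x 1 1), 0, P.gs x 1 0, P.gs x 1 1] := by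
  ext i j
  fin_cases i <;> fin_cases j
  · exact P.metric_zero_zero x
  · exact P.metric_zero_one x
  · exact P.metric_zero_ang x 0
  · exact P.metric_zero_ang x 1
  · exact P.metric_one_zero x
  · exact P.metric_one_one x
  · exact P.metric_one_ang x 0
  · exact P.metric_one_ang x 1
  · exact P.metric_ang_zero x 0
  · exact P.metric_ang_one x 0
  · exact P.metric_ang_ang x 0 0
  · exact P.metric_ang_ang x 0 1
  · exact P.metric_ang_zero x 1
  · exact P.metric_ang_one x 1
  · exact P.metric_ang_ang x 1 0
  · exact P.metric_ang_ang x 1 1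

variable {P x}

theorem invMetric_mul (hΩ : P.Ω x ≠ 0) (hsymm : P.gs x 1 0 = P.gs x 0 1)
    (hdet : (P.gs x).det ≠ 0) : P.invMetric x * P.metric x = 1 := by
  have h1 : (P.gs x)⁻¹ * P.gs x = 1 := Matrix.nonsing_inv_mul _ (isUnit_iff_ne_zero.2 hdet)
  have h00 := congrFun (congrFun h1 0) 0
  have h01 := congrFun (congrFun h1 0) 1
  have h10 := congrFun (congrFun h1 1) 0
  have h11 := congrFun (congrFun h1 1) 1
  simp only [Matrix.mul_apply, Fin.sum_univ_two] at h00 h01 h10 h11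
  simp at h00 h01 h10 h11
  rw [hsymm] at h00 h10
  rw [metric_eq_of, invMetric, hsymm]
  ext i j
  fin_cases i <;> fin_cases j <;>
    simp [Matrix.mul_apply, Fin.sum_univ_four] <;> field_simp <;>
    first
    | ring1
    | linear_combination h00
    | linear_combination h01
    | linear_combination h10
    | linear_combination h11
    | linear_combination -P.b x 0 * h00 - P.b x 1 * h01
    | linear_combination -P.b x 0 * h10 - P.b x 1 * h11

theorem metric_det_ne (hΩ : P.Ω x ≠ 0) (hsymm : P.gs x 1 0 = P.gs x 0 1)
    (hdet : (P.gs x).det ≠ 0) : (P.metric x).det ≠ 0 := fun h => by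
  have := congrArg Matrix.det (invMetric_mul hΩ hsymm hdet)
  simp [h] at this

theorem metric_inv (hΩ : P.Ω x ≠ 0) (hsymm : P.gs x 1 0 = P.gs x 0 1)
    (hdet : (P.gs x).det ≠ 0) : (P.metric x)⁻¹ = P.invMetric x :=
  Matrix.inv_eq_left_inv (invMetric_mul hΩ hsymm hdet)

end PatchData

/-- The double null data `Q` are smooth up to the conformal boundary, and their metric is `(u - v)²`
times the metric of the double null data `P`. -/
structure IsCompactification (e : SChart) (P Q : PatchData) : Prop where
  dom : P.D = intDom e
  smooth_lapse : Smooth e Q.Ω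
  smooth_shift : ∀ A, Smooth e (fun x => Q.b x A)
  smooth_sphere : ∀ A B, Smooth e (fun x => Q.gs x A B)
  lapse_pos : ∀ x ∈ closedDom e, 0 < Q.Ω x
  sphere_symm : ∀ x ∈ closedDom e, ∀ A B, Q.gs x A B = Q.gs x B A
  sphere_det : ∀ x ∈ closedDom e, (Q.gs x).det ≠ 0
  lapse_eq : ∀ x ∈ intDom e, P.Ω x = (x 0 - x 1)⁻¹ * Q.Ω x
  shift_eq : ∀ x ∈ intDom e, ∀ A, P.b x A = Q.b x A
  sphere_eq : ∀ x ∈ intDom e, ∀ A B, P.gs x A B = (x 0 - x 1)⁻¹ ^ 2 * Q.gs x A B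

namespace IsCompactification

variable {e : SChart} {P Q : PatchData} (hQ : IsCompactification e P Q)
include hQ

theorem smooth_coframe (A : Fin 2) (i : Fin 4) : Smooth e (fun x => Q.coframe A x i) :=
  contDiffOn_const.sub ((hQ.smooth_shift A).mul contDiffOn_const)

theorem isRegularMetric : IsRegularMetric e Q.metric where
  smooth i j :=
    ((contDiffOn_const.mul (hQ.smooth_lapse.pow 2)).mul contDiffOn_const).add
      (ContDiffOn.sum fun A _ => ContDiffOn.sum fun B _ =>
        ((hQ.smooth_sphere A B).mul (hQ.smooth_coframe A i)).mul (hQ.smooth_coframe B j))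
  symm x hx i j := by
    have := hQ.sphere_symm x hx 0 1
    simp only [PatchData.metric, Matrix.of_apply, Fin.sum_univ_two, this]
    ring
  det_ne x hx := PatchData.metric_det_ne (hQ.lapse_pos x hx).ne' (hQ.sphere_symm x hx 1 0)
    (hQ.sphere_det x hx)

theorem metric_conformal {x : Coord} (hx : x ∈ intDom e) (i j : Fin 4) :
    Q.metric x i j = (x 0 - x 1) ^ 2 * P.metric x i j := by
  have hs := sub_ne_zero_of_mem hx
  simp only [PatchData.metric, Matrix.of_apply, PatchData.coframe, hQ.lapse_eq x hx,
    hQ.shift_eq x hx, hQ.sphere_eq x hx, Fin.sum_univ_two]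
  field_simp

theorem metric_inv {x : Coord} (hx : x ∈ closedDom e) : (Q.metric x)⁻¹ = Q.invMetric x :=
  PatchData.metric_inv (hQ.lapse_pos x hx).ne' (hQ.sphere_symm x hx 1 0) (hQ.sphere_det x hx)

theorem gradS_eq {x : Coord} (hx : x ∈ closedDom e) (i : Fin 4) :
    gradS Q.metric i x = (2 * Q.Ω x ^ 2)⁻¹ * ![1, -1, Q.b x 0, Q.b x 1] i := by
  rw [gradS, hQ.metric_inv hx]
  fin_cases i <;> simp [PatchData.invMetric, dS, Fin.sum_univ_four]

/-- The shift does not enter, so every expansion of |ds|² at the boundary is an expansion of the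
compactified lapse. -/
theorem normS_eq {x : Coord} (hx : x ∈ closedDom e) : normS Q.metric x = (Q.Ω x ^ 2)⁻¹ := by
  have h0 := (hQ.lapse_pos x hx).ne'
  simp only [normS, hQ.gradS_eq hx, Fin.sum_univ_four, dS]
  simp
  field_simp
  norm_num

theorem hessS_eq {x : Coord} (hx : x ∈ closedDom e) (i j : Fin 4) :
    hessS (closedDom e) Q.metric i j x = -(2 * Q.Ω x ^ 2)⁻¹ *
      (christoffelLow (closedDom e) Q.metric 0 i j x - christoffelLow (closedDom e) Q.metric 1 i j x
        + Q.b x 0 * christoffelLow (closedDom e) Q.metric 2 i j x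
        + Q.b x 1 * christoffelLow (closedDom e) Q.metric 3 i j x) := by
  have h1 : hessS (closedDom e) Q.metric i j x
      = -∑ m, gradS Q.metric m x * christoffelLow (closedDom e) Q.metric m i j x := by
    simp only [hessS, ← sum_christoffel (hQ.isRegularMetric.det_ne x hx),
      ← hQ.isRegularMetric.sum_metric_gradS hx, Finset.mul_sum, Finset.sum_mul]
    congr 1
    rw [Finset.sum_comm]
    refine Finset.sum_congr rfl fun p _ => Finset.sum_congr rfl fun n _ => ?_
    rw [hQ.isRegularMetric.symm x hx n p]
    ring
  rw [h1]
  simp only [hQ.gradS_eq hx, Fin.sum_univ_four]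
  simp
  ring

end IsCompactification

end AAdS

end

noncomputable section

namespace AAdS

/-! ## The Einstein equations at the conformal boundary -/

/-- Near the conformal boundary, the length of `d(u - v)` equals `k` to second order, and the
Hessian of `u - v` vanishes to first order. -/
structure HasExpansion (e : SChart) (k : ℝ) (Q : PatchData) (N : Coord → ℝ)
    (K : Fin 4 → Fin 4 → Coord → ℝ) : Prop where
  smooth_norm : Smooth e N
  smooth_hess : ∀ i j, Smooth e (K i j)
  norm_eq : ∀ x ∈ closedDom e, normS Q.metric x - k ^ 2 = (x 0 - x 1) * ((x 0 - x 1) * N x)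
  hess_eq : ∀ i j, ∀ x ∈ closedDom e, hessS (closedDom e) Q.metric i j x = (x 0 - x 1) * K i j x
  einstein : ∀ j m, ∀ x ∈ closedDom e, 3 * N x * Q.metric x j m
    = 2 * K j m x + Q.metric x j m * ∑ i, ∑ n, (Q.metric x)⁻¹ i n * K n i x
      + ricci (closedDom e) Q.metric j m x

section

variable {e : SChart} {k : ℝ} {P Q : PatchData} (hQ : IsCompactification e P Q)
  (hE : ∀ x ∈ intDom e, ∀ i j, ricci (intDom e) P.metric i j x = -3 * k ^ 2 * P.metric x i j)
include hQ hE

/-- The Einstein equations inserted into the conformal formula for the Ricci tensor and multiplied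
by s². Both sides are smooth up to the boundary, so the interior identity extends by density. -/
theorem einstein_conformal (j m : Fin 4) {x : Coord} (hx : x ∈ closedDom e) :
    3 * (normS Q.metric x - k ^ 2) * Q.metric x j m
      = (x 0 - x 1) * (2 * hessS (closedDom e) Q.metric j m x
          + Q.metric x j m * ∑ i, hessUp (closedDom e) Q.metric i i x)
        + (x 0 - x 1) ^ 2 * ricci (closedDom e) Q.metric j m x := by
  have hh := hQ.isRegularMetric
  have hs := smooth_defining e
  refine eq_of_eq_on_intDom (e := e)
    (f := fun x => 3 * (normS Q.metric x - k ^ 2) * Q.metric x j m)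
    (g := fun x => (x 0 - x 1) * (2 * hessS (closedDom e) Q.metric j m x
          + Q.metric x j m * ∑ i, hessUp (closedDom e) Q.metric i i x)
        + (x 0 - x 1) ^ 2 * ricci (closedDom e) Q.metric j m x)
    ((contDiffOn_const.mul (hh.smooth_normS.sub contDiffOn_const)).mul (hh.smooth j m))
    ((hs.mul ((contDiffOn_const.mul (hh.smooth_hessS j m)).add ((hh.smooth j m).mul
      (ContDiffOn.sum fun i _ => hh.smooth_hessUp i i)))).add
      ((hs.pow 2).mul (hh.smooth_ricci j m)))
    (fun y hy => ?_) x hx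
  have h1 := ricci_conformal hh (fun x hx => hQ.metric_conformal hx) hy j m
  have hsne := sub_ne_zero_of_mem hy
  rw [hE y hy, metric_eq (fun x hx => hQ.metric_conformal hx) hy] at h1
  field_simp at h1
  linear_combination h1

/-- At s = 0 the right-hand side vanishes. The 01 component suffices, since h₀₁ = −2Ω̂² is nonzero.
-/
theorem normS_boundary {x : Coord} (hx : x ∈ closedDom e) (h0 : x 0 = x 1) :
    normS Q.metric x - k ^ 2 = 0 := by
  have h1 := einstein_conformal hQ hE 0 1 hx
  rw [Q.metric_zero_one, h0] at h1
  have h2 := (hQ.lapse_pos x hx).ne'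
  have h3 : (normS Q.metric x - k ^ 2) * (Q.Ω x ^ 2) = 0 := by linear_combination -h1 / 6
  exact (mul_eq_zero.1 h3).resolve_right (pow_ne_zero 2 h2)

/-- A general defining function leaves a pure trace term in its Hessian at the boundary. That u − v
has none is due to the double null gauge: the null direction ∂_v sees Hess s but not h. -/
theorem exists_expansion : ∃ N K, HasExpansion e k Q N K := by
  have hh := hQ.isRegularMetric
  have hs := smooth_defining e
  obtain ⟨a, ha, hna⟩ := exists_smooth_quotient (hh.smooth_normS.sub contDiffOn_const)
    fun x hx h0 => normS_boundary hQ hE hx h0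
  -- The conformal Einstein equations divided once by s.
  have h1 : ∀ j m, ∀ x ∈ closedDom e, 3 * a x * Q.metric x j m
      - (2 * hessS (closedDom e) Q.metric j m x
          + Q.metric x j m * ∑ i, hessUp (closedDom e) Q.metric i i x)
        - (x 0 - x 1) * ricci (closedDom e) Q.metric j m x = 0 := by
    intro j m
    refine Smooth.eq_zero_of_mul ?_ fun x hx => ?_
    · exact ((((contDiffOn_const.mul ha).mul (hh.smooth j m)).sub
        ((contDiffOn_const.mul (hh.smooth_hessS j m)).add ((hh.smooth j m).mul
          (ContDiffOn.sum fun i _ => hh.smooth_hessUp i i)))).sub (hs.mul (hh.smooth_ricci j m)))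
    · have hx' := intDom_subset_closedDom e hx
      have h2 := einstein_conformal hQ hE j m hx'
      rw [hna x hx'] at h2
      linear_combination h2
  -- the derivative of the lapse along the null generator vanishes on the boundary
  have ha0 : ∀ x ∈ closedDom e, x 0 = x 1 → a x = 0 := by
    intro x hx h0
    have hΩ := (hQ.lapse_pos x hx).ne'
    have hd := hQ.smooth_lapse.diff hx
    have e1 : ∀ y ∈ closedDom e, Q.metric y 1 1 = 0 := fun y _ => Q.metric_one_one y
    -- In the 11 component every term with h drops out.
    have e2 : hessS (closedDom e) Q.metric 1 1 x = 0 := by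
      have := h1 1 1 x hx
      rw [e1 x hx, h0] at this
      linear_combination -this / 2
    have e3 : ∀ n : Fin 4, n = 1 ∨ n = 2 ∨ n = 3 →
        christoffelLow (closedDom e) Q.metric n 1 1 x = 0 := by
      intro n hn
      have hz : ∀ y ∈ closedDom e, Q.metric y n 1 = 0 := by
        rcases hn with rfl | rfl | rfl
        · exact e1
        · exact fun y _ => Q.metric_ang_one y 0
        · exact fun y _ => Q.metric_ang_one y 1
      rw [christoffelLow, pd_congr hz hx, pd_congr e1 hx, pd_const, pd_const]
      ring
    -- Of the Christoffel symbols with lower pair 11 only Γ_{0,11} = −2∂_v Ω̂² survives, so the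
    -- vanishing Hessian component is a derivative of the lapse.
    have e4 : pd (closedDom e) 1 (fun y => Q.Ω y ^ 2) x = 0 := by
      rw [hQ.hessS_eq hx, e3 1 (by simp), e3 2 (by simp), e3 3 (by simp), christoffelLow,
        pd_congr e1 hx, pd_const, pd_congr (fun y _ => Q.metric_zero_one y) hx,
        pd_mul 1 hx (differentiableWithinAt_const _) (hd.fun_pow 2), pd_const] at e2
      have h2 : (2 * Q.Ω x ^ 2)⁻¹ ≠ 0 := by positivity
      have h3 : (2 * Q.Ω x ^ 2)⁻¹ * pd (closedDom e) 1 (fun y => Q.Ω y ^ 2) x = 0 := by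
        linear_combination e2 / 2
      exact (mul_eq_zero.1 h3).resolve_left h2
    -- Apply ∂_v to sa = Ω̂⁻² − k² at s = 0: the left side is −a, the right side is 0.
    have e5 := pd_congr (fun y hy => (hna y hy).symm.trans
      (congrArg (· - k ^ 2) (hQ.normS_eq hy))) hx 1
    rw [pd_mul 1 hx (hs.diff hx) (ha.diff hx), pd_defining hx, h0,
      pd_sub 1 hx ((hd.fun_pow 2).fun_inv (pow_ne_zero 2 hΩ)) (differentiableWithinAt_const _),
      pd_inv 1 hx (hd.fun_pow 2) (pow_ne_zero 2 hΩ), e4, pd_const] at e5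
    simp [dS] at e5
    exact e5
  obtain ⟨N, hN, haN⟩ := exists_smooth_quotient ha ha0
  -- At the boundary 2 Hess s = −(Δs)h; the trace reads 2Δs = −4Δs.
  have htr : ∀ x ∈ closedDom e, x 0 = x 1 → ∑ i, hessUp (closedDom e) Q.metric i i x = 0 := by
    intro x hx h0
    set T := ∑ i, hessUp (closedDom e) Q.metric i i x with hT
    have h2 : ∀ j m, 2 * hessS (closedDom e) Q.metric j m x = -T * Q.metric x j m := by
      intro j m
      have := h1 j m x hx
      rw [ha0 x hx h0, h0] at this
      linear_combination -this
    have h3 : ∀ i, 2 * hessUp (closedDom e) Q.metric i i x = -T := by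
      intro i
      have h4 := sum_inv_mul (hh.det_ne x hx) i i
      rw [if_pos rfl] at h4
      rw [hessUp, Finset.mul_sum]
      calc _ = ∑ n, -T * ((Q.metric x)⁻¹ i n * Q.metric x n i) :=
            Finset.sum_congr rfl fun n _ => by linear_combination (Q.metric x)⁻¹ i n * h2 n i
        _ = -T := by rw [← Finset.mul_sum, h4, mul_one]
    have h5 : 2 * T = ∑ _i : Fin 4, -T := by
      rw [hT, Finset.mul_sum]
      exact Finset.sum_congr rfl fun i _ => h3 i
    simp at h5
    linarith
  have hH : ∀ i j, ∃ q, Smooth e q ∧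
      ∀ x ∈ closedDom e, hessS (closedDom e) Q.metric i j x = (x 0 - x 1) * q x := by
    intro i j
    refine exists_smooth_quotient (hh.smooth_hessS i j) fun x hx h0 => ?_
    have := h1 i j x hx
    rw [ha0 x hx h0, h0, htr x hx h0] at this
    linear_combination -this / 2
  choose K hK hHK using hH
  refine ⟨N, K, hN, hK, fun x hx => by rw [hna x hx, haN x hx], hHK, fun j m x hx => ?_⟩
  -- A second division by s; the quotients N and K now satisfy the Einstein equations without a
  -- factor s.
  have h2 : ∀ y ∈ closedDom e, 3 * N y * Q.metric y j m
    - (2 * K j m y + Q.metric y j m * ∑ i, ∑ n, (Q.metric y)⁻¹ i n * K n i y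
      + ricci (closedDom e) Q.metric j m y) = 0 := by
    refine Smooth.eq_zero_of_mul ?_ fun y hy => ?_
    · exact ((contDiffOn_const.mul hN).mul (hh.smooth j m)).sub
        (((contDiffOn_const.mul (hK j m)).add ((hh.smooth j m).mul
          (ContDiffOn.sum fun i _ => ContDiffOn.sum fun n _ => (hh.smooth_inv i n).mul (hK n i)))).add
          (hh.smooth_ricci j m))
    · have hy' := intDom_subset_closedDom e hy
      have h3 := h1 j m y hy'
      have h4 : ∑ i, hessUp (closedDom e) Q.metric i i y
          = (y 0 - y 1) * ∑ i, ∑ n, (Q.metric y)⁻¹ i n * K n i y := by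
        simp only [hessUp, hHK _ _ y hy', Finset.mul_sum]
        exact Finset.sum_congr rfl fun _ _ => Finset.sum_congr rfl fun _ _ => by ring
      rw [h4, haN y hy', hHK j m y hy'] at h3
      linear_combination h3
  exact sub_eq_zero.1 (h2 x hx)

end

namespace HasExpansion

variable {e : SChart} {k : ℝ} {P Q : PatchData} {N : Coord → ℝ} {K : Fin 4 → Fin 4 → Coord → ℝ}
  (hK : HasExpansion e k Q N K) (hQ : IsCompactification e P Q)
include hK hQ

theorem hess_symm (i j : Fin 4) {x : Coord} (hx : x ∈ closedDom e) : K i j x = K j i x := by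
  refine sub_eq_zero.1 (Smooth.eq_zero_of_mul ((hK.smooth_hess i j).sub (hK.smooth_hess j i))
    (fun y hy => ?_) x hx)
  have hy' := intDom_subset_closedDom e hy
  have := hQ.isRegularMetric.hessS_symm hy' i j
  rw [hK.hess_eq i j y hy', hK.hess_eq j i y hy'] at this
  linear_combination this

/-- Differentiate |ds|² = k² + s²N, which gives 2 Hess s(∇s, ·), and divide by 2s. -/
theorem sum_gradS_hess (m : Fin 4) {x : Coord} (hx : x ∈ closedDom e) :
    ∑ i, gradS Q.metric i x * K i m x
      = N x * dS m + (x 0 - x 1) * pd (closedDom e) m N x / 2 := by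
  have hh := hQ.isRegularMetric
  have hs := smooth_defining e
  have h1 : ∀ y ∈ closedDom e, ∑ i, gradS Q.metric i y * K i m y
      - (N y * dS m + (y 0 - y 1) * pd (closedDom e) m N y * 2⁻¹) = 0 := by
    refine Smooth.eq_zero_of_mul ?_ fun y hy => ?_
    · exact (ContDiffOn.sum fun i _ => (hh.smooth_gradS i).mul (hK.smooth_hess i m)).sub
        ((hK.smooth_norm.mul contDiffOn_const).add
          ((hs.mul (hK.smooth_norm.pd m)).mul contDiffOn_const))
    · have hy' := intDom_subset_closedDom e hy
      have h2 := pd_congr hK.norm_eq hy' m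
      rw [pd_sub m hy' (hh.smooth_normS.diff hy') (differentiableWithinAt_const _), pd_const,
        hh.pd_normS hy', pd_mul m hy' (hs.diff hy')
          ((hs.diff hy').fun_mul (hK.smooth_norm.diff hy')),
        pd_mul m hy' (hs.diff hy') (hK.smooth_norm.diff hy'), pd_defining hy'] at h2
      have h3 : ∑ i, gradS Q.metric i y * hessS (closedDom e) Q.metric i m y
          = (y 0 - y 1) * ∑ i, gradS Q.metric i y * K i m y := by
        simp only [hK.hess_eq _ _ y hy', Finset.mul_sum]
        exact Finset.sum_congr rfl fun _ _ => by ring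
      rw [h3] at h2
      linear_combination h2 / 2
  linear_combination h1 x hx

end HasExpansion

end AAdS

end

noncomputable section

namespace AAdS

/-! ## The Weyl tensor at the conformal boundary -/

/-- The Weyl tensor of `(u - v)⁻² h`, up to the factor `(u - v)⁻²`, in terms of quantities which are
smooth up to the conformal boundary. -/
def confWeyl (e : SChart) (h : MetricField) (N : Coord → ℝ) (K : Fin 4 → Fin 4 → Coord → ℝ)
    (i j l m : Fin 4) (x : Coord) : ℝ :=
  riemann (closedDom e) h i j l m x
    + (h x i l * K j m x - h x i m * K j l x + h x j m * K i l x - h x j l * K i m x)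
    - N x * (h x i l * h x j m - h x i m * h x j l)

/-- The scalar curvature is −12k², so all Ricci terms of the Weyl tensor combine into the curvature
tensor of anti-de Sitter space. -/
theorem weyl_eq_of_einstein {D : Set Coord} {g : MetricField} {k : ℝ} {x : Coord}
    (hg : (g x).det ≠ 0) (hsymm : ∀ i j, g x i j = g x j i)
    (hE : ∀ i j, ricci D g i j x = -3 * k ^ 2 * g x i j) (i j l m : Fin 4) :
    weyl D g i j l m x
      = riemann D g i j l m x + k ^ 2 * (g x i l * g x j m - g x i m * g x j l) := by
  have h1 : scalarCurv D g x = -12 * k ^ 2 := by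
    have h2 : ∀ i, ∑ j, (g x)⁻¹ i j * g x i j = 1 := fun i => by
      have := sum_inv_mul hg i i
      rw [if_pos rfl] at this
      rw [← this]
      exact Finset.sum_congr rfl fun j _ => by rw [hsymm i j]
    have h3 : ∀ i, ∑ j, (g x)⁻¹ i j * ricci D g i j x = -3 * k ^ 2 := fun i => by
      simp only [hE]
      calc _ = ∑ j, -3 * k ^ 2 * ((g x)⁻¹ i j * g x i j) :=
            Finset.sum_congr rfl fun _ _ => by ring
        _ = _ := by rw [← Finset.mul_sum, h2, mul_one]
    simp only [scalarCurv, h3]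
    simp
    ring
  simp only [weyl, h1, hE]
  ring

namespace HasExpansion

variable {e : SChart} {k : ℝ} {P Q : PatchData} {N : Coord → ℝ} {K : Fin 4 → Fin 4 → Coord → ℝ}
  (hK : HasExpansion e k Q N K) (hQ : IsCompactification e P Q)
include hK hQ

theorem smooth_confWeyl (i j l m : Fin 4) : Smooth e (confWeyl e Q.metric N K i j l m) := by
  have hh := hQ.isRegularMetric
  have s := hh.smooth
  have t := hK.smooth_hess
  exact ((hh.smooth_riemann i j l m).add (((((s i l).mul (t j m)).sub ((s i m).mul (t j l))).add
    ((s j m).mul (t i l))).sub ((s j l).mul (t i m)))).sub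
    (hK.smooth_norm.mul (((s i l).mul (s j m)).sub ((s i m).mul (s j l))))

/-- In the conformal formula for the curvature the singular term s⁻²|ds|² equals s⁻²k² + N. Its k²
part cancels the constant curvature term of the Weyl tensor, and s⁻¹ Hess s is K. -/
theorem weyl_eq (hE : ∀ x ∈ intDom e, ∀ i j,
      ricci (intDom e) P.metric i j x = -3 * k ^ 2 * P.metric x i j)
    {x : Coord} (hx : x ∈ intDom e) (i j l m : Fin 4) :
    weyl (intDom e) P.metric i j l m x
      = (x 0 - x 1)⁻¹ ^ 2 * confWeyl e Q.metric N K i j l m x := by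
  have hx' := intDom_subset_closedDom e hx
  have hh := hQ.isRegularMetric
  have hg : ∀ x ∈ intDom e, ∀ i j, Q.metric x i j = (x 0 - x 1) ^ 2 * P.metric x i j :=
    fun x hx => hQ.metric_conformal hx
  have hs := sub_ne_zero_of_mem hx
  have hdet : (P.metric x).det ≠ 0 := by
    have h1 : Q.metric x = (x 0 - x 1) ^ 2 • P.metric x := Matrix.ext (hg x hx)
    have h2 := hh.det_ne x hx'
    rw [h1, Matrix.det_smul] at h2
    exact right_ne_zero_of_mul h2
  have hsymm : ∀ i j, P.metric x i j = P.metric x j i := fun i j => by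
    rw [metric_eq hg hx, metric_eq hg hx, hh.symm x hx' i j]
  rw [weyl_eq_of_einstein hdet hsymm (hE x hx)]
  set σ := (x 0 - x 1)⁻¹ with hσ
  have h1 : riemann (intDom e) P.metric i j l m x
      = σ ^ 2 * (riemann (closedDom e) Q.metric i j l m x
        + σ * (Q.metric x i l * hessS (closedDom e) Q.metric j m x
            - Q.metric x i m * hessS (closedDom e) Q.metric j l x
            + Q.metric x j m * hessS (closedDom e) Q.metric i l x
            - Q.metric x j l * hessS (closedDom e) Q.metric i m x)
        - σ ^ 2 * normS Q.metric x *
          (Q.metric x i l * Q.metric x j m - Q.metric x i m * Q.metric x j l)) := by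
    have h2 : ∀ m, ∑ n, Q.metric x i n * hessUp (closedDom e) Q.metric n m x
        = hessS (closedDom e) Q.metric i m x := fun m => sum_mul_inv_mul (hh.det_ne x hx') i _
    rw [← h2 l, ← h2 m]
    simp only [riemann, riemannUp_conformal hh hg hx, metric_eq hg hx]
    have h3 : ∀ l, ∀ c : ℝ, ∑ n, Q.metric x i n * (if n = l then c else 0) = Q.metric x i l * c :=
      fun l c => by simp
    rw [← h3 l (hessS (closedDom e) Q.metric j m x), ← h3 m (hessS (closedDom e) Q.metric j l x),
      ← h3 l (Q.metric x j m), ← h3 m (Q.metric x j l)]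
    simp only [Finset.mul_sum, ← Finset.sum_add_distrib, ← Finset.sum_sub_distrib]
    exact Finset.sum_congr rfl fun _ _ => by ring
  have h4 := hK.norm_eq x hx'
  have hσ1 : σ * (x 0 - x 1) = 1 := inv_mul_cancel₀ hs
  have h5 : σ ^ 2 * normS Q.metric x = σ ^ 2 * k ^ 2 + N x := by
    linear_combination σ ^ 2 * h4 + (σ * (x 0 - x 1) + 1) * N x * hσ1
  have h6 : ∀ i j, σ * hessS (closedDom e) Q.metric i j x = K i j x := fun i j => by
    rw [hK.hess_eq i j x hx']
    linear_combination K i j x * hσ1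
  simp only [h1, metric_eq hg hx, confWeyl, ← hσ, ← h6]
  linear_combination -σ ^ 2 *
    (Q.metric x i l * Q.metric x j m - Q.metric x i m * Q.metric x j l) * h5

theorem isCurvatureTensor_confWeyl {x : Coord} (hx : x ∈ closedDom e) :
    IsCurvatureTensor fun i j l m => confWeyl e Q.metric N K i j l m x := by
  have hh := hQ.isRegularMetric
  have hR := hh.isCurvatureTensor_riemann hx
  refine ⟨fun i j l m => ?_, fun i j l m => ?_, fun i j l m => ?_⟩
  · simp only [confWeyl]
    linear_combination hR.antisymm_left i j l m
  · simp only [confWeyl]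
    linear_combination hR.antisymm_right i j l m
  · simp only [confWeyl]
    rw [hh.symm x hx m l, hh.symm x hx m j, hh.symm x hx j l, hK.hess_symm hQ m l hx,
      hK.hess_symm hQ m j hx, hK.hess_symm hQ j l hx]
    linear_combination hR.bianchi i j l m

/-- The trace of `confWeyl` is the twice divided Einstein equation. -/
theorem trace_confWeyl {x : Coord} (hx : x ∈ closedDom e) (j m : Fin 4) :
    ∑ i, ∑ n, (Q.metric x)⁻¹ i n * confWeyl e Q.metric N K n j i m x = 0 := by
  have hh := hQ.isRegularMetric
  have hdet := hh.det_ne x hx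
  have h1 : ∑ i, ∑ n, (Q.metric x)⁻¹ i n * riemann (closedDom e) Q.metric n j i m x
      = ricci (closedDom e) Q.metric j m x :=
    Finset.sum_congr rfl fun i _ => sum_inv_mul_mul hdet i _
  have h2 : ∀ i l, ∑ n, (Q.metric x)⁻¹ i n * Q.metric x n l = if i = l then 1 else 0 :=
    fun i l => sum_inv_mul hdet i l
  have h3 : ∑ i, Q.metric x j i * ∑ n, (Q.metric x)⁻¹ i n * K n m x = K j m x :=
    sum_mul_inv_mul hdet j fun n => K n m x
  have h4 : ∀ i, ∑ n, (Q.metric x)⁻¹ i n * confWeyl e Q.metric N K n j i m x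
      = ∑ n, (Q.metric x)⁻¹ i n * riemann (closedDom e) Q.metric n j i m x
        + ((if i = i then 1 else 0) * K j m x - (if i = m then 1 else 0) * K j i x
          + Q.metric x j m * ∑ n, (Q.metric x)⁻¹ i n * K n i x
          - Q.metric x j i * ∑ n, (Q.metric x)⁻¹ i n * K n m x)
        - N x * ((if i = i then 1 else 0) * Q.metric x j m
          - (if i = m then 1 else 0) * Q.metric x j i) := by
    intro i
    rw [← h2 i i, ← h2 i m]
    simp only [confWeyl, Finset.mul_sum, Finset.sum_mul, ← Finset.sum_add_distrib,
      ← Finset.sum_sub_distrib]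
    exact Finset.sum_congr rfl fun _ _ => by ring
  simp only [h4, Finset.sum_add_distrib, Finset.sum_sub_distrib, h1, h3, ← Finset.mul_sum, if_true,
    ite_mul, one_mul, zero_mul, Finset.sum_ite_eq', Finset.mem_univ, Finset.sum_const,
    Finset.card_univ, Fintype.card_fin, nsmul_eq_mul]
  push_cast
  linear_combination -hK.einstein j m x hx

/-- Since Hess s = sK, at s = 0 the Ricci identity reads R(∇s, ∂_j, ∂_l, ∂_m) = dS_m K_lj − dS_l
K_mj. This cancels the K terms of `confWeyl`, while K(∇s, ·) = N ds cancels the N terms. -/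
theorem sum_gradS_confWeyl {x : Coord} (hx : x ∈ closedDom e) (h0 : x 0 = x 1) (j l m : Fin 4) :
    ∑ i, gradS Q.metric i x * confWeyl e Q.metric N K i j l m x = 0 := by
  have hh := hQ.isRegularMetric
  have hH : ∀ i j, hessS (closedDom e) Q.metric i j x = 0 := fun i j => by
    rw [hK.hess_eq i j x hx, h0]
    ring
  have hpd : ∀ l i j, pd (closedDom e) l (hessS (closedDom e) Q.metric i j) x
      = dS l * K i j x := fun l i j => by
    rw [pd_congr (hK.hess_eq i j) hx, pd_mul l hx ((smooth_defining e).diff hx)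
      ((hK.smooth_hess i j).diff hx), pd_defining hx, h0]
    ring
  have h1 := hh.sum_gradS_riemann hx j l m
  simp only [hH, hpd, zero_mul, sub_zero, Finset.sum_const_zero] at h1
  have h2 : ∀ l, ∑ i, gradS Q.metric i x * Q.metric x i l = dS l := fun l => by
    rw [← hh.sum_metric_gradS hx l]
    exact Finset.sum_congr rfl fun i _ => by rw [hh.symm x hx l i, mul_comm]
  have h3 : ∀ m, ∑ i, gradS Q.metric i x * K i m x = N x * dS m := fun m => by
    rw [hK.sum_gradS_hess hQ m hx, h0]
    ring
  have h4 : ∑ i, gradS Q.metric i x * confWeyl e Q.metric N K i j l m x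
      = ∑ i, gradS Q.metric i x * riemann (closedDom e) Q.metric i j l m x
        + ((∑ i, gradS Q.metric i x * Q.metric x i l) * K j m x
          - (∑ i, gradS Q.metric i x * Q.metric x i m) * K j l x
          + Q.metric x j m * ∑ i, gradS Q.metric i x * K i l x
          - Q.metric x j l * ∑ i, gradS Q.metric i x * K i m x)
        - N x * ((∑ i, gradS Q.metric i x * Q.metric x i l) * Q.metric x j m
          - (∑ i, gradS Q.metric i x * Q.metric x i m) * Q.metric x j l) := by
    simp only [confWeyl, Finset.mul_sum, Finset.sum_mul, ← Finset.sum_add_distrib,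
      ← Finset.sum_sub_distrib]
    exact Finset.sum_congr rfl fun _ _ => by ring
  rw [h4, h1, h2, h2, h3, h3, hK.hess_symm hQ l j hx, hK.hess_symm hQ m j hx]
  ring

/-- A trace-free curvature tensor annihilated by ∇s, which is nonnull because |ds|² = Ω̂⁻². -/
theorem confWeyl_boundary {x : Coord} (hx : x ∈ closedDom e) (h0 : x 0 = x 1) (i j l m : Fin 4) :
    confWeyl e Q.metric N K i j l m x = 0 := by
  have hΩ := (hQ.lapse_pos x hx).ne'
  have hC := hK.isCurvatureTensor_confWeyl hQ hx
  set C := fun i j l m => confWeyl e Q.metric N K i j l m x with hCdef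
  have hgdet := hQ.sphere_det x hx
  have hinvdet : (Q.gs x)⁻¹.det ≠ 0 := by
    rw [Matrix.det_nonsing_inv]
    simpa using hgdet
  have hinvsymm : (Q.gs x)⁻¹ 1 0 = (Q.gs x)⁻¹ 0 1 := by
    have h1 : (Q.gs x).transpose = Q.gs x := Matrix.ext fun a c => hQ.sphere_symm x hx c a
    have h2 : ((Q.gs x)⁻¹).transpose = (Q.gs x)⁻¹ := by rw [Matrix.transpose_nonsing_inv, h1]
    exact congrFun (congrFun h2 0) 1
  refine hC.eq_zero (c := (2 * Q.Ω x ^ 2)⁻¹) (b₁ := Q.b x 0) (b₂ := Q.b x 1)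
    (q₁₁ := (Q.gs x)⁻¹ 0 0) (q₁₂ := (Q.gs x)⁻¹ 0 1) (q₂₂ := (Q.gs x)⁻¹ 1 1)
    (by positivity) ?_ (fun j l m => ?_) (fun j m => ?_) i j l m
  · rw [Matrix.det_fin_two, hinvsymm] at hinvdet
    rwa [pow_two]
  · have h1 := hK.sum_gradS_confWeyl hQ hx h0 j l m
    simp only [hQ.gradS_eq hx, Fin.sum_univ_four] at h1
    simp only [Matrix.cons_val_zero, Matrix.cons_val_one, Matrix.cons_val] at h1
    have h2 : (2 * Q.Ω x ^ 2)⁻¹ ≠ 0 := by positivity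
    have h3 : (2 * Q.Ω x ^ 2)⁻¹ * (C 0 j l m - C 1 j l m + Q.b x 0 * C 2 j l m
        + Q.b x 1 * C 3 j l m) = 0 := by
      simp only [hCdef]
      linear_combination h1
    linear_combination (mul_eq_zero.1 h3).resolve_left h2
  · have h1 := hK.trace_confWeyl hQ hx j m
    rw [hQ.metric_inv hx] at h1
    simp only [PatchData.invMetric, Fin.sum_univ_four, hinvsymm] at h1
    simp only [Matrix.cons_val_zero, Matrix.cons_val_one, Matrix.cons_val, Matrix.of_apply] at h1
    simp only [hCdef]
    linear_combination h1

/-- The Weyl tensor vanishes to first order, relative to the compactified metric. -/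
theorem exists_weyl_eq (hE : ∀ x ∈ intDom e, ∀ i j,
      ricci (intDom e) P.metric i j x = -3 * k ^ 2 * P.metric x i j) :
    ∃ V : Fin 4 → Fin 4 → Fin 4 → Fin 4 → Coord → ℝ, (∀ i j l m, Smooth e (V i j l m)) ∧
      ∀ i j l m, ∀ x ∈ intDom e,
        weyl (intDom e) P.metric i j l m x = (x 0 - x 1)⁻¹ * V i j l m x := by
  have h1 := fun i j l m => exists_smooth_quotient (hK.smooth_confWeyl hQ i j l m)
    fun x hx h0 => hK.confWeyl_boundary hQ hx h0 i j l m
  choose V hV hVeq using h1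
  refine ⟨V, hV, fun i j l m x hx => ?_⟩
  have hs := sub_ne_zero_of_mem hx
  rw [hK.weyl_eq hQ hE hx, hVeq i j l m x (intDom_subset_closedDom e hx)]
  field_simp

end HasExpansion

end AAdS

end

noncomputable section

namespace AAdS

/-! ## The Ricci coefficients -/

theorem dS_ang (A : Fin 2) : dS (ang A) = 0 := by
  fin_cases A <;> rfl

theorem dS_zero : dS 0 = 1 := rfl

theorem dS_one : dS 1 = -1 := rfl

theorem dS_two : dS 2 = 0 := rfl

theorem dS_three : dS 3 = 0 := rfl

theorem ang_zero : ang 0 = 2 := rfl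

theorem ang_one : ang 1 = 3 := rfl

/-- Lowering the free index replaces Γ by Christoffel symbols of the first kind. The Ricci
coefficients can then be computed without the inverse metric. -/
theorem ip_covD {D : Set Coord} {g : MetricField} {x : Coord} (hg : (g x).det ≠ 0)
    (hsymm : ∀ i j, g x i j = g x j i) (X Y Z : VField) :
    ip g (covD D g X Y) Z x = ∑ m, Z x m * ∑ j, X x j *
      (∑ i, g x m i * pd D j (fun y => Y y i) x + ∑ l, christoffelLow D g m j l x * Y x l) := by
  have h1 : ∀ m, ∑ i, g x m i * covD D g X Y x i = ∑ j, X x j *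
      (∑ i, g x m i * pd D j (fun y => Y y i) x + ∑ l, christoffelLow D g m j l x * Y x l) := by
    intro m
    simp only [covD, ← sum_christoffel hg, Finset.mul_sum, Finset.sum_mul, mul_add,
      Finset.sum_add_distrib]
    congr 1
    · rw [Finset.sum_comm]
      exact Finset.sum_congr rfl fun _ _ => Finset.sum_congr rfl fun _ _ => by ring
    · rw [Finset.sum_comm]
      refine Finset.sum_congr rfl fun _ _ => ?_
      rw [Finset.sum_comm]
      exact Finset.sum_congr rfl fun _ _ => Finset.sum_congr rfl fun _ _ => by ring
  simp only [← h1, ip, Finset.mul_sum]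
  rw [Finset.sum_comm]
  refine Finset.sum_congr rfl fun m _ => Finset.sum_congr rfl fun i _ => ?_
  rw [hsymm i m]
  ring

theorem christoffelLow_conformal {e : SChart} {h g : MetricField} (hh : IsRegularMetric e h)
    (hg : ∀ x ∈ intDom e, ∀ i j, h x i j = (x 0 - x 1) ^ 2 * g x i j) {x : Coord}
    (hx : x ∈ intDom e) (m j l : Fin 4) :
    christoffelLow (intDom e) g m j l x
      = (x 0 - x 1)⁻¹ ^ 2 * christoffelLow (closedDom e) h m j l x
        - (x 0 - x 1)⁻¹ ^ 3 * (dS j * h x m l + dS l * h x m j - dS m * h x j l) := by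
  simp only [christoffelLow, pd_conformal hh hg hx]
  ring

open PatchData

namespace IsCompactification

variable {e : SChart} {P Q : PatchData} (hQ : IsCompactification e P Q)

/-- The second fundamental form `½ ∂_v \slashed g` of the compactified metric. -/
def outForm (e : SChart) (Q : PatchData) (A B : Fin 2) : Coord → ℝ :=
  christoffelLow (closedDom e) Q.metric (ang B) (ang A) 1

/-- The second fundamental form `g(∇_A (∂_u + b), ∂_B)` of the compactified metric. -/
def inForm (e : SChart) (Q : PatchData) (A B : Fin 2) (x : Coord) : ℝ :=
  ∑ C, Q.gs x B C * pd (closedDom e) (ang A) (fun y => Q.b y C) x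
    + christoffelLow (closedDom e) Q.metric (ang B) (ang A) 0 x
    + ∑ C, Q.b x C * christoffelLow (closedDom e) Q.metric (ang B) (ang A) (ang C) x

include hQ

theorem smooth_outForm (A B : Fin 2) : Smooth e (outForm e Q A B) :=
  hQ.isRegularMetric.smooth_christoffelLow _ _ _

theorem smooth_inForm (A B : Fin 2) : Smooth e (inForm e Q A B) :=
  ((ContDiffOn.sum fun C _ => (hQ.smooth_sphere B C).mul ((hQ.smooth_shift C).pd _)).add
    (hQ.isRegularMetric.smooth_christoffelLow _ _ _)).add
    (ContDiffOn.sum fun C _ => (hQ.smooth_shift C).mul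
      (hQ.isRegularMetric.smooth_christoffelLow _ _ _))

theorem conformal : ∀ x ∈ intDom e, ∀ i j, Q.metric x i j = (x 0 - x 1) ^ 2 * P.metric x i j :=
  fun _ hx => hQ.metric_conformal hx

theorem lapse_ne {x : Coord} (hx : x ∈ intDom e) : P.Ω x ≠ 0 := by
  rw [hQ.lapse_eq x hx]
  exact mul_ne_zero (inv_ne_zero (sub_ne_zero_of_mem hx))
    (hQ.lapse_pos x (intDom_subset_closedDom e hx)).ne'

theorem phys_det_ne {x : Coord} (hx : x ∈ intDom e) : (P.metric x).det ≠ 0 := by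
  have h1 : Q.metric x = (x 0 - x 1) ^ 2 • P.metric x := Matrix.ext (hQ.conformal x hx)
  have h2 := hQ.isRegularMetric.det_ne x (intDom_subset_closedDom e hx)
  rw [h1, Matrix.det_smul] at h2
  exact right_ne_zero_of_mul h2

theorem phys_symm {x : Coord} (hx : x ∈ intDom e) (i j : Fin 4) :
    P.metric x i j = P.metric x j i := by
  rw [metric_eq hQ.conformal hx, metric_eq hQ.conformal hx,
    hQ.isRegularMetric.symm x (intDom_subset_closedDom e hx) i j]

omit hQ in
theorem eventuallyEq_of_eqOn {f g : Coord → ℝ} (h : ∀ x ∈ intDom e, f x = g x) {x : Coord}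
    (hx : x ∈ intDom e) : f =ᶠ[nhdsWithin x (closedDom e)] g := by
  filter_upwards [self_mem_nhdsWithin, mem_nhdsWithin_of_mem_nhds (isOpen_bulk.mem_nhds hx.2.1)]
    with y hy hy'
  exact h y ⟨hy.1, hy', hy.2.2⟩

theorem diff_lapse {x : Coord} (hx : x ∈ intDom e) :
    DifferentiableWithinAt ℝ P.Ω (closedDom e) x :=
  ((diff_invDefining hx).fun_mul
    (hQ.smooth_lapse.diff (intDom_subset_closedDom e hx))).congr_of_eventuallyEq
    (eventuallyEq_of_eqOn hQ.lapse_eq hx) (hQ.lapse_eq x hx)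

theorem diff_shift {x : Coord} (hx : x ∈ intDom e) (A : Fin 2) :
    DifferentiableWithinAt ℝ (fun y => P.b y A) (closedDom e) x :=
  ((hQ.smooth_shift A).diff (intDom_subset_closedDom e hx)).congr_of_eventuallyEq
    (eventuallyEq_of_eqOn (fun y hy => hQ.shift_eq y hy A) hx) (hQ.shift_eq x hx A)

theorem pd_shift {x : Coord} (hx : x ∈ intDom e) (i : Fin 4) (A : Fin 2) :
    pd (closedDom e) i (fun y => P.b y A) x = pd (closedDom e) i (fun y => Q.b y A) x :=
  pd_congr_intDom (fun y hy => hQ.shift_eq y hy A) hx i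

/-- The logarithmic derivative of Ω = s⁻¹Ω̂. -/
theorem pd_lapse {x : Coord} (hx : x ∈ intDom e) (i : Fin 4) :
    pd (closedDom e) i P.Ω x / P.Ω x
      = pd (closedDom e) i Q.Ω x / Q.Ω x - dS i * (x 0 - x 1)⁻¹ := by
  have hx' := intDom_subset_closedDom e hx
  have h1 := (hQ.lapse_pos x hx').ne'
  have h2 := sub_ne_zero_of_mem hx
  rw [pd_congr_intDom hQ.lapse_eq hx, pd_mul i hx' (diff_invDefining hx) (hQ.smooth_lapse.diff hx'),
    pd_invDefining hx, hQ.lapse_eq x hx]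
  field_simp
  ring

theorem pd_e4 {x : Coord} (hx : x ∈ intDom e) (i j : Fin 4) :
    pd (intDom e) j (fun y => P.e4 y i) x
      = (-pd (closedDom e) j P.Ω x / P.Ω x ^ 2) * (if i = 1 then 1 else 0) := by
  have hx' := intDom_subset_closedDom e hx
  have hd := (hQ.diff_lapse hx).fun_inv (hQ.lapse_ne hx)
  rw [pd_intDom _ hx]
  unfold PatchData.e4
  rw [pd_mul j hx' hd (differentiableWithinAt_const _), pd_const,
    pd_inv j hx' (hQ.diff_lapse hx) (hQ.lapse_ne hx)]
  ring

theorem pd_e3 {x : Coord} (hx : x ∈ intDom e) (i j : Fin 4) :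
    pd (intDom e) j (fun y => P.e3 y i) x
      = (-pd (closedDom e) j P.Ω x / P.Ω x ^ 2)
          * ((if i = 0 then 1 else 0) + ∑ A, P.b x A * (if i = ang A then 1 else 0))
        + (P.Ω x)⁻¹ * ∑ A, pd (closedDom e) j (fun y => Q.b y A) x
          * (if i = ang A then 1 else 0) := by
  have hx' := intDom_subset_closedDom e hx
  have hd := (hQ.diff_lapse hx).fun_inv (hQ.lapse_ne hx)
  have hb : ∀ A, DifferentiableWithinAt ℝ
      (fun y => P.b y A * (if i = ang A then (1 : ℝ) else 0)) (closedDom e) x := fun A =>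
    (hQ.diff_shift hx A).fun_mul (differentiableWithinAt_const _)
  have hbs : DifferentiableWithinAt ℝ
      (fun y => ∑ A, P.b y A * (if i = ang A then (1 : ℝ) else 0)) (closedDom e) x :=
    DifferentiableWithinAt.fun_sum fun A _ => hb A
  rw [pd_intDom _ hx]
  unfold PatchData.e3
  rw [pd_mul j hx' hd ((differentiableWithinAt_const _).fun_add hbs),
    pd_add j hx' (differentiableWithinAt_const _) hbs, pd_const,
    pd_inv j hx' (hQ.diff_lapse hx) (hQ.lapse_ne hx), pd_sum j _ hx' fun A _ => hb A]
  simp only [pd_mul j hx' (hQ.diff_shift hx _) (differentiableWithinAt_const _), pd_const,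
    mul_zero, add_zero, zero_add, hQ.pd_shift hx]

omit hQ in
theorem pd_eS (D : Set Coord) (A : Fin 2) (i j : Fin 4) (x : Coord) :
    pd D j (fun y => eS A y i) x = 0 := by
  simp [pd, eS]

/-- ω is ∂_v log Ω: against ∂_v the metric has only the component g₁₀ = −2Ω², and the relevant
Christoffel symbols reduce to derivatives of g₁₁ = 0. -/
theorem omega_eq {x : Coord} (hx : x ∈ intDom e) :
    P.omega x = pd (closedDom e) 1 Q.Ω x / Q.Ω x + (x 0 - x 1)⁻¹ := by
  have hΩ := hQ.lapse_ne hx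
  have hG : ∀ l, christoffelLow (intDom e) P.metric 1 1 l x = 0 := by
    intro l
    have h1 : pd (intDom e) l (fun y => P.metric y 1 1) x = 0 := by
      rw [pd_congr (fun y _ => P.metric_one_one y) hx, pd_intDom _ hx, pd_const]
    rw [christoffelLow, h1]
    ring
  have h2 : P.omega x = pd (closedDom e) 1 P.Ω x / P.Ω x := by
    rw [PatchData.omega, hQ.dom, ip_covD (hQ.phys_det_ne hx) (hQ.phys_symm hx)]
    have hz0 : P.metric x 1 0 = -2 * P.Ω x ^ 2 := P.metric_one_zero x
    have hz1 : P.metric x 1 1 = 0 := P.metric_one_one x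
    have hz2 : P.metric x 1 2 = 0 := P.metric_one_ang x 0
    have hz3 : P.metric x 1 3 = 0 := P.metric_one_ang x 1
    simp only [hQ.pd_e3 hx, PatchData.e4, Fin.sum_univ_four, hz0, hz1, hz2, hz3, hG]
    simp [ang]
    field_simp
  rw [h2, hQ.pd_lapse hx]
  simp [dS]

/-- The vector field `∂_u + b` is orthogonal to `∂_u + b` and to the spheres. -/
theorem null_eq {x : Coord} (hx : x ∈ closedDom e) {j : Fin 4} (hj : j ≠ 1) :
    Q.metric x 0 j + Q.b x 0 * Q.metric x 2 j + Q.b x 1 * Q.metric x 3 j = 0 := by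
  have hs := hQ.sphere_symm x hx 1 0
  rw [Q.metric_eq_of x, hs]
  fin_cases j
  · simp
    ring
  · exact absurd rfl hj
  · simp
  · simp

theorem pd_null_eq {x : Coord} (hx : x ∈ closedDom e) (i : Fin 4) {j : Fin 4} (hj : j ≠ 1) :
    pd (closedDom e) i (fun y => Q.metric y 0 j) x
      + (pd (closedDom e) i (fun y => Q.b y 0) x * Q.metric x 2 j
        + Q.b x 0 * pd (closedDom e) i (fun y => Q.metric y 2 j) x)
      + (pd (closedDom e) i (fun y => Q.b y 1) x * Q.metric x 3 j
        + Q.b x 1 * pd (closedDom e) i (fun y => Q.metric y 3 j) x) = 0 := by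
  have hh := fun i j => (hQ.isRegularMetric.smooth i j).diff hx
  have hb := fun A => (hQ.smooth_shift A).diff hx
  have h1 := pd_congr (fun y hy => hQ.null_eq hy hj) hx i
  rwa [pd_add i hx ((hh 0 j).fun_add ((hb 0).fun_mul (hh 2 j))) ((hb 1).fun_mul (hh 3 j)),
    pd_add i hx (hh 0 j) ((hb 0).fun_mul (hh 2 j)), pd_mul i hx (hb 0) (hh 2 j),
    pd_mul i hx (hb 1) (hh 3 j), pd_const] at h1

/-- ω̲ is the derivative of log Ω along ∂_u + b. -/
theorem omegab_eq {x : Coord} (hx : x ∈ intDom e) :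
    P.omegab x = (pd (closedDom e) 0 Q.Ω x + ∑ A, Q.b x A * pd (closedDom e) (ang A) Q.Ω x) / Q.Ω x
      - (x 0 - x 1)⁻¹ := by
  have hΩ := hQ.lapse_ne hx
  have hx' := intDom_subset_closedDom e hx
  have hh := hQ.isRegularMetric
  have hG : ∀ m j, christoffelLow (intDom e) P.metric m j 1 x
        + christoffelLow (intDom e) P.metric j m 1 x
      = (x 0 - x 1)⁻¹ ^ 2 * pd (closedDom e) 1 (fun y => Q.metric y m j) x
        + 2 * (x 0 - x 1)⁻¹ ^ 3 * Q.metric x m j := by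
    intro m j
    rw [christoffelLow_conformal hh hQ.conformal hx, christoffelLow_conformal hh hQ.conformal hx,
      hh.pd_metric hx', hh.christoffelLow_symm hx' m 1 j, hh.christoffelLow_symm hx' j 1 m,
      hh.symm x hx' j m]
    simp only [dS, Matrix.cons_val_one, Matrix.cons_val_zero]
    ring
  have h2 : P.omegab x = pd (closedDom e) 0 P.Ω x / P.Ω x
      + ∑ A, Q.b x A * (pd (closedDom e) (ang A) P.Ω x / P.Ω x) := by
    rw [PatchData.omegab, hQ.dom, ip_covD (hQ.phys_det_ne hx) (hQ.phys_symm hx)]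
    have hz0 : P.metric x 0 1 = -2 * P.Ω x ^ 2 := P.metric_zero_one x
    have hz2 : P.metric x 2 1 = 0 := P.metric_ang_one x 0
    have hz3 : P.metric x 3 1 = 0 := P.metric_ang_one x 1
    have n0 := hQ.null_eq hx' (j := 0) (by decide)
    have n2 := hQ.null_eq hx' (j := 2) (by decide)
    have n3 := hQ.null_eq hx' (j := 3) (by decide)
    have d0 := hQ.pd_null_eq hx' 1 (j := 0) (by decide)
    have d2 := hQ.pd_null_eq hx' 1 (j := 2) (by decide)
    have d3 := hQ.pd_null_eq hx' 1 (j := 3) (by decide)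
    have g00 := hG 0 0
    have g02 := hG 0 2
    have g03 := hG 0 3
    have g22 := hG 2 2
    have g23 := hG 2 3
    have g33 := hG 3 3
    rw [hh.pd_symm hx' 2 0, hh.pd_symm hx' 3 0, hh.symm x hx' 2 0, hh.symm x hx' 3 0] at d0
    rw [hh.symm x hx' 2 0, hh.symm x hx' 3 0] at n0
    rw [hh.symm x hx' 3 2] at n2
    rw [hh.pd_symm hx' 3 2, hh.symm x hx' 3 2] at d2
    -- With n = ∂_u + b this is ½(∂_v g)(n, n) = 0. It follows by differentiating g(n, n) = 0, since
    -- ∂_v n is tangent to the spheres and n is orthogonal to them.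
    have key : christoffelLow (intDom e) P.metric 0 0 1 x
        + Q.b x 0 * (christoffelLow (intDom e) P.metric 0 2 1 x
            + christoffelLow (intDom e) P.metric 2 0 1 x)
        + Q.b x 1 * (christoffelLow (intDom e) P.metric 0 3 1 x
            + christoffelLow (intDom e) P.metric 3 0 1 x)
        + Q.b x 0 ^ 2 * christoffelLow (intDom e) P.metric 2 2 1 x
        + Q.b x 0 * Q.b x 1 * (christoffelLow (intDom e) P.metric 2 3 1 x
            + christoffelLow (intDom e) P.metric 3 2 1 x)
        + Q.b x 1 ^ 2 * christoffelLow (intDom e) P.metric 3 3 1 x = 0 := by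
      set σ := (x 0 - x 1)⁻¹
      linear_combination g00 / 2 + Q.b x 0 * g02 + Q.b x 1 * g03 + Q.b x 0 ^ 2 / 2 * g22
        + Q.b x 0 * Q.b x 1 * g23 + Q.b x 1 ^ 2 / 2 * g33
        + σ ^ 2 / 2 * (d0 + Q.b x 0 * d2 + Q.b x 1 * d3
          - pd (closedDom e) 1 (fun y => Q.b y 0) x * n2
          - pd (closedDom e) 1 (fun y => Q.b y 1) x * n3)
        + σ ^ 3 * (n0 + Q.b x 0 * n2 + Q.b x 1 * n3)
    simp only [hQ.pd_e4 hx]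
    simp only [PatchData.e3, PatchData.e4, Fin.sum_univ_four, Fin.sum_univ_two, hz0, hz2, hz3,
      hQ.shift_eq x hx]
    simp [ang]
    field_simp
    linear_combination key
  rw [h2, hQ.pd_lapse hx]
  simp only [hQ.pd_lapse hx, Fin.sum_univ_two]
  simp [dS, ang]
  ring

/-- The s⁻³ term is pure trace; it is the derivative of the conformal factor s⁻² along ∂_v. For
`chib` it has the opposite sign because ds(∂_u + b) = 1 and ds(∂_v) = −1. -/
theorem chi_eq {x : Coord} (hx : x ∈ intDom e) (A B : Fin 2) :
    P.chi x A B = (P.Ω x)⁻¹ * ((x 0 - x 1)⁻¹ ^ 2 * outForm e Q A B x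
      + (x 0 - x 1)⁻¹ ^ 3 * Q.gs x A B) := by
  have hx' := intDom_subset_closedDom e hx
  rw [PatchData.chi, hQ.dom, ip_covD (hQ.phys_det_ne hx) (hQ.phys_symm hx)]
  have hz : P.metric x (ang B) 1 = 0 := P.metric_ang_one x B
  have hc := christoffelLow_conformal hQ.isRegularMetric hQ.conformal hx (ang B) (ang A) 1
  rw [Q.metric_ang_one, Q.metric_ang_one, Q.metric_ang_ang, hQ.sphere_symm x hx' B A] at hc
  simp only [hQ.pd_e4 hx]
  simp only [eS, ite_mul, one_mul, zero_mul, Finset.sum_ite_eq', Finset.mem_univ, if_true,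
    PatchData.e4, mul_ite, mul_zero, mul_one, hz, hc, outForm]
  simp only [dS, Matrix.cons_val_one, Matrix.cons_val_zero]
  ring

theorem chib_eq {x : Coord} (hx : x ∈ intDom e) (A B : Fin 2) :
    P.chib x A B = (P.Ω x)⁻¹ * ((x 0 - x 1)⁻¹ ^ 2 * inForm e Q A B x
      - (x 0 - x 1)⁻¹ ^ 3 * Q.gs x A B) := by
  have hx' := intDom_subset_closedDom e hx
  have hΩ := hQ.lapse_ne hx
  have hs := sub_ne_zero_of_mem hx
  rw [PatchData.chib, hQ.dom, ip_covD (hQ.phys_det_ne hx) (hQ.phys_symm hx)]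
  have hg : ∀ i, P.metric x (ang B) i = (x 0 - x 1)⁻¹ ^ 2 * Q.metric x (ang B) i := fun i =>
    metric_eq hQ.conformal hx _ _
  have hc := fun l =>
    christoffelLow_conformal hQ.isRegularMetric hQ.conformal hx (ang B) (ang A) l
  simp only [Q.metric_ang_ang, hQ.sphere_symm x hx' B A, dS_ang, zero_mul, zero_add,
    sub_zero] at hc
  have n := hQ.null_eq hx' (j := ang B) (by fin_cases B <;> decide)
  rw [hQ.isRegularMetric.symm x hx' 0, hQ.isRegularMetric.symm x hx' 2,
    hQ.isRegularMetric.symm x hx' 3] at n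
  have m2 : Q.metric x (ang B) 2 = Q.gs x B 0 := Q.metric_ang_ang x B 0
  have m3 : Q.metric x (ang B) 3 = Q.gs x B 1 := Q.metric_ang_ang x B 1
  simp only [hQ.pd_e3 hx]
  simp only [eS, ite_mul, one_mul, zero_mul, Finset.sum_ite_eq', Finset.mem_univ, if_true, hg,
    hc, PatchData.e3, hQ.shift_eq x hx, inForm, Fin.sum_univ_four, Fin.sum_univ_two, m2, m3]
  rw [m2, m3] at n
  simp [dS_zero, dS_one, dS_two, dS_three, ang_zero, ang_one]
  linear_combination -((x 0 - x 1) ^ 2)⁻¹ * pd (closedDom e) (ang A) P.Ω x / P.Ω x ^ 2 * n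

/-- The conformal correction drops out because ds vanishes on the spheres and both ∂_v and ∂_u + b
are orthogonal to them. The same happens for `etab`. -/
theorem eta_eq {x : Coord} (hx : x ∈ intDom e) (A : Fin 2) :
    P.eta x A = -(2 * Q.Ω x ^ 2)⁻¹ * (christoffelLow (closedDom e) Q.metric 1 0 (ang A) x
      + ∑ C, Q.b x C * christoffelLow (closedDom e) Q.metric 1 (ang C) (ang A) x) := by
  have hx' := intDom_subset_closedDom e hx
  have hΩ := hQ.lapse_pos x hx'
  have hs := sub_ne_zero_of_mem hx
  rw [PatchData.eta, hQ.dom, ip_covD (hQ.phys_det_ne hx) (hQ.phys_symm hx)]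
  have hc := fun j => christoffelLow_conformal hQ.isRegularMetric hQ.conformal hx 1 j (ang A)
  have n := hQ.null_eq hx' (j := ang A) (by fin_cases A <;> decide)
  simp only [pd_eS, Q.metric_one_ang, dS_ang, mul_zero, zero_mul, add_zero] at hc ⊢
  simp only [eS, PatchData.e3, PatchData.e4, hc, hQ.shift_eq x hx, hQ.lapse_eq x hx,
    Fin.sum_univ_two, ite_mul, zero_mul, mul_ite, mul_one, mul_zero, Finset.sum_ite_eq',
    Finset.mem_univ, if_true]
  simp only [Fin.sum_univ_four]
  simp [dS_one, ang_zero, ang_one]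
  field_simp
  linear_combination -n

theorem etab_eq {x : Coord} (hx : x ∈ intDom e) (A : Fin 2) :
    P.etab x A = -(2 * Q.Ω x ^ 2)⁻¹ * (christoffelLow (closedDom e) Q.metric 0 1 (ang A) x
      + ∑ C, Q.b x C * christoffelLow (closedDom e) Q.metric (ang C) 1 (ang A) x) := by
  have hx' := intDom_subset_closedDom e hx
  have hΩ := hQ.lapse_pos x hx'
  have hs := sub_ne_zero_of_mem hx
  rw [PatchData.etab, hQ.dom, ip_covD (hQ.phys_det_ne hx) (hQ.phys_symm hx)]
  have hc := fun m => christoffelLow_conformal hQ.isRegularMetric hQ.conformal hx m 1 (ang A)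
  have n := hQ.null_eq hx' (j := ang A) (by fin_cases A <;> decide)
  simp only [pd_eS, Q.metric_one_ang, dS_ang, mul_zero, zero_mul, add_zero, sub_zero] at hc ⊢
  simp only [eS, PatchData.e3, PatchData.e4, hc, hQ.shift_eq x hx, hQ.lapse_eq x hx,
    Fin.sum_univ_two, ite_mul, zero_mul, mul_ite, mul_one, mul_zero, Finset.sum_ite_eq',
    Finset.mem_univ, if_true]
  simp only [Fin.sum_univ_four]
  simp [dS_one, ang_zero, ang_one]
  field_simp
  linear_combination n

end IsCompactification

end AAdS

end

noncomputable section

namespace AAdS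

open PatchData IsCompactification

/-! ## Expansions of the Ricci coefficients -/

/-- The trace with respect to the compactified metric of the spheres. -/
def confTr (Q : PatchData) (f : Fin 2 → Fin 2 → Coord → ℝ) (x : Coord) : ℝ :=
  ∑ A, ∑ B, (Q.gs x)⁻¹ A B * f A B x

namespace IsCompactification

variable {e : SChart} {P Q : PatchData} (hQ : IsCompactification e P Q)
include hQ

theorem smooth_confTr {f : Fin 2 → Fin 2 → Coord → ℝ} (hf : ∀ A B, Smooth e (f A B)) :
    Smooth e (confTr Q f) :=
  ContDiffOn.sum fun A _ => ContDiffOn.sum fun B _ =>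
    (AAdS.smooth_inv hQ.smooth_sphere hQ.sphere_det A B).mul (hf A B)

theorem sphere_inv_eq {x : Coord} (hx : x ∈ intDom e) (A B : Fin 2) :
    (P.gs x)⁻¹ A B = (x 0 - x 1) ^ 2 * (Q.gs x)⁻¹ A B := by
  have hs := sub_ne_zero_of_mem hx
  have hu : IsUnit (Q.gs x).det :=
    isUnit_iff_ne_zero.2 (hQ.sphere_det x (intDom_subset_closedDom e hx))
  have h1 : P.gs x = (x 0 - x 1)⁻¹ ^ 2 • Q.gs x := Matrix.ext (hQ.sphere_eq x hx)
  have h2 : ((x 0 - x 1) ^ 2 • (Q.gs x)⁻¹) * P.gs x = 1 := by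
    rw [h1, Matrix.smul_mul, Matrix.mul_smul, Matrix.nonsing_inv_mul _ hu, smul_smul,
      ← mul_pow, mul_inv_cancel₀ hs, one_pow, one_smul]
  rw [Matrix.inv_eq_left_inv h2]
  rfl

theorem confTr_sphere {x : Coord} (hx : x ∈ closedDom e) :
    confTr Q (fun A B y => Q.gs y A B) x = 2 := by
  have h1 : (Q.gs x)⁻¹ * Q.gs x = 1 :=
    Matrix.nonsing_inv_mul _ (isUnit_iff_ne_zero.2 (hQ.sphere_det x hx))
  have h2 := congrArg Matrix.trace h1
  rw [Matrix.trace_one, Fintype.card_fin] at h2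
  rw [confTr, ← Nat.cast_ofNat (R := ℝ), ← h2]
  simp only [Matrix.trace, Matrix.diag, Matrix.mul_apply]
  exact Finset.sum_congr rfl fun A _ => Finset.sum_congr rfl fun B _ => by
    rw [hQ.sphere_symm x hx A B]

section

variable {θ : Coord → Fin 2 → Fin 2 → ℝ} {f : Fin 2 → Fin 2 → Coord → ℝ} {x : Coord} {c : ℝ}

/-- Treats both null second fundamental forms at once, with c = 1 for χ and c = −1 for χ̲. The pure
trace term contributes 2c/s because the spheres have dimension two. -/
theorem lapse_mul_trS (hx : x ∈ intDom e)
    (hθ : ∀ A B, θ x A B = (P.Ω x)⁻¹ * ((x 0 - x 1)⁻¹ ^ 2 * f A B x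
      + c * (x 0 - x 1)⁻¹ ^ 3 * Q.gs x A B)) :
    P.Ω x * P.trS θ x = confTr Q f x + c * (2 / (x 0 - x 1)) := by
  have hΩ := hQ.lapse_ne hx
  have hs := sub_ne_zero_of_mem hx
  have h1 := hQ.confTr_sphere (intDom_subset_closedDom e hx)
  rw [← h1]
  simp only [trS, confTr, hθ, hQ.sphere_inv_eq hx, Fin.sum_univ_two]
  field_simp
  ring

/-- The singular term is pure trace and disappears, so the shears have one power of s more than the
forms suggest. -/
theorem hatS_eq (hx : x ∈ intDom e)
    (hθ : ∀ A B, θ x A B = (P.Ω x)⁻¹ * ((x 0 - x 1)⁻¹ ^ 2 * f A B x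
      + c * (x 0 - x 1)⁻¹ ^ 3 * Q.gs x A B)) (A B : Fin 2) :
    P.hatS θ x A B = (x 0 - x 1)⁻¹ * (Q.Ω x)⁻¹
      * (f A B x - (1 / 2) * confTr Q f x * Q.gs x A B) := by
  have hΩ := hQ.lapse_pos x (intDom_subset_closedDom e hx)
  have hs := sub_ne_zero_of_mem hx
  have h1 : P.trS θ x = (P.Ω x)⁻¹ * (confTr Q f x + c * (2 / (x 0 - x 1))) := by
    rw [← hQ.lapse_mul_trS hx hθ, inv_mul_cancel_left₀ (hQ.lapse_ne hx)]
  rw [hatS, h1, hθ, hQ.sphere_eq x hx, hQ.lapse_eq x hx]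
  field_simp
  ring

end

theorem chi_eq' {x : Coord} (hx : x ∈ intDom e) (A B : Fin 2) :
    P.chi x A B = (P.Ω x)⁻¹ * ((x 0 - x 1)⁻¹ ^ 2 * outForm e Q A B x
      + 1 * (x 0 - x 1)⁻¹ ^ 3 * Q.gs x A B) := by
  rw [hQ.chi_eq hx, one_mul]

theorem chib_eq' {x : Coord} (hx : x ∈ intDom e) (A B : Fin 2) :
    P.chib x A B = (P.Ω x)⁻¹ * ((x 0 - x 1)⁻¹ ^ 2 * inForm e Q A B x
      + (-1) * (x 0 - x 1)⁻¹ ^ 3 * Q.gs x A B) := by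
  rw [hQ.chib_eq hx]
  ring

/-- The difference of the two second fundamental forms is the Hessian of `u - v`. -/
theorem outForm_sub_inForm {x : Coord} (hx : x ∈ closedDom e) (A B : Fin 2) :
    outForm e Q A B x - inForm e Q A B x
      = -(2 * Q.Ω x ^ 2) * hessS (closedDom e) Q.metric (ang A) (ang B) x := by
  have hh := hQ.isRegularMetric
  have hΩ := (hQ.lapse_pos x hx).ne'
  have n := hQ.pd_null_eq hx (ang A) (j := ang B) (by fin_cases B <;> decide)
  have n1 := hh.pd_metric hx (ang A) 1 (ang B)
  rw [pd_congr (fun y _ => Q.metric_one_ang y B) hx, pd_const] at n1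
  rw [hh.pd_metric hx, hh.pd_metric hx, hh.pd_metric hx] at n
  have m2 : Q.metric x 2 (ang B) = Q.gs x B 0 :=
    (Q.metric_ang_ang x 0 B).trans (hQ.sphere_symm x hx 0 B)
  have m3 : Q.metric x 3 (ang B) = Q.gs x B 1 :=
    (Q.metric_ang_ang x 1 B).trans (hQ.sphere_symm x hx 1 B)
  rw [m2, m3] at n
  rw [hQ.hessS_eq hx, outForm, inForm]
  simp only [Fin.sum_univ_two, ang_zero, ang_one]
  field_simp
  linear_combination -n1 - n

/-- Γ_{1,1A} vanishes, so the Christoffel symbols that make up η̲ are those of Hess s(∂_v, ∂_A). -/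
theorem etab_eq_hessS {x : Coord} (hx : x ∈ intDom e) (A : Fin 2) :
    P.etab x A = hessS (closedDom e) Q.metric 1 (ang A) x := by
  have hx' := intDom_subset_closedDom e hx
  have h1 : christoffelLow (closedDom e) Q.metric 1 1 (ang A) x = 0 := by
    rw [christoffelLow, pd_congr (fun y _ => Q.metric_one_one y) hx', pd_const]
    ring
  rw [hQ.etab_eq hx, hQ.hessS_eq hx', h1]
  simp only [Fin.sum_univ_two, ang_zero, ang_one]
  ring

/-- Metric compatibility applied to h(∂_u + b, ∂_v) = −2Ω̂². The lapse of h may replace that of g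
because s is constant on each sphere. -/
theorem eta_add_etab {x : Coord} (hx : x ∈ intDom e) (A : Fin 2) :
    P.eta x A + P.etab x A = 2 * (pd (closedDom e) (ang A) Q.Ω x / Q.Ω x) := by
  have hx' := intDom_subset_closedDom e hx
  have hh := hQ.isRegularMetric
  have hΩ := (hQ.lapse_pos x hx').ne'
  have hd := hQ.smooth_lapse.diff hx'
  have h0 := hh.pd_metric hx' (ang A) 1 0
  rw [pd_congr (fun y _ => Q.metric_one_zero y) hx',
    pd_mul _ hx' (differentiableWithinAt_const _) (hd.fun_pow 2), pd_const] at h0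
  have hsq : pd (closedDom e) (ang A) (fun y => Q.Ω y ^ 2) x
      = 2 * Q.Ω x * pd (closedDom e) (ang A) Q.Ω x := by
    simp only [pow_two]
    rw [pd_mul _ hx' hd hd]
    ring
  have hC : ∀ C : Fin 2, christoffelLow (closedDom e) Q.metric 1 (ang C) (ang A) x
      + christoffelLow (closedDom e) Q.metric (ang C) 1 (ang A) x = 0 := fun C => by
    have := hh.pd_metric hx' (ang A) 1 (ang C)
    rw [pd_congr (fun y _ => Q.metric_one_ang y C) hx', pd_const,
      hh.christoffelLow_symm hx' 1, hh.christoffelLow_symm hx' (ang C)] at this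
    exact this.symm
  rw [hsq, hh.christoffelLow_symm hx' 1, hh.christoffelLow_symm hx' 0] at h0
  have h2 := hC 0
  have h3 := hC 1
  rw [hQ.eta_eq hx, hQ.etab_eq hx]
  simp only [Fin.sum_univ_two]
  field_simp
  linear_combination h0 - Q.b x 0 * h2 - Q.b x 1 * h3

end IsCompactification

namespace HasExpansion

variable {e : SChart} {k : ℝ} {P Q : PatchData} {N : Coord → ℝ} {K : Fin 4 → Fin 4 → Coord → ℝ}
  (hK : HasExpansion e k Q N K) (hQ : IsCompactification e P Q)
include hK hQ

theorem lapse_sq {x : Coord} (hx : x ∈ closedDom e) :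
    k ^ 2 * Q.Ω x ^ 2 - 1 = -(x 0 - x 1) ^ 2 * (Q.Ω x ^ 2 * N x) := by
  have h1 := hK.norm_eq x hx
  have hΩ := (hQ.lapse_pos x hx).ne'
  rw [hQ.normS_eq hx] at h1
  field_simp at h1
  linear_combination -h1

/-- The differential of Ω̂⁻² = k² + s²N. The term with ds is of order s and is absent in directions
tangent to the spheres, where only order s² remains. -/
theorem pd_log_lapse {x : Coord} (hx : x ∈ closedDom e) (i : Fin 4) :
    pd (closedDom e) i Q.Ω x / Q.Ω x = -Q.Ω x ^ 2 * ((x 0 - x 1) * N x * dS i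
      + (x 0 - x 1) ^ 2 * pd (closedDom e) i N x / 2) := by
  have hΩ := (hQ.lapse_pos x hx).ne'
  have hd := hQ.smooth_lapse.diff hx
  have hs := (smooth_defining e).diff hx
  have hN := hK.smooth_norm.diff hx
  have h1 := pd_congr (fun y hy => (congrArg (· - k ^ 2) (hQ.normS_eq hy)).symm.trans
    (hK.norm_eq y hy)) hx i
  have hsq : pd (closedDom e) i (fun y => Q.Ω y ^ 2) x = 2 * Q.Ω x * pd (closedDom e) i Q.Ω x := by
    simp only [pow_two]
    rw [pd_mul _ hx hd hd]
    ring
  rw [pd_sub i hx ((hd.fun_pow 2).fun_inv (pow_ne_zero 2 hΩ)) (differentiableWithinAt_const _),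
    pd_inv i hx (hd.fun_pow 2) (pow_ne_zero 2 hΩ), pd_const, hsq, pd_mul i hx hs (hs.fun_mul hN),
    pd_mul i hx hs hN, pd_defining hx] at h1
  field_simp at h1 ⊢
  linear_combination -h1

end HasExpansion

end AAdS

end

noncomputable section

namespace AAdS

open PatchData IsCompactification

/-! ## Existence of the compactified data -/

/-- The assumption concerns the matrix h as a whole; lapse, shift and sphere metric have to be
recovered from its entries. The double null shape passes to the boundary by continuity, and
nondegeneracy excludes that the lapse or the sphere determinant vanishes there. -/
theorem exists_isCompactification {e : SChart} {P : PatchData} {h : MetricField}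
    (hD : P.D = intDom e) (hΩ : ∀ x ∈ intDom e, 0 < P.Ω x)
    (hsymm : ∀ x ∈ intDom e, ∀ A B, P.gs x A B = P.gs x B A)
    (hh : ∀ i j, Smooth e (fun x => h x i j)) (hdet : ∀ x ∈ closedDom e, (h x).det ≠ 0)
    (hP : ∀ x ∈ intDom e, ∀ i j, h x i j = (x 0 - x 1) ^ 2 * P.metric x i j) :
    ∃ Q, IsCompactification e P Q := by
  have h11 : ∀ x ∈ closedDom e, h x 1 1 = 0 :=
    eq_of_eq_on_intDom (hh 1 1) contDiffOn_const fun x hx => by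
      rw [hP x hx, P.metric_one_one, mul_zero]
  have h1A : ∀ A, ∀ x ∈ closedDom e, h x 1 (ang A) = 0 := fun A =>
    eq_of_eq_on_intDom (hh 1 _) contDiffOn_const fun x hx => by
      rw [hP x hx, P.metric_one_ang, mul_zero]
  have hA1 : ∀ A, ∀ x ∈ closedDom e, h x (ang A) 1 = 0 := fun A =>
    eq_of_eq_on_intDom (hh _ 1) contDiffOn_const fun x hx => by
      rw [hP x hx, P.metric_ang_one, mul_zero]
  have h10 : ∀ x ∈ closedDom e, h x 1 0 = h x 0 1 :=
    eq_of_eq_on_intDom (hh 1 0) (hh 0 1) fun x hx => by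
      rw [hP x hx, hP x hx, P.metric_one_zero, P.metric_zero_one]
  have hAB : ∀ A B, ∀ x ∈ closedDom e, h x (ang A) (ang B) = h x (ang B) (ang A) := fun A B =>
    eq_of_eq_on_intDom (hh _ _) (hh _ _) fun x hx => by
      rw [hP x hx, hP x hx, P.metric_ang_ang, P.metric_ang_ang, hsymm x hx]
  have h01 : ∀ x ∈ closedDom e, h x 0 1 < 0 := by
    intro x hx
    -- The inequality h₀₁ ≤ 0 in the form of an equation between continuous functions, so that
    -- density applies. If h₀₁ were 0, row 1 of h would vanish.
    have hle : h x 0 1 = -|h x 0 1| :=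
      Set.EqOn.of_subset_closure (s := intDom e) (f := fun x => h x 0 1)
        (g := fun x => -|h x 0 1|) (fun y hy => by
          have h1 : h y 0 1 ≤ 0 := by
            rw [hP y hy, P.metric_zero_one]
            nlinarith [mul_nonneg (sq_nonneg (y 0 - y 1)) (sq_nonneg (P.Ω y))]
          simp only [abs_of_nonpos h1, neg_neg]) (hh 0 1).continuousOn (hh 0 1).continuousOn.abs.neg
        (intDom_subset_closedDom e) (closedDom_subset_closure e) hx
    refine lt_of_le_of_ne (by rw [hle]; simp) fun h0 => hdet x hx ?_
    refine Matrix.det_eq_zero_of_row_eq_zero 1 fun j => ?_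
    fin_cases j
    · exact (h10 x hx).trans h0
    · exact h11 x hx
    · exact h1A 0 x hx
    · exact h1A 1 x hx
  set q : Coord → Matrix (Fin 2) (Fin 2) ℝ := fun x => Matrix.of fun A B => h x (ang A) (ang B)
    with hq
  have hqs : ∀ A B, Smooth e (fun x => q x A B) := fun A B => hh _ _
  have hqdet : ∀ x ∈ closedDom e, (q x).det ≠ 0 := by
    intro x hx h0
    obtain ⟨v, hv, hqv⟩ := Matrix.exists_mulVec_eq_zero_iff.2 h0
    -- A kernel vector of the sphere block becomes one of h; its ∂_v component is chosen to
    -- annihilate row 0.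
    refine hdet x hx (Matrix.exists_mulVec_eq_zero_iff.1
      ⟨![0, -(h x 0 2 * v 0 + h x 0 3 * v 1) / h x 0 1, v 0, v 1], fun hz => hv ?_, ?_⟩)
    · ext A
      fin_cases A
      · exact congrFun hz 2
      · exact congrFun hz 3
    · have r0 := congrFun hqv 0
      have r1 := congrFun hqv 1
      simp only [Matrix.mulVec, dotProduct, Fin.sum_univ_two, hq, Matrix.of_apply, ang_zero,
        ang_one, Pi.zero_apply] at r0 r1
      have hne := (h01 x hx).ne
      have z11 := h11 x hx
      have z12 : h x 1 2 = 0 := h1A 0 x hx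
      have z13 : h x 1 3 = 0 := h1A 1 x hx
      have z21 : h x 2 1 = 0 := hA1 0 x hx
      have z31 : h x 3 1 = 0 := hA1 1 x hx
      ext i
      fin_cases i <;> simp [Matrix.mulVec, dotProduct, Fin.sum_univ_four, z11, z12, z13, z21, z31,
        r0, r1]
      field_simp
      ring
  -- Solved from h₀₁ = −2Ω̂² and h_{0A} = −q_{AB} b^B.
  refine ⟨⟨closedDom e, fun x => Real.sqrt (-h x 0 1 / 2),
    fun x A => -∑ B, (q x)⁻¹ A B * h x 0 (ang B), q⟩, ?_⟩
  refine ⟨hD, ?_, fun A => ?_, hqs, fun x hx => ?_, fun x hx A B => hAB A B x hx, hqdet,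
    fun x hx => ?_, fun x hx A => ?_, fun x hx A B => ?_⟩
  · refine ContDiffOn.sqrt ((hh 0 1).neg.div_const 2) fun x hx => ?_
    have := h01 x hx
    exact (by linarith : (0 : ℝ) < -h x 0 1 / 2).ne'
  · exact (ContDiffOn.sum fun B _ => (AAdS.smooth_inv hqs hqdet A B).mul (hh 0 (ang B))).neg
  · exact Real.sqrt_pos.2 (by linarith [h01 x hx])
  · have hs : 0 < x 0 - x 1 := sub_pos.2 hx.2.1
    have h1 : -h x 0 1 / 2 = ((x 0 - x 1) * P.Ω x) ^ 2 := by
      rw [hP x hx, P.metric_zero_one]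
      ring
    change P.Ω x = (x 0 - x 1)⁻¹ * Real.sqrt (-h x 0 1 / 2)
    rw [h1, Real.sqrt_sq (mul_pos hs (hΩ x hx)).le, inv_mul_cancel_left₀ hs.ne']
  · have hx' := intDom_subset_closedDom e hx
    have h1 : (q x)⁻¹ * q x = 1 := Matrix.nonsing_inv_mul _ (isUnit_iff_ne_zero.2 (hqdet x hx'))
    have h2 : ∀ B, -h x 0 (ang B) = (q x).mulVec (P.b x) B := by
      intro B
      simp only [Matrix.mulVec, dotProduct, Fin.sum_univ_two, hq, Matrix.of_apply, hP x hx,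
        P.metric_zero_ang, P.metric_ang_ang, hsymm x hx B]
      ring
    change P.b x A = -∑ B, (q x)⁻¹ A B * h x 0 (ang B)
    have h3 : (q x)⁻¹.mulVec ((q x).mulVec (P.b x)) A = P.b x A := by
      rw [Matrix.mulVec_mulVec, h1, Matrix.one_mulVec]
    rw [← h3, Matrix.mulVec, dotProduct, ← Finset.sum_neg_distrib]
    exact Finset.sum_congr rfl fun B _ => by rw [← h2 B, mul_neg]
  · have hs := sub_ne_zero_of_mem hx
    simp only [hq, Matrix.of_apply, hP x hx, P.metric_ang_ang]
    field_simp

theorem DoubleNull.exists_isCompactification {g : DoubleNull} (hAdS : g.IsAsymptoticallyAdS)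
    {e : SChart} (he : e ∈ charts) : ∃ Q, IsCompactification e (g.inChart e) Q := by
  obtain ⟨h, hh, hdet, hP⟩ := hAdS e he
  exact AAdS.exists_isCompactification rfl (fun x hx => g.Ω_pos _ _ _ hx.1 hx.2.1)
    (fun x hx A B => g.gs_symm _ _ _ hx.1 hx.2.1 _ _) hh hdet hP

/-! ## Null components of the Weyl tensor -/

section WeylComponents

variable {e : SChart} {ρ R : Coord → ℝ} (hρ : Smooth e ρ)
  (hR : ∀ x ∈ intDom e, R x = ρ x / (x 0 - x 1))
  {T V : Fin 4 → Fin 4 → Fin 4 → Fin 4 → Coord → ℝ} (hV : ∀ i j l m, Smooth e (V i j l m))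
  (hT : ∀ i j l m, ∀ x ∈ intDom e, T i j l m x = (x 0 - x 1)⁻¹ * V i j l m x)

/-- A vector field of the form `(u - v)` times a smooth one. -/
def IsScaledField (e : SChart) (X : VField) : Prop :=
  ∃ Y : VField, (∀ i, Smooth e (fun x => Y x i)) ∧
    ∀ x ∈ intDom e, ∀ i, X x i = (x 0 - x 1) * Y x i

include hρ hR hV hT

/-- Weights: s⁻³ from R³, s⁻¹ from the tensor and s⁴ from its four arguments. -/
theorem extendsSmoothly_apply4 {X Y Z W : VField} (hX : IsScaledField e X)
    (hY : IsScaledField e Y) (hZ : IsScaledField e Z) (hW : IsScaledField e W) :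
    ExtendsSmoothly e (fun x => R x ^ 3 * apply4 T X Y Z W x) := by
  obtain ⟨X', hX', hXe⟩ := hX
  obtain ⟨Y', hY', hYe⟩ := hY
  obtain ⟨Z', hZ', hZe⟩ := hZ
  obtain ⟨W', hW', hWe⟩ := hW
  refine ⟨fun x => ρ x ^ 3 * apply4 V X' Y' Z' W' x, (hρ.pow 3).mul (ContDiffOn.sum fun i _ =>
    ContDiffOn.sum fun j _ => ContDiffOn.sum fun l _ => ContDiffOn.sum fun m _ =>
      ((((hV i j l m).mul (hX' i)).mul (hY' j)).mul (hZ' l)).mul (hW' m)), fun x hx => ?_⟩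
  have hs := sub_ne_zero_of_mem hx
  simp only [apply4, hR x hx, hT _ _ _ _ x hx, hXe x hx, hYe x hx, hZe x hx, hWe x hx,
    Finset.mul_sum]
  refine Finset.sum_congr rfl fun i _ => Finset.sum_congr rfl fun j _ =>
    Finset.sum_congr rfl fun l _ => Finset.sum_congr rfl fun m _ => ?_
  field_simp

end WeylComponents

/-- The spacetime vector field `E^A ∂_A`. -/
def sphereField (E : Coord → Fin 2 → ℝ) : VField := fun x i => ∑ A, E x A * eS A x i

theorem apply4_tensor (T : Fin 4 → Fin 4 → Fin 4 → Fin 4 → Coord → ℝ) (Y W : VField)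
    (E F : Coord → Fin 2 → ℝ) (x : Coord) :
    ∑ A, ∑ B, apply4 T (eS A) Y (eS B) W x * E x A * F x B
      = apply4 T (sphereField E) Y (sphereField F) W x := by
  simp only [apply4, sphereField, Fin.sum_univ_two, ← Finset.sum_add_distrib, Finset.sum_mul]
  exact Finset.sum_congr rfl fun i _ => Finset.sum_congr rfl fun j _ =>
    Finset.sum_congr rfl fun l _ => Finset.sum_congr rfl fun m _ => by ring

theorem apply4_form (T : Fin 4 → Fin 4 → Fin 4 → Fin 4 → Coord → ℝ) (Y Z W : VField)
    (E : Coord → Fin 2 → ℝ) (x : Coord) :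
    ∑ A, apply4 T (eS A) Y Z W x * E x A = apply4 T (sphereField E) Y Z W x := by
  simp only [apply4, sphereField, Fin.sum_univ_two, ← Finset.sum_add_distrib, Finset.sum_mul]
  exact Finset.sum_congr rfl fun i _ => Finset.sum_congr rfl fun j _ =>
    Finset.sum_congr rfl fun l _ => Finset.sum_congr rfl fun m _ => by ring

namespace IsCompactification

variable {e : SChart} {P Q : PatchData} (hQ : IsCompactification e P Q)
include hQ

theorem smooth_inv_lapse : Smooth e (fun x => (Q.Ω x)⁻¹) :=
  hQ.smooth_lapse.inv fun x hx => (hQ.lapse_pos x hx).ne'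

theorem isScaledField_e3 : IsScaledField e P.e3 := by
  refine ⟨Q.e3, fun i => hQ.smooth_inv_lapse.mul (contDiffOn_const.add (ContDiffOn.sum fun A _ =>
    (hQ.smooth_shift A).mul contDiffOn_const)), fun x hx i => ?_⟩
  simp only [e3, hQ.lapse_eq x hx, hQ.shift_eq x hx, mul_inv, inv_inv]
  ring

theorem isScaledField_e4 : IsScaledField e P.e4 := by
  refine ⟨Q.e4, fun i => hQ.smooth_inv_lapse.mul contDiffOn_const, fun x hx i => ?_⟩
  simp only [e4, hQ.lapse_eq x hx, mul_inv, inv_inv]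
  ring

omit hQ in
theorem isScaledField_sphereField {E : Coord → Fin 2 → ℝ} {F : Fin 2 → Coord → ℝ}
    (hF : ∀ A, Smooth e (F A)) (hE : ∀ x ∈ intDom e, ∀ A, E x A = (x 0 - x 1) * F A x) :
    IsScaledField e (sphereField E) := by
  refine ⟨sphereField fun x A => F A x, fun i => ContDiffOn.sum fun A _ =>
    (hF A).mul contDiffOn_const, fun x hx i => ?_⟩
  simp only [sphereField, hE x hx, Finset.mul_sum, mul_assoc]

/-- The determinant scales by s⁻⁸, its square root by s⁻⁴. -/
theorem volForm_eq {x : Coord} (hx : x ∈ intDom e) (i j l m : Fin 4) :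
    volForm P.metric i j l m x = (x 0 - x 1)⁻¹ ^ 4 * volForm Q.metric i j l m x := by
  have hs : 0 < (x 0 - x 1)⁻¹ := inv_pos.2 (sub_pos.2 hx.2.1)
  have h1 : P.metric x = (x 0 - x 1)⁻¹ ^ 2 • Q.metric x :=
    Matrix.ext fun i j => metric_eq hQ.conformal hx i j
  have h2 : |(P.metric x).det| = ((x 0 - x 1)⁻¹ ^ 4) ^ 2 * |(Q.metric x).det| := by
    rw [h1, Matrix.det_smul, Fintype.card_fin, abs_mul, abs_of_pos (by positivity)]
    ring
  rw [volForm, volForm, h2, Real.sqrt_mul (by positivity), Real.sqrt_sq (by positivity), mul_assoc]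

theorem smooth_volForm (i j l m : Fin 4) : Smooth e (volForm Q.metric i j l m) := by
  have hh := hQ.isRegularMetric
  refine ContDiffOn.mul (ContDiffOn.sqrt ?_ fun x hx => abs_ne_zero.2 (hh.det_ne x hx))
    contDiffOn_const
  exact fun x hx => (smooth_det hh.smooth x hx).abs (hh.det_ne x hx)

/-- The Hodge dual on two-forms is conformally invariant: s⁻⁴ from the volume form cancels s² from
each of the two inverse metrics. -/
theorem weylDual_eq {V : Fin 4 → Fin 4 → Fin 4 → Fin 4 → Coord → ℝ}
    (hV : ∀ i j l m, Smooth e (V i j l m))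
    (hW : ∀ i j l m, ∀ x ∈ intDom e,
      weyl (intDom e) P.metric i j l m x = (x 0 - x 1)⁻¹ * V i j l m x) :
    ∃ V' : Fin 4 → Fin 4 → Fin 4 → Fin 4 → Coord → ℝ, (∀ i j l m, Smooth e (V' i j l m)) ∧
      ∀ i j l m, ∀ x ∈ intDom e,
        weylDual (intDom e) P.metric i j l m x = (x 0 - x 1)⁻¹ * V' i j l m x := by
  have hh := hQ.isRegularMetric
  refine ⟨fun i j l m x => (1 / 2) * ∑ p, ∑ q, ∑ a, ∑ c, volForm Q.metric i j p q x
    * (Q.metric x)⁻¹ p a * (Q.metric x)⁻¹ q c * V a c l m x, fun i j l m => ?_,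
    fun i j l m x hx => ?_⟩
  · exact contDiffOn_const.mul (ContDiffOn.sum fun p _ => ContDiffOn.sum fun q _ =>
      ContDiffOn.sum fun a _ => ContDiffOn.sum fun c _ => (((hQ.smooth_volForm i j p q).mul
        (hh.smooth_inv p a)).mul (hh.smooth_inv q c)).mul (hV a c l m))
  · have hs := sub_ne_zero_of_mem hx
    simp only [weylDual, hQ.volForm_eq hx, metric_inv_eq hh hQ.conformal hx, hW _ _ _ _ x hx,
      Finset.mul_sum]
    refine Finset.sum_congr rfl fun p _ => Finset.sum_congr rfl fun q _ =>
      Finset.sum_congr rfl fun a _ => Finset.sum_congr rfl fun c _ => ?_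
    field_simp

end IsCompactification

end AAdS

end

noncomputable section

namespace AAdS

open PatchData IsCompactification

/-! ## Smooth extension of the rescaled quantities -/

namespace HasExpansion

variable {e : SChart} {k : ℝ} {P Q : PatchData} {N : Coord → ℝ} {K : Fin 4 → Fin 4 → Coord → ℝ}
  (hK : HasExpansion e k Q N K) (hQ : IsCompactification e P Q)
  {ρ R : Coord → ℝ} (hρ : Smooth e ρ) (hR : ∀ x ∈ intDom e, R x = ρ x / (x 0 - x 1))

/-- The Hessian of `u - v`, divided by `u - v`, on the spheres. -/
abbrev sphereHess (K : Fin 4 → Fin 4 → Coord → ℝ) (A B : Fin 2) : Coord → ℝ := K (ang A) (ang B)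

/-! ### The lapse, ω, ω̲ and the difference of the traces -/

section Lapse

include hK hQ

/-- To leading order d log Ω̂ = −sNΩ̂² ds. As ds(∂_v) = −1 and ds(∂_u + b) = 1, the leading terms of
ω and ω̲ are opposite. -/
theorem omega_sub_eq {x : Coord} (hx : x ∈ intDom e) :
    P.omega x - 1 / (x 0 - x 1) = (x 0 - x 1) * (Q.Ω x ^ 2
      * (N x - (x 0 - x 1) * pd (closedDom e) 1 N x / 2)) := by
  rw [hQ.omega_eq hx, hK.pd_log_lapse hQ (intDom_subset_closedDom e hx), dS_one]
  ring

theorem omegab_add_eq {x : Coord} (hx : x ∈ intDom e) :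
    P.omegab x + 1 / (x 0 - x 1) = -(x 0 - x 1) * (Q.Ω x ^ 2
      * (N x + (x 0 - x 1) * (pd (closedDom e) 0 N x
        + ∑ A, Q.b x A * pd (closedDom e) (ang A) N x) / 2)) := by
  have hp := hK.pd_log_lapse hQ (intDom_subset_closedDom e hx)
  have h1 : P.omegab x + 1 / (x 0 - x 1) = pd (closedDom e) 0 Q.Ω x / Q.Ω x
      + ∑ A, Q.b x A * (pd (closedDom e) (ang A) Q.Ω x / Q.Ω x) := by
    rw [hQ.omegab_eq hx]
    simp only [Fin.sum_univ_two]
    ring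
  rw [h1]
  simp only [hp, dS_zero, dS_ang, Fin.sum_univ_two]
  ring

theorem eta_add_etab_eq {x : Coord} (hx : x ∈ intDom e) (A : Fin 2) :
    P.eta x A + P.etab x A
      = -(x 0 - x 1) ^ 2 * (Q.Ω x ^ 2 * pd (closedDom e) (ang A) N x) := by
  rw [hQ.eta_add_etab hx, hK.pd_log_lapse hQ (intDom_subset_closedDom e hx), dS_ang]
  ring

theorem etab_eq' {x : Coord} (hx : x ∈ intDom e) (A : Fin 2) :
    P.etab x A = (x 0 - x 1) * K 1 (ang A) x := by
  rw [hQ.etab_eq_hessS hx, hK.hess_eq _ _ x (intDom_subset_closedDom e hx)]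

theorem outForm_eq {x : Coord} (hx : x ∈ closedDom e) (A B : Fin 2) :
    outForm e Q A B x = inForm e Q A B x
      - (x 0 - x 1) * (2 * Q.Ω x ^ 2) * sphereHess K A B x := by
  have := hQ.outForm_sub_inForm hx A B
  rw [hK.hess_eq _ _ x hx] at this
  linear_combination this

theorem confTr_outForm {x : Coord} (hx : x ∈ closedDom e) :
    confTr Q (outForm e Q) x = confTr Q (inForm e Q) x
      - (x 0 - x 1) * (2 * Q.Ω x ^ 2) * confTr Q (sphereHess K) x := by
  simp only [confTr, hK.outForm_eq hQ hx, Fin.sum_univ_two]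
  ring

include hρ hR

theorem extends_lapse :
    ExtendsSmoothly e (fun x => R x ^ 2 * (k ^ 2 * (x 0 - x 1) ^ 2 * P.Ω x ^ 2 - 1)) := by
  refine ⟨fun x => -(ρ x ^ 2 * (Q.Ω x ^ 2 * N x)),
    ((hρ.pow 2).mul ((hQ.smooth_lapse.pow 2).mul hK.smooth_norm)).neg, fun x hx => ?_⟩
  have hs := sub_ne_zero_of_mem hx
  have h1 := hK.lapse_sq hQ (intDom_subset_closedDom e hx)
  have h2 : k ^ 2 * (x 0 - x 1) ^ 2 * P.Ω x ^ 2 - 1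
      = -(x 0 - x 1) ^ 2 * (Q.Ω x ^ 2 * N x) := by
    rw [← h1, hQ.lapse_eq x hx]
    field_simp
  beta_reduce
  rw [h2, hR x hx]
  field_simp

theorem extends_omega : ExtendsSmoothly e (fun x => R x * (P.omega x - 1 / (x 0 - x 1))) := by
  refine ⟨fun x => ρ x * (Q.Ω x ^ 2 * (N x - (x 0 - x 1) * pd (closedDom e) 1 N x / 2)),
    hρ.mul ((hQ.smooth_lapse.pow 2).mul (hK.smooth_norm.sub
      (((smooth_defining e).mul (hK.smooth_norm.pd 1)).div_const 2))), fun x hx => ?_⟩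
  have hs := sub_ne_zero_of_mem hx
  beta_reduce
  rw [hK.omega_sub_eq hQ hx, hR x hx]
  field_simp

theorem extends_omegab : ExtendsSmoothly e (fun x => R x * (P.omegab x + 1 / (x 0 - x 1))) := by
  refine ⟨fun x => -(ρ x * (Q.Ω x ^ 2 * (N x + (x 0 - x 1) * (pd (closedDom e) 0 N x
        + ∑ A, Q.b x A * pd (closedDom e) (ang A) N x) / 2))),
    (hρ.mul ((hQ.smooth_lapse.pow 2).mul (hK.smooth_norm.add
      (((smooth_defining e).mul ((hK.smooth_norm.pd 0).add (ContDiffOn.sum fun A _ =>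
        (hQ.smooth_shift A).mul (hK.smooth_norm.pd _)))).div_const 2)))).neg, fun x hx => ?_⟩
  have hs := sub_ne_zero_of_mem hx
  beta_reduce
  rw [hK.omegab_add_eq hQ hx, hR x hx]
  field_simp

/-- The opposite terms ±sΩ̂²N cancel, which gains one order over ω and ω̲ separately. -/
theorem extends_omega_add_omegab :
    ExtendsSmoothly e (fun x => R x ^ 2 * (P.omega x + P.omegab x)) := by
  refine ⟨fun x => -(ρ x ^ 2 * (Q.Ω x ^ 2 * (pd (closedDom e) 1 N x + (pd (closedDom e) 0 N x
        + ∑ A, Q.b x A * pd (closedDom e) (ang A) N x)) / 2)),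
    ((hρ.pow 2).mul (((hQ.smooth_lapse.pow 2).mul ((hK.smooth_norm.pd 1).add
      ((hK.smooth_norm.pd 0).add (ContDiffOn.sum fun A _ =>
        (hQ.smooth_shift A).mul (hK.smooth_norm.pd _))))).div_const 2)).neg, fun x hx => ?_⟩
  have hs := sub_ne_zero_of_mem hx
  have h1 : P.omega x + P.omegab x
      = (P.omega x - 1 / (x 0 - x 1)) + (P.omegab x + 1 / (x 0 - x 1)) := by ring
  beta_reduce
  rw [h1, hK.omega_sub_eq hQ hx, hK.omegab_add_eq hQ hx, hR x hx]
  field_simp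
  ring

theorem extends_trace_difference : ExtendsSmoothly e
    (fun x => R x * (P.Ω x * P.trS P.chi x - P.Ω x * P.trS P.chib x - 4 / (x 0 - x 1))) := by
  refine ⟨fun x => -(ρ x * (2 * Q.Ω x ^ 2 * confTr Q (sphereHess K) x)),
    (hρ.mul ((contDiffOn_const.mul (hQ.smooth_lapse.pow 2)).mul
      (hQ.smooth_confTr fun A B => hK.smooth_hess _ _))).neg, fun x hx => ?_⟩
  have hs := sub_ne_zero_of_mem hx
  beta_reduce
  rw [hQ.lapse_mul_trS hx (hQ.chi_eq' hx), hQ.lapse_mul_trS hx (hQ.chib_eq' hx),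
    hK.confTr_outForm hQ (intDom_subset_closedDom e hx), hR x hx]
  field_simp
  ring

end Lapse

/-! ### The two null expansions -/

section Trace

include hQ

omit hK in
theorem extends_trace_chi :
    ExtendsSmoothly e (fun x => P.Ω x * P.trS P.chi x - 2 / (x 0 - x 1)) := by
  refine ⟨confTr Q (outForm e Q), hQ.smooth_confTr hQ.smooth_outForm, fun x hx => ?_⟩
  beta_reduce
  rw [hQ.lapse_mul_trS hx (hQ.chi_eq' hx)]
  ring

omit hK in
theorem extends_trace_chib :
    ExtendsSmoothly e (fun x => P.Ω x * P.trS P.chib x + 2 / (x 0 - x 1)) := by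
  refine ⟨confTr Q (inForm e Q), hQ.smooth_confTr hQ.smooth_inForm, fun x hx => ?_⟩
  beta_reduce
  rw [hQ.lapse_mul_trS hx (hQ.chib_eq' hx)]
  ring

end Trace

/-! ### Tensorial quantities in a frame E = sF -/

section Frame

variable {E : Fin 2 → Coord → Fin 2 → ℝ} {F : Fin 2 → Fin 2 → Coord → ℝ}
  (hF : ∀ a A, Smooth e (F a A)) (hE : ∀ a A, ∀ x ∈ intDom e, E a x A = (x 0 - x 1) * F a A x)

include hQ hρ hR hF hE

omit hK in
-- Weights: s⁻² from the sphere metric, s from the frame vector and s from 1/r, where ρ must not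
-- vanish.
theorem extends_shift (hρ0 : ∀ x ∈ closedDom e, ρ x ≠ 0) :
    VectorExtends e P E (fun x A => (R x)⁻¹ * P.b x A) := by
  refine fun a => ⟨fun x => ∑ A, ∑ B, Q.gs x A B * ((ρ x)⁻¹ * Q.b x A) * F a B x,
    ContDiffOn.sum fun A _ => ContDiffOn.sum fun B _ => ((hQ.smooth_sphere A B).mul
      ((hρ.inv hρ0).mul (hQ.smooth_shift A))).mul (hF a B), fun x hx => ?_⟩
  have hs := sub_ne_zero_of_mem hx
  have h0 := hρ0 x (intDom_subset_closedDom e hx)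
  refine Finset.sum_congr rfl fun A _ => Finset.sum_congr rfl fun B _ => ?_
  beta_reduce
  rw [hQ.sphere_eq x hx, hQ.shift_eq x hx, hE a B x hx, hR x hx]
  field_simp

omit hK in
theorem extends_hatS {θ : Coord → Fin 2 → Fin 2 → ℝ} {f : Fin 2 → Fin 2 → Coord → ℝ} {c : ℝ}
    (hf : ∀ A B, Smooth e (f A B))
    (hθ : ∀ x ∈ intDom e, ∀ A B, θ x A B = (P.Ω x)⁻¹ * ((x 0 - x 1)⁻¹ ^ 2 * f A B x
      + c * (x 0 - x 1)⁻¹ ^ 3 * Q.gs x A B)) :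
    TensorExtends e E (fun x A B => R x * P.hatS θ x A B) := by
  refine fun a d => ⟨fun x => ∑ A, ∑ B, ρ x * (Q.Ω x)⁻¹
      * (f A B x - (1 / 2) * confTr Q f x * Q.gs x A B) * F a A x * F d B x,
    ContDiffOn.sum fun A _ => ContDiffOn.sum fun B _ => (((hρ.mul hQ.smooth_inv_lapse).mul
      ((hf A B).sub ((contDiffOn_const.mul (hQ.smooth_confTr hf)).mul
        (hQ.smooth_sphere A B)))).mul (hF a A)).mul (hF d B), fun x hx => ?_⟩
  have hs := sub_ne_zero_of_mem hx
  refine Finset.sum_congr rfl fun A _ => Finset.sum_congr rfl fun B _ => ?_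
  beta_reduce
  rw [hQ.hatS_eq hx (hθ x hx), hE a A x hx, hE d B x hx, hR x hx]
  field_simp

include hK

/-- The two forms differ by −2Ω̂²sK, so their difference is one order better than each shear. -/
theorem extends_hat_difference : TensorExtends e E
    (fun x A B => R x ^ 2 * (P.hatS P.chi x A B - P.hatS P.chib x A B)) := by
  refine fun a d => ⟨fun x => ∑ A, ∑ B, -(ρ x ^ 2 * (2 * Q.Ω x
      * (sphereHess K A B x - (1 / 2) * confTr Q (sphereHess K) x * Q.gs x A B))
        * F a A x * F d B x),
    ContDiffOn.sum fun A _ => ContDiffOn.sum fun B _ => ((((hρ.pow 2).mul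
      ((contDiffOn_const.mul hQ.smooth_lapse).mul ((hK.smooth_hess _ _).sub
        ((contDiffOn_const.mul (hQ.smooth_confTr fun A B => hK.smooth_hess _ _)).mul
          (hQ.smooth_sphere A B))))).mul (hF a A)).mul (hF d B)).neg, fun x hx => ?_⟩
  have hx' := intDom_subset_closedDom e hx
  have hs := sub_ne_zero_of_mem hx
  have hΩ := hQ.lapse_pos x hx'
  refine Finset.sum_congr rfl fun A _ => Finset.sum_congr rfl fun B _ => ?_
  beta_reduce
  rw [hQ.hatS_eq hx (hQ.chi_eq' hx), hQ.hatS_eq hx (hQ.chib_eq' hx), hE a A x hx, hE d B x hx,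
    hR x hx, hK.outForm_eq hQ hx', hK.confTr_outForm hQ hx']
  field_simp
  ring

theorem extends_etab : FormExtends e E (fun x A => R x ^ 2 * P.etab x A) := by
  refine fun a => ⟨fun x => ∑ A, ρ x ^ 2 * K 1 (ang A) x * F a A x,
    ContDiffOn.sum fun A _ => ((hρ.pow 2).mul (hK.smooth_hess _ _)).mul (hF a A), fun x hx => ?_⟩
  have hs := sub_ne_zero_of_mem hx
  refine Finset.sum_congr rfl fun A _ => ?_
  beta_reduce
  rw [hK.etab_eq' hQ hx, hE a A x hx, hR x hx]
  field_simp

/-- Obtained from (η + η̲) − η̲: the sum has order s², so η has the order of η̲. -/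
theorem extends_eta : FormExtends e E (fun x A => R x ^ 2 * P.eta x A) := by
  refine fun a => ⟨fun x => ∑ A, -(ρ x ^ 2 * (K 1 (ang A) x
      + (x 0 - x 1) * (Q.Ω x ^ 2 * pd (closedDom e) (ang A) N x)) * F a A x),
    ContDiffOn.sum fun A _ => (((hρ.pow 2).mul ((hK.smooth_hess _ _).add
      ((smooth_defining e).mul ((hQ.smooth_lapse.pow 2).mul (hK.smooth_norm.pd _))))).mul
        (hF a A)).neg, fun x hx => ?_⟩
  have hs := sub_ne_zero_of_mem hx
  refine Finset.sum_congr rfl fun A _ => ?_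
  have h1 : P.eta x A = (P.eta x A + P.etab x A) - P.etab x A := by ring
  beta_reduce
  rw [h1, hK.eta_add_etab_eq hQ hx, hK.etab_eq' hQ hx, hE a A x hx, hR x hx]
  field_simp
  ring

theorem extends_eta_add_etab :
    FormExtends e E (fun x A => R x ^ 3 * (P.eta x A + P.etab x A)) := by
  refine fun a => ⟨fun x => ∑ A, -(ρ x ^ 3 * (Q.Ω x ^ 2 * pd (closedDom e) (ang A) N x) * F a A x),
    ContDiffOn.sum fun A _ => (((hρ.pow 3).mul ((hQ.smooth_lapse.pow 2).mul
      (hK.smooth_norm.pd _))).mul (hF a A)).neg, fun x hx => ?_⟩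
  have hs := sub_ne_zero_of_mem hx
  refine Finset.sum_congr rfl fun A _ => ?_
  beta_reduce
  rw [hK.eta_add_etab_eq hQ hx, hE a A x hx, hR x hx]
  field_simp

end Frame

end HasExpansion

theorem ExtendsSmoothly.congr {e : SChart} {f g : Coord → ℝ} (hf : ExtendsSmoothly e f)
    (h : ∀ x, g x = f x) : ExtendsSmoothly e g := by
  rwa [funext h]

theorem ExtendsSmoothly.const_mul {e : SChart} {f : Coord → ℝ} (hf : ExtendsSmoothly e f)
    (c : ℝ) : ExtendsSmoothly e (fun x => c * f x) := by
  obtain ⟨F, hF, h⟩ := hf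
  exact ⟨fun x => c * F x, contDiffOn_const.mul hF, fun x hx => by
    beta_reduce
    rw [h x hx]⟩

end AAdS

end

/-! ### Assembly of the theorem -/

theorem proposition2p1 (M k : ℝ) (hM : 0 < M) (hk : 0 < k)
    (r : ℝ → ℝ) (hr : AAdS.IsAreaRadius M k r)
    (g : AAdS.DoubleNull) (hsmooth : g.IsSmooth) (hE : g.IsEinstein k)
    (hAdS : g.IsAsymptoticallyAdS)
    (e : AAdS.SChart) (he : e ∈ AAdS.charts)
    (P : AAdS.PatchData) (hP : P = g.inChart e)
    (R s : AAdS.Coord → ℝ) (hR : ∀ x, R x = r (x 1 - x 0)) (hs : ∀ x, s x = x 0 - x 1) :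
    -- scalar quantities: the lapse, Ricci coefficients, and null Weyl components
    AAdS.ExtendsSmoothly e (fun x => R x ^ 2 * (k ^ 2 * s x ^ 2 * P.Ω x ^ 2 - 1)) ∧
    AAdS.ExtendsSmoothly e (fun x => P.Ω x * P.trS P.chi x - 2 / s x) ∧
    AAdS.ExtendsSmoothly e (fun x => P.Ω x * P.trS P.chib x + 2 / s x) ∧
    AAdS.ExtendsSmoothly e (fun x => R x * (P.omega x - 1 / s x)) ∧
    AAdS.ExtendsSmoothly e (fun x => R x * (P.omegab x + 1 / s x)) ∧
    AAdS.ExtendsSmoothly e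
      (fun x => R x * (P.Ω x * P.trS P.chi x - P.Ω x * P.trS P.chib x - 4 / s x)) ∧
    AAdS.ExtendsSmoothly e (fun x => R x ^ 2 * (P.omega x + P.omegab x)) ∧
    AAdS.ExtendsSmoothly e (fun x => R x ^ 3 * P.rho x) ∧
    AAdS.ExtendsSmoothly e (fun x => R x ^ 3 * P.sigma x) ∧
    -- tensorial quantities: the components in an orthonormal frame
    ∀ E : Fin 2 → AAdS.Coord → Fin 2 → ℝ, AAdS.IsOrthonormalFrame e P E →
      AAdS.VectorExtends e P E (fun x A => (R x)⁻¹ * P.b x A) ∧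
      AAdS.TensorExtends e E (fun x A B => R x * P.hatS P.chi x A B) ∧
      AAdS.TensorExtends e E (fun x A B => R x * P.hatS P.chib x A B) ∧
      AAdS.FormExtends e E (fun x A => R x ^ 2 * P.eta x A) ∧
      AAdS.FormExtends e E (fun x A => R x ^ 2 * P.etab x A) ∧
      AAdS.TensorExtends e E
        (fun x A B => R x ^ 2 * (P.hatS P.chi x A B - P.hatS P.chib x A B)) ∧
      AAdS.FormExtends e E (fun x A => R x ^ 3 * (P.eta x A + P.etab x A)) ∧
      AAdS.TensorExtends e E (fun x A B => R x ^ 3 * P.alpha x A B) ∧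
      AAdS.TensorExtends e E (fun x A B => R x ^ 3 * P.alphab x A B) ∧
      AAdS.FormExtends e E (fun x A => R x ^ 3 * P.beta x A) ∧
      AAdS.FormExtends e E (fun x A => R x ^ 3 * P.betab x A) := by
  obtain ⟨Q, hQ⟩ := AAdS.DoubleNull.exists_isCompactification hAdS he
  have hE' := hE e he
  rw [← hP] at hQ hE'
  obtain ⟨N, K, hK⟩ := AAdS.exists_expansion hQ hE'
  obtain ⟨V, hV, hW⟩ := hK.exists_weyl_eq hQ hE'
  obtain ⟨V', hV', hW'⟩ := hQ.weylDual_eq hV hW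
  obtain ⟨ρ, hρ, hρ0, hρr⟩ := hr.exists_smooth_mul hM hk e
  have hRρ : ∀ x ∈ AAdS.intDom e, R x = ρ x / (x 0 - x 1) := fun x hx => by
    rw [hR, hρr x hx]
  obtain rfl : s = fun x => x 0 - x 1 := funext hs
  have h3 := hQ.isScaledField_e3
  have h4 := hQ.isScaledField_e4
  refine ⟨hK.extends_lapse hQ hρ hRρ, AAdS.HasExpansion.extends_trace_chi hQ,
    AAdS.HasExpansion.extends_trace_chib hQ, hK.extends_omega hQ hρ hRρ,
    hK.extends_omegab hQ hρ hRρ, hK.extends_trace_difference hQ hρ hRρ,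
    hK.extends_omega_add_omegab hQ hρ hRρ, ?_, ?_, fun E hEf => ?_⟩
  · refine ((AAdS.extendsSmoothly_apply4 hρ hRρ hV hW h4 h3 h4 h3).const_mul
      (1 / 4)).congr fun x => ?_
    rw [AAdS.PatchData.rho, hQ.dom]
    ring
  · refine ((AAdS.extendsSmoothly_apply4 hρ hRρ hV' hW' h4 h3 h4 h3).const_mul
      (1 / 4)).congr fun x => ?_
    rw [AAdS.PatchData.sigma, hQ.dom]
    ring
  -- F is the smooth extension of s⁻¹E, so E = sF in the interior and each frame vector carries one
  -- factor s.
  · choose F hF hFE using hEf.2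
    have hEF : ∀ a A, ∀ x ∈ AAdS.intDom e, E a x A = (x 0 - x 1) * F a A x := fun a A x hx => by
      rw [hFE a A x hx, mul_inv_cancel_left₀ (AAdS.sub_ne_zero_of_mem hx)]
    have hS : ∀ a, AAdS.IsScaledField e (AAdS.sphereField (E a)) := fun a =>
      AAdS.IsCompactification.isScaledField_sphereField (hF a) fun x hx A => hEF a A x hx
    refine ⟨AAdS.HasExpansion.extends_shift hQ hρ hRρ hF hEF hρ0,
      AAdS.HasExpansion.extends_hatS hQ hρ hRρ hF hEF hQ.smooth_outForm fun x hx => hQ.chi_eq' hx,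
      AAdS.HasExpansion.extends_hatS hQ hρ hRρ hF hEF hQ.smooth_inForm fun x hx => hQ.chib_eq' hx,
      hK.extends_eta hQ hρ hRρ hF hEF, hK.extends_etab hQ hρ hRρ hF hEF,
      hK.extends_hat_difference hQ hρ hRρ hF hEF, hK.extends_eta_add_etab hQ hρ hRρ hF hEF,
      fun a c => ?_, fun a c => ?_, fun a => ?_, fun a => ?_⟩
    · refine (AAdS.extendsSmoothly_apply4 hρ hRρ hV hW (hS a) h4 (hS c) h4).congr
        fun x => ?_
      rw [← AAdS.apply4_tensor]
      simp only [AAdS.PatchData.alpha, hQ.dom, Finset.mul_sum, mul_assoc]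
    · refine (AAdS.extendsSmoothly_apply4 hρ hRρ hV hW (hS a) h3 (hS c) h3).congr
        fun x => ?_
      rw [← AAdS.apply4_tensor]
      simp only [AAdS.PatchData.alphab, hQ.dom, Finset.mul_sum, mul_assoc]
    · refine ((AAdS.extendsSmoothly_apply4 hρ hRρ hV hW (hS a) h4 h3 h4).const_mul
        (1 / 2)).congr fun x => ?_
      rw [← AAdS.apply4_form]
      simp only [AAdS.PatchData.beta, hQ.dom, Fin.sum_univ_two]
      ring
    · refine ((AAdS.extendsSmoothly_apply4 hρ hRρ hV hW (hS a) h3 h3 h4).const_mul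
        (1 / 2)).congr fun x => ?_
      rw [← AAdS.apply4_form]
      simp only [AAdS.PatchData.betab, hQ.dom, Fin.sum_univ_two]
      ring
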